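/- **Machines.** A machine has finite control, a one-way read-only program tape and a one-way read-only auxiliary input tape (both with end markers), a one-way write-only output tape, and two binary stacks with push, pop and is-empty requests. A computation uses space $s$ if the sum of the sizes of the two stacks is at most $s$ at every moment, and $V(p,y)=x$ means that $V$ halts with output $x$ on program $p$ and auxiliary input $y$. For strings $x_1,y_1,\dots,x_k,y_k$ let $$C_V^s(x_1{\leftarrow}y_1;\dots;x_k{\leftarrow}y_k)=\min\{|p| : V(p,y_j)=x_j \text{ using space } s \text{ for all } j\le k\},$$ which is $+\infty$ if there is no such $p$. Let $U$ be an optimal machine: for each machine $V$ there is a constant $c_V$ such that $C_U^{s+c_V}(T)\le C_V^s(T)+c_V$ for all $s$ and all finite lists of tasks $T$. **Even complexity.** For a binary string $x=x_1x_2\cdots$ let $C_{\mathrm{ev}}^s(x)=C_U^s(x_2{\leftarrow}x_1;\;x_4{\leftarrow}x_1x_3;\;\dots)$, with one task for each $j\le |x|/2$. **Even semimeasures.** A function $P:\{0,1\}^*\to[0,1]$ is an even semimeasure if $P(x)=P(x0)=P(x1)$ whenever $|x|$ is even and $P(x)\ge P(x0)+P(x1)$ whenever $|x|$ is odd. **Complexity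 of a function.** For $F:\{0,1\}^*\to\mathbb R$ and $\tilde s:\mathbb N\times\mathbb N\to\mathbb N$, let $C^{\tilde s}(F)$ be the minimal length of a program on $U$ that for all $k\in\mathbb N$ and $x\in\{0,1\}^*$, on the input $(k,x)$ (coded as $0k_10k_2\cdots0k_\ell1x$, where $k_1\cdots k_\ell$ is $k$ in binary), uses space $\tilde s(k,|x|)$ and outputs in binary (a sign bit followed by the absolute value) an integer $N$ with $|F(x)-N2^{-k}|\le 2^{-k}$. It is $+\infty$ if there is no such program. **Proposition.** There is a constant $c$, depending only on $U$, such that for every $\tilde s:\mathbb N\times\mathbb N\to\mathbb N$ that is non-decreasing in both arguments, every even semimeasure $P_{\mathrm{ev}}$ and every binary string $x$ with $P_{\mathrm{ev}}(x)>0$, $$C_{\mathrm{ev}}^{s'}(x)\;\le\;\log_2\frac1{P_{\mathrm{ev}}(x)}+c\cdot\bigl(C^{\tilde s}(P_{\mathrm{ev}})+1\bigr),$$ where $s'=\tilde s\Bigl(\Bigl\lceil\log_2\frac{8|x|}{P_{\mathrm{ev}}(x)}\Bigr\rceil,|x|\Bigr)+|x|+c\lfloor\log_2|x|\rfloor$ (for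 the empty $x$, both logarithms in $s'$ are read as $0$). -/

import Mathlib

/-- One request of a stack machine with control states `Q`. The field `next` is the state
that follows; requests with an answer have one following state per answer.
The two stacks are numbered `0` and `1`. -/
inductive Request (Q : Type) : Type where
  /-- Read the next symbol of the program tape: a bit, or the end marker. -/
  | readProgram (onFalse onTrue onEnd : Q)
  /-- Read the next symbol of the auxiliary input tape: a bit, or the end marker. -/
  | readInput (onFalse onTrue onEnd : Q)
  /-- Append a bit to the output tape. -/
  | write (b : Bool) (next : Q)
  /-- Push a bit on a stack. -/
  | push (i : Fin 2) (b : Bool) (next : Q)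
  /-- Pop a bit from a stack; popping an empty stack changes nothing and goes to `onEmpty`. -/
  | pop (i : Fin 2) (onFalse onTrue onEmpty : Q)
  /-- Ask whether a stack is empty. -/
  | isEmpty (i : Fin 2) (onYes onNo : Q)
  /-- Stop. -/
  | halt

/-- A deterministic machine with finite control, a one-way read-only program tape and a one-way
read-only auxiliary input tape (both with end markers), a one-way write-only output tape, and two
binary stacks. -/
structure StackMachine : Type 1 where
  State : Type
  [finite : Finite State]
  start : State
  request : State → Request State

namespace StackMachine

/-- A configuration: the control state, the unread parts of the program and input tapes,
the two stacks (top element first), and the output written so far. -/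
@[ext] structure Config (M : StackMachine) : Type where
  state : M.State
  program : List Bool
  input : List Bool
  stack : Fin 2 → List Bool
  output : List Bool

/-- The memory in use: the sum of the sizes of the two stacks. -/
def Config.space {M : StackMachine} (a : M.Config) : ℕ :=
  (a.stack 0).length + (a.stack 1).length

/-- The initial configuration on program `p` and auxiliary input `y`. -/
def init (M : StackMachine) (p y : List Bool) : M.Config where
  state := M.start
  program := p
  input := y
  stack := fun _ => []
  output := []

/-- One step of the computation; `none` if the machine halts. -/
def step (M : StackMachine) (a : M.Config) : Option M.Config :=
  match M.request a.state with
  | .readProgram q₀ q₁ qe =>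
    match a.program with
    | [] => some { a with state := qe }
    | false :: l => some { a with state := q₀, program := l }
    | true :: l => some { a with state := q₁, program := l }
  | .readInput q₀ q₁ qe =>
    match a.input with
    | [] => some { a with state := qe }
    | false :: l => some { a with state := q₀, input := l }
    | true :: l => some { a with state := q₁, input := l }
  | .write b q => some { a with state := q, output := a.output ++ [b] }
  | .push i b q => some { a with state := q, stack := Function.update a.stack i (b :: a.stack i) }
  | .pop i q₀ q₁ qe =>
    match a.stack i with
    | [] => some { a with state := qe }
    | false :: l => some { a with state := q₀, stack := Function.update a.stack i l }
    | true :: l => some { a with state := q₁, stack := Function.update a.stack i l }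
  | .isEmpty i qy qn =>
    match a.stack i with
    | [] => some { a with state := qy }
    | _ :: _ => some { a with state := qn }
  | .halt => none

/-- `M.Computes s p y x`: on program `p` and auxiliary input `y`, the machine halts with
output `x`, and all configurations of the computation have space at most `s`
(the initial one has space `0`). -/
def Computes (M : StackMachine) (s : ℕ) (p y x : List Bool) : Prop :=
  ∃ a : M.Config,
    Relation.ReflTransGen (fun b b' : M.Config => M.step b = some b' ∧ b'.space ≤ s)
      (M.init p y) a ∧
    M.step a = none ∧ a.output = x

/-- The Kolmogorov complexity of a list of tasks `x₁ ← y₁; …; x_k ← y_k` with space bound `s`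
relative to `V`; the task `x ← y` is the pair `(x, y)`. It is `⊤` if there is no program. -/
noncomputable def complexity (V : StackMachine) (s : ℕ)
    (tasks : List (List Bool × List Bool)) : ℕ∞ :=
  ⨅ p ∈ {p : List Bool | ∀ t ∈ tasks, V.Computes s p t.2 t.1}, (p.length : ℕ∞)

/-- `U` is an optimal (universal) machine for space-bounded complexity of tasks: it simulates each
machine with constant overhead in program length and in space. -/
def IsOptimal (U : StackMachine) : Prop :=
  ∀ V : StackMachine, ∃ c : ℕ, ∀ (s : ℕ) (tasks : List (List Bool × List Bool)),
    U.complexity (s + c) tasks ≤ V.complexity s tasks + c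

/-- The tasks `x₂ ← x₁; x₄ ← x₁x₃; x₆ ← x₁x₃x₅; …`, one for each `j ≤ |x| / 2`
(positions of the string `x` are counted from `1` here and from `0` in Lean). -/
def evenTasks (x : List Bool) : List (List Bool × List Bool) :=
  List.ofFn fun j : Fin (x.length / 2) =>
    ([x[2 * j.1 + 1]'(by omega)],
      List.ofFn fun i : Fin (j.1 + 1) => x[2 * i.1]'(by omega))

/-- The even complexity of `x` with space bound `s`. -/
noncomputable def evenComplexity (U : StackMachine) (s : ℕ) (x : List Bool) : ℕ∞ :=
  U.complexity s (evenTasks x)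

/-- Binary notation of a natural number, most significant bit first (empty for `0`). -/
def natCode (n : ℕ) : List Bool := n.bits.reverse

/-- Binary notation of an integer: a sign bit (`true` for negative numbers),
followed by the absolute value. -/
def intCode (N : ℤ) : List Bool := decide (N < 0) :: natCode N.natAbs

/-- The prefix code `0 y₁ 0 y₂ ⋯ 0 y_n 1` of a string `y`. -/
def prefixCode (y : List Bool) : List Bool := y.flatMap (fun b => [false, b]) ++ [true]

/-- The code of the pair of strings `(y, z)`. -/
def pairCode (y z : List Bool) : List Bool := prefixCode y ++ z

/-- The program `p` approximates `F` within space `s`: on input `(k, x)`, with `k` in binary, it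
uses space at most `s k |x|` and outputs an integer `N` with `|F x - N 2⁻ᵏ| ≤ 2⁻ᵏ`. -/
def Approximates (U : StackMachine) (s : ℕ → ℕ → ℕ) (p : List Bool) (F : List Bool → ℝ) : Prop :=
  ∀ (k : ℕ) (x : List Bool), ∃ N : ℤ,
    |F x - (N : ℝ) / 2 ^ k| ≤ 1 / 2 ^ k ∧
    U.Computes (s k x.length) p (pairCode (natCode k) x) (intCode N)

/-- The complexity of a real-valued function `F` on strings with space bound `s`: the minimal
length of a program that approximates `F` within space `s`, or `⊤` if there is none. -/
noncomputable def functionComplexity (U : StackMachine) (s : ℕ → ℕ → ℕ)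
    (F : List Bool → ℝ) : ℕ∞ :=
  ⨅ p ∈ {p : List Bool | U.Approximates s p F}, (p.length : ℕ∞)

end StackMachine

/-- Even semimeasures on binary strings. -/
structure IsEvenSemimeasure (P : List Bool → ℝ) : Prop where
  nonneg : ∀ x, 0 ≤ P x
  le_one : ∀ x, P x ≤ 1
  of_even : ∀ x : List Bool, Even x.length → ∀ b : Bool, P (x ++ [b]) = P x
  of_odd : ∀ x : List Bool, Odd x.length → P (x ++ [false]) + P (x ++ [true]) ≤ P x

/-! The proof is arithmetic coding with careful space accounting. Read x as pairs y_i e_i of an odd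
and an even bit, let m = ⌊|x|/2⌋, let μ_i be the value of P after i pairs, and let a_i be the sum of
P(y_0 e_0 ⋯ y_k 0) over all k < i with e_k = 1. The intervals [a_i, a_i + μ_i] are nested, because
an odd bit does not change P and the two values of an even bit share the old mass (`mass_succ_add`,
`lowerEnd_mono`, `upperEnd_anti`). A binary fraction w with about log(1/μ_q) digits in the middle
half of the q-th interval (`exists_codeword`) therefore determines e_0, …, e_{q-1} from the odd
bits. Finding e_{j-1} needs only y_0, …, y_{j-1}, so one program serves all tasks.

The decoder scales by 2^k with k = |w| + O(log j) and keeps the remainder r_i ≈ (w - a_i) 2^k. It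
computes an approximation N of the scaled mass of the 0-branch. If N ≤ r_i the bit is 1 and N is
subtracted, otherwise the bit is 0. Each N is off by at most 1, so the error stays below j, whereas
w is 2^k μ_q/4 > j away from the ends of its interval (`decoding_correct`). The bound 2^k μ_q ≤ 16 m
explains the precision log(8|x|/P(x)).

Besides the space of the program p that approximates P, only |x| + O(log |x|) bits are available,
with leading constant one. So N is never stored: each of its digits is recomputed by running p again
(`sexec_getBit`). The strings in memory are stacked without delimiters, and their lengths are kept
in counters of logarithmic size (`cexec_shift`, `cexec_focus`). At stage i the memory holds p, the
2i bits decoded so far, j - i unused odd bits, and r_i, which has about log(μ_i/μ_q) + log j digits.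
If q maximizes μ_i 2^i, this logarithm is at most q - i, and the total is about |p| + j + q
(`sexec_decodeLast_of_mass`).

The even bits after the first q pairs are listed literally. This loses nothing, since μ_m 2^m ≤ μ_q
2^q, except that announcing q and m - q costs about 4 log m bits. If |p| ≥ log m, a multiple of |p|
pays for that and for restricting q to at most m - |p|. Otherwise either the gain μ_q 2^q / (μ_m
2^m) pays, or it is below 2^(4 log m), and then decoding all m pairs costs only O(log m) more space.
When P(x) is tiny, all even bits are listed (`exists_program`). Optimality of U transfers the bound
from the decoding machine to U. -/

/-! ### Machine programs as composable fragments -/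

/-- Rename the states of a request. -/
def Request.map {Q Q' : Type} (g : Q → Q') : Request Q → Request Q'
  | .readProgram a b e => .readProgram (g a) (g b) (g e)
  | .readInput a b e => .readInput (g a) (g b) (g e)
  | .write b q => .write b (g q)
  | .push i b q => .push i b (g q)
  | .pop i a b e => .pop i (g a) (g b) (g e)
  | .isEmpty i a b => .isEmpty i (g a) (g b)
  | .halt => .halt

namespace StackMachine

/-- A configuration without its control state. -/
structure Store where
  program : List Bool
  input : List Bool
  stack : Fin 2 → List Bool
  output : List Bool

/-- The memory in use: the sum of the sizes of the two stacks. -/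
def Store.space (σ : Store) : ℕ := (σ.stack 0).length + (σ.stack 1).length

/-- The memory part of a configuration. -/
def Config.store {M : StackMachine} (a : M.Config) : Store :=
  ⟨a.program, a.input, a.stack, a.output⟩

end StackMachine

open StackMachine

/-- The effect of a request on a store. -/
def Request.act {Q : Type} (r : Request Q) (σ : Store) : Option (Q × Store) :=
  match r with
  | .readProgram q₀ q₁ qe =>
    match σ.program with
    | [] => some (qe, σ)
    | false :: l => some (q₀, { σ with program := l })
    | true :: l => some (q₁, { σ with program := l })
  | .readInput q₀ q₁ qe =>
    match σ.input with
    | [] => some (qe, σ)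
    | false :: l => some (q₀, { σ with input := l })
    | true :: l => some (q₁, { σ with input := l })
  | .write b q => some (q, { σ with output := σ.output ++ [b] })
  | .push i b q => some (q, { σ with stack := Function.update σ.stack i (b :: σ.stack i) })
  | .pop i q₀ q₁ qe =>
    match σ.stack i with
    | [] => some (qe, σ)
    | false :: l => some (q₀, { σ with stack := Function.update σ.stack i l })
    | true :: l => some (q₁, { σ with stack := Function.update σ.stack i l })
  | .isEmpty i qy qn =>
    match σ.stack i with
    | [] => some (qy, σ)
    | _ :: _ => some (qn, σ)
  | .halt => none

/-- The effect on the store does not depend on the names of the following states, so runs can be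
transported along maps of states. All composition of fragments rests on this. -/
theorem Request.act_map {Q Q' : Type} (g : Q → Q') (r : Request Q) (σ : Store) :
    (r.map g).act σ = (r.act σ).map (fun c : Q × Store => (g c.1, c.2)) := by
  cases r <;> simp only [Request.map, Request.act] <;> (try rfl) <;> split <;> rfl

theorem StackMachine.step_eq_act (M : StackMachine) (a : M.Config) :
    M.step a = ((M.request a.state).act a.store).map fun c : M.State × Store =>
      ⟨c.1, c.2.program, c.2.input, c.2.stack, c.2.output⟩ := by
  obtain ⟨st, pr, inp, stk, out⟩ := a
  simp only [StackMachine.step, Config.store]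
  cases M.request st <;> simp only [Request.act]
  case write => rfl
  case push => rfl
  case halt => rfl
  case readProgram => rcases pr with _ | ⟨_ | _, l⟩ <;> rfl
  case readInput => rcases inp with _ | ⟨_ | _, l⟩ <;> rfl
  case pop i _ _ _ => rcases stk i with _ | ⟨_ | _, l⟩ <;> simp
  case isEmpty i _ _ => rcases stk i with _ | ⟨_ | _, l⟩ <;> simp

/-- A program fragment that returns values in `β`: a finite control whose transitions lead to
other control states or out of the fragment. -/
structure Frag (β : Type) : Type 1 where
  State : Type
  [finite : Finite State]
  start : State
  request : State → Request (State ⊕ β)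

namespace Frag

attribute [instance] Frag.finite

variable {α β : Type}

/-- One step of a fragment within space `s`. -/
def Step (F : Frag β) (s : ℕ) (c c' : (F.State ⊕ β) × Store) : Prop :=
  ∃ q, c.1 = .inl q ∧ (F.request q).act c.2 = some c' ∧ c'.2.space ≤ s

/-- The fragment `F`, entered with the store `σ`, returns `b` with the store `σ'`,
within space `s`. -/
def Runs (F : Frag β) (s : ℕ) (σ : Store) (b : β) (σ' : Store) : Prop :=
  Relation.ReflTransGen (F.Step s) (.inl F.start, σ) (.inr b, σ')

/-- Sequencing and looping embed the control of a part into a larger control, where a returned value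
may become a start state. A run of the part then is a run of the whole. -/
theorem lift_steps {γ : Type} {F : Frag β} {G : Frag γ} {s : ℕ} (g : F.State ⊕ β → G.State ⊕ γ)
    (hg : ∀ q, ∃ q', g (.inl q) = .inl q' ∧ G.request q' = (F.request q).map g)
    {c c' : (F.State ⊕ β) × Store} (h : Relation.ReflTransGen (F.Step s) c c') :
    Relation.ReflTransGen (G.Step s) (g c.1, c.2) (g c'.1, c'.2) := by
  refine Relation.ReflTransGen.lift
    (fun c : (F.State ⊕ β) × Store => (g c.1, c.2)) ?_ _ _ h
  rintro ⟨_, σ⟩ ⟨d, σ'⟩ ⟨q, rfl, h1, h2⟩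
  obtain ⟨q', e1, e2⟩ := hg q
  refine ⟨q', e1, ?_, h2⟩
  simp only at h1 ⊢
  rw [e2, Request.act_map, h1]
  rfl

/-- The fragment consisting of a single request. -/
def single (r : Request β) : Frag β where
  State := Unit
  start := ()
  request _ := r.map .inr

theorem runs_single {r : Request β} {s : ℕ} {σ σ' : Store} {b : β}
    (h : r.act σ = some (b, σ')) (hs : σ'.space ≤ s) : (single r).Runs s σ b σ' := by
  refine Relation.ReflTransGen.single ⟨(), rfl, ?_, hs⟩
  simp [single, Request.act_map, h]

/-- Return `b`. -/
def pure (b : β) : Frag β := single (.isEmpty 0 b b)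

/-- Sequential composition. -/
def bind [Finite α] (F : Frag α) (G : α → Frag β) : Frag β where
  State := F.State ⊕ (Σ a, (G a).State)
  start := .inl F.start
  request
    | .inl q => (F.request q).map
        (Sum.elim (fun q' => .inl (.inl q')) (fun a => .inl (.inr ⟨a, (G a).start⟩)))
    | .inr ⟨a, q⟩ => ((G a).request q).map (Sum.map (fun q' => .inr ⟨a, q'⟩) id)

theorem runs_bind [Finite α] {F : Frag α} {G : α → Frag β} {s : ℕ} {σ σ₁ σ₂ : Store} {a : α}
    {b : β} (h₁ : F.Runs s σ a σ₁) (h₂ : (G a).Runs s σ₁ b σ₂) : (F.bind G).Runs s σ b σ₂ := by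
  have e₁ := lift_steps (G := F.bind G)
    (Sum.elim (fun q' => .inl (.inl q')) (fun a => .inl (.inr ⟨a, (G a).start⟩)))
    (fun q => ⟨.inl q, rfl, rfl⟩) h₁
  have e₂ := lift_steps (G := F.bind G) (Sum.map (fun q' => .inr ⟨a, q'⟩) id)
    (fun q => ⟨.inr ⟨a, q⟩, rfl, rfl⟩) h₂
  exact e₁.trans e₂

/-- Repeat the fragment `G a`, where `a` is updated as long as the fragment returns a value in the
left summand. -/
def loop [Finite α] (G : α → Frag (α ⊕ β)) (a : α) : Frag β where
  State := Σ a, (G a).State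
  start := ⟨a, (G a).start⟩
  request q := ((G q.1).request q.2).map
    (Sum.elim (fun q' => .inl ⟨q.1, q'⟩) (Sum.map (fun a' => ⟨a', (G a').start⟩) id))

theorem runs_loop_body [Finite α] {G : α → Frag (α ⊕ β)} {s : ℕ} {σ σ₁ : Store} {a a₀ : α}
    {b : α ⊕ β} (h₁ : (G a).Runs s σ b σ₁) :
    Relation.ReflTransGen ((loop G a₀).Step s) (.inl ⟨a, (G a).start⟩, σ)
      (Sum.map (fun a' => ⟨a', (G a').start⟩) id b, σ₁) :=
  lift_steps (G := loop G a₀)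
    (Sum.elim (fun q' => .inl ⟨a, q'⟩) (Sum.map (fun a' => ⟨a', (G a').start⟩) id))
    (fun q => ⟨⟨a, q⟩, rfl, rfl⟩) h₁

theorem runs_loop_done [Finite α] {G : α → Frag (α ⊕ β)} {s : ℕ} {σ σ₁ : Store} {a : α} {b : β}
    (h₁ : (G a).Runs s σ (.inr b) σ₁) : (loop G a).Runs s σ b σ₁ :=
  runs_loop_body (a₀ := a) h₁

theorem runs_loop_next [Finite α] {G : α → Frag (α ⊕ β)} {s : ℕ} {σ σ₁ σ₂ : Store} {a a' : α}
    {b : β} (h₁ : (G a).Runs s σ (.inl a') σ₁) (h₂ : (loop G a').Runs s σ₁ b σ₂) :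
    (loop G a).Runs s σ b σ₂ :=
  (runs_loop_body (a₀ := a) h₁).trans h₂

/-- The stack machine that executes a fragment and halts. -/
def machine (F : Frag Unit) : StackMachine where
  State := F.State ⊕ Unit
  start := .inl F.start
  request
    | .inl q => F.request q
    | .inr _ => .halt

theorem step_machine {F : Frag Unit} {s : ℕ} {a a' : F.machine.Config}
    (h : F.Step s (a.state, a.store) (a'.state, a'.store)) :
    F.machine.step a = some a' ∧ a'.space ≤ s := by
  obtain ⟨q, h1, h2, h3⟩ := h
  refine ⟨?_, h3⟩
  rw [step_eq_act]
  simp only at h1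
  rw [h1]
  have : F.machine.request (Sum.inl q) = F.request q := rfl
  rw [this]
  exact congrArg (Option.map _) h2

theorem computes_machine {F : Frag Unit} {s : ℕ} {p y : List Bool} {σ : Store}
    (h : F.Runs s ⟨p, y, fun _ => [], []⟩ () σ) : F.machine.Computes s p y σ.output := by
  refine ⟨⟨.inr (), σ.program, σ.input, σ.stack, σ.output⟩, ?_, rfl, rfl⟩
  have := Relation.ReflTransGen.lift (p := fun b b' : F.machine.Config =>
      F.machine.step b = some b' ∧ b'.space ≤ s)
    (fun c : (F.State ⊕ Unit) × Store =>
      (⟨c.1, c.2.program, c.2.input, c.2.stack, c.2.output⟩ : F.machine.Config))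
    (fun a b hab => step_machine hab) _ _ h
  exact this

/-- The fragment `F`, entered with any store of space at most `s` that represents `a`, returns `b`
with a store that represents `a'`, within space `s`. -/
def Exec {A : Type} (R : A → Store → Prop) (s : ℕ) (F : Frag β) (a : A) (b : β) (a' : A) : Prop :=
  ∀ σ, R a σ → σ.space ≤ s → ∃ σ', R a' σ' ∧ σ'.space ≤ s ∧ F.Runs s σ b σ'

section Exec

variable {A : Type} {R : A → Store → Prop} {s : ℕ} {a₀ a₁ a₂ : A}

theorem exec_pure (b : β) : Exec R s (pure b) a₀ b a₀ := by
  intro σ hσ hs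
  refine ⟨σ, hσ, hs, runs_single ?_ hs⟩
  simp only [Request.act]
  split <;> rfl

/-- The store between the two parts is known only up to representation. This suffices because the
second hypothesis covers every store that represents the middle state. -/
theorem Exec.bind [Finite α] {F : Frag α} {G : α → Frag β} {x : α} {b : β}
    (h₁ : Exec R s F a₀ x a₁) (h₂ : Exec R s (G x) a₁ b a₂) : Exec R s (F.bind G) a₀ b a₂ := by
  intro σ hσ hs
  obtain ⟨σ₁, r₁, s₁, e₁⟩ := h₁ σ hσ hs
  obtain ⟨σ₂, r₂, s₂, e₂⟩ := h₂ σ₁ r₁ s₁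
  exact ⟨σ₂, r₂, s₂, runs_bind e₁ e₂⟩

theorem Exec.done [Finite α] {G : α → Frag (α ⊕ β)} {x : α} {b : β}
    (h₁ : Exec R s (G x) a₀ (.inr b) a₁) : Exec R s (loop G x) a₀ b a₁ := by
  intro σ hσ hs
  obtain ⟨σ₁, r₁, s₁, e₁⟩ := h₁ σ hσ hs
  exact ⟨σ₁, r₁, s₁, runs_loop_done e₁⟩

theorem Exec.next [Finite α] {G : α → Frag (α ⊕ β)} {x x' : α} {b : β}
    (h₁ : Exec R s (G x) a₀ (.inl x') a₁) (h₂ : Exec R s (loop G x') a₁ b a₂) :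
    Exec R s (loop G x) a₀ b a₂ := by
  intro σ hσ hs
  obtain ⟨σ₁, r₁, s₁, e₁⟩ := h₁ σ hσ hs
  obtain ⟨σ₂, r₂, s₂, e₂⟩ := h₂ σ₁ r₁ s₁
  exact ⟨σ₂, r₂, s₂, runs_loop_next e₁ e₂⟩

end Exec

/-- Read a symbol of the program tape; `none` stands for the end marker. -/
def readProgram : Frag (Option Bool) := single (.readProgram (some false) (some true) none)

/-- Read a symbol of the input tape; `none` stands for the end marker. -/
def readInput : Frag (Option Bool) := single (.readInput (some false) (some true) none)

/-- Write a bit on the output tape. -/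
def write (b : Bool) : Frag Unit := single (.write b ())

/-- Push a bit on a stack. -/
def push (i : Fin 2) (b : Bool) : Frag Unit := single (.push i b ())

/-- Pop a bit from a stack; `none` if it is empty. -/
def pop (i : Fin 2) : Frag (Option Bool) := single (.pop i (some false) (some true) none)

theorem runs_readProgram {σ : Store} {s : ℕ} (h : σ.space ≤ s) :
    readProgram.Runs s σ σ.program.head? { σ with program := σ.program.tail } := by
  refine runs_single ?_ h
  obtain ⟨pr, inp, stk, out⟩ := σ
  rcases pr with _ | ⟨_ | _, l⟩ <;> rfl

theorem runs_readInput {σ : Store} {s : ℕ} (h : σ.space ≤ s) :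
    readInput.Runs s σ σ.input.head? { σ with input := σ.input.tail } := by
  refine runs_single ?_ h
  obtain ⟨pr, inp, stk, out⟩ := σ
  rcases inp with _ | ⟨_ | _, l⟩ <;> rfl

theorem runs_write {σ : Store} {s : ℕ} (b : Bool) (h : σ.space ≤ s) :
    (write b).Runs s σ () { σ with output := σ.output ++ [b] } :=
  runs_single rfl h

theorem runs_push {σ : Store} {s : ℕ} (i : Fin 2) (b : Bool) (h : σ.space + 1 ≤ s) :
    (push i b).Runs s σ () { σ with stack := Function.update σ.stack i (b :: σ.stack i) } := by
  refine runs_single rfl ?_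
  fin_cases i <;> simp [Store.space] at h ⊢ <;> omega

theorem runs_pop {σ : Store} {s : ℕ} (i : Fin 2) (h : σ.space ≤ s) :
    (pop i).Runs s σ (σ.stack i).head?
      { σ with stack := Function.update σ.stack i (σ.stack i).tail } := by
  refine runs_single ?_ ?_
  · obtain ⟨pr, inp, stk, out⟩ := σ
    simp only [Request.act]
    split
    next h => simp [h]
    next h => simp [h]
    next h => simp [h]
  · fin_cases i <;> simp [Store.space] at h ⊢ <;> omega

end Frag

/-! ### Elementary operations on the two stacks -/

namespace StackMachine

/-- The store `σ` with contents `u` of stack `i` and `v` of the other stack. -/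
def Store.put (σ : Store) (i : Fin 2) (u v : List Bool) : Store :=
  { σ with stack := fun k => if k = i then u else v }

/-- In `Fin 2` the stack other than `i` is `1 - i`. Changing the point of view makes every lemma
about one stack available for the other. -/
theorem Store.put_swap (σ : Store) (i : Fin 2) (u v : List Bool) :
    σ.put i u v = σ.put (1 - i) v u := by
  simp only [Store.put]
  congr 1
  funext k
  revert k i
  simp [Fin.forall_fin_two]

theorem Store.put_stack (σ : Store) : σ.put 1 (σ.stack 1) (σ.stack 0) = σ := by
  obtain ⟨pr, inp, stk, out⟩ := σ
  simp only [Store.put]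
  congr 1
  funext k
  revert k
  simp [Fin.forall_fin_two]

@[simp] theorem Store.space_put (σ : Store) (i : Fin 2) (u v : List Bool) :
    (σ.put i u v).space = u.length + v.length := by
  revert i
  simp [Fin.forall_fin_two, Store.put, Store.space, add_comm]

end StackMachine

namespace Frag

theorem exec_eq {β : Type} {F : Frag β} {s : ℕ} {σ σ' : Store} {b : β}
    (h : F.Runs s σ b σ') (hs : σ'.space ≤ s) : Exec Eq s F σ b σ' := by
  rintro _ rfl -
  exact ⟨σ', rfl, hs, h⟩

theorem update_put (σ : Store) (i : Fin 2) (u u' v : List Bool) :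
    { σ.put i u v with stack := Function.update (σ.put i u v).stack i u' } = σ.put i u' v := by
  simp only [Store.put]
  congr 1
  funext k
  by_cases hk : k = i <;> simp [hk]

section Stacks

variable {s : ℕ} {σ : Store} {i : Fin 2} {u v : List Bool}

theorem exec_push_put (b : Bool) (h : u.length + v.length + 1 ≤ s) :
    Exec Eq s (push i b) (σ.put i u v) () (σ.put i (b :: u) v) := by
  have h' := runs_push (σ := σ.put i u v) i b (by simpa using h)
  have e : (σ.put i u v).stack i = u := by simp [Store.put]
  rw [e, update_put] at h'
  exact exec_eq h' (by simp; omega)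

theorem exec_pop_put (h : u.length + v.length ≤ s) :
    Exec Eq s (pop i) (σ.put i u v) u.head? (σ.put i u.tail v) := by
  have h' := runs_pop (σ := σ.put i u v) i (by simpa using h)
  have e : (σ.put i u v).stack i = u := by simp [Store.put]
  rw [e, update_put] at h'
  exact exec_eq h' (by simp; omega)

/-- Push a list on a stack, such that its head becomes the top. -/
def pushList (i : Fin 2) : List Bool → Frag Unit
  | [] => pure ()
  | b :: l => (pushList i l).bind fun _ => push i b

theorem exec_pushList (l : List Bool) (h : l.length + u.length + v.length ≤ s) :
    Exec Eq s (pushList i l) (σ.put i u v) () (σ.put i (l ++ u) v) := by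
  induction l with
  | nil => exact exec_pure ()
  | cons b l ih =>
    simp only [List.length_cons] at h
    exact (ih (by omega)).bind (exec_push_put b (by simp; omega))

/-- Pop `n` bits from a stack. -/
def popBits (i : Fin 2) : (n : ℕ) → Frag (Fin n → Bool)
  | 0 => pure Fin.elim0
  | n + 1 => (pop i).bind fun o => (popBits i n).bind fun w =>
      pure (Fin.cons (o.getD false) w : Fin (n + 1) → Bool)

theorem exec_popBits {n : ℕ} (w : Fin n → Bool) (h : n + u.length + v.length ≤ s) :
    Exec Eq s (popBits i n) (σ.put i (List.ofFn w ++ u) v) w (σ.put i u v) := by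
  induction n with
  | zero =>
    have : w = Fin.elim0 := Subsingleton.elim _ _
    subst this
    exact exec_pure _
  | succ n ih =>
    have h1 := exec_pop_put (s := s) (σ := σ) (i := i) (u := List.ofFn w ++ u) (v := v)
      (by simp; omega)
    rw [List.ofFn_succ] at h1 ⊢
    refine h1.bind ((ih (fun k => w k.succ) (by omega)).bind ?_)
    have : (Fin.cons ((w 0 :: (List.ofFn (fun k => w k.succ)) ++ u).head?.getD false)
        (fun k => w k.succ) : Fin (n + 1) → Bool) = w := by
      funext k
      refine Fin.cases ?_ (fun k => ?_) k <;> simp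
    rw [this]
    exact exec_pure _

end Stacks

/-! ### Finite transducers acting on blocks of columns -/

/-- The final state of a transducer and its output. -/
def transduce {ι Q : Type} (f : Q → (ι → Bool) → Q × (ι → Bool)) (q : Q) :
    List (ι → Bool) → Q × List (ι → Bool)
  | [] => (q, [])
  | c :: l => ((transduce f (f q c).1 l).1, (f q c).2 :: (transduce f (f q c).1 l).2)

@[simp] theorem length_transduce {ι Q : Type} (f : Q → (ι → Bool) → Q × (ι → Bool)) (q : Q)
    (l : List (ι → Bool)) : (transduce f q l).2.length = l.length := by
  induction l generalizing q with
  | nil => rfl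
  | cons c l ih => simp [transduce, ih]

section Tokens

variable {ι : Type} [Fintype ι]

/-- The number of bits of a token. -/
def tokenWidth (ι : Type) [Fintype ι] : ℕ := Fintype.card (Option ι)

/-- The bits of a token: a column of bits indexed by `ι`, or an end marker. -/
noncomputable def tokenBits (o : Option (ι → Bool)) : Fin (tokenWidth ι) → Bool := fun k =>
  match o with
  | none => false
  | some c => ((Fintype.equivFin (Option ι)).symm k).elim true c

/-- The token with the given bits. -/
noncomputable def tokenOfBits (w : Fin (tokenWidth ι) → Bool) : Option (ι → Bool) :=
  if w (Fintype.equivFin (Option ι) none) then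
    some fun x => w (Fintype.equivFin (Option ι) (some x))
  else none

/-- The bit at `none` separates the two kinds of token: it is set for a column and clear for an end
marker. -/
theorem tokenOfBits_tokenBits (o : Option (ι → Bool)) : tokenOfBits (tokenBits o) = o := by
  cases o <;> simp [tokenOfBits, tokenBits]

/-- The code of a token. -/
noncomputable def tokenCode (o : Option (ι → Bool)) : List Bool := List.ofFn (tokenBits o)

@[simp] theorem length_tokenCode (o : Option (ι → Bool)) :
    (tokenCode o).length = tokenWidth ι := by
  simp [tokenCode]

/-- The code of the end marker. -/
noncomputable abbrev endCode (ι : Type) [Fintype ι] : List Bool :=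
  tokenCode (none : Option (ι → Bool))

/-- The code of a list of columns. -/
noncomputable def columnsCode (l : List (ι → Bool)) : List Bool :=
  l.flatMap fun c => tokenCode (some c)

@[simp] theorem columnsCode_nil : columnsCode ([] : List (ι → Bool)) = [] := rfl

@[simp] theorem columnsCode_cons (c : ι → Bool) (l : List (ι → Bool)) :
    columnsCode (c :: l) = tokenCode (some c) ++ columnsCode l := rfl

@[simp] theorem columnsCode_append (l l' : List (ι → Bool)) :
    columnsCode (l ++ l') = columnsCode l ++ columnsCode l' := by
  simp [columnsCode]

@[simp] theorem length_columnsCode (l : List (ι → Bool)) :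
    (columnsCode l).length = tokenWidth ι * l.length := by
  induction l with
  | nil => rfl
  | cons c l ih => simp [ih]; ring

/-- Push a token. -/
noncomputable def pushToken (i : Fin 2) (o : Option (ι → Bool)) : Frag Unit :=
  pushList i (tokenCode o)

/-- Pop a token. -/
noncomputable def popToken (ι : Type) [Fintype ι] (i : Fin 2) : Frag (Option (ι → Bool)) :=
  (popBits i (tokenWidth ι)).bind fun w => pure (tokenOfBits w)

variable {s : ℕ} {σ : Store} {i : Fin 2} {u v : List Bool}

theorem exec_pushToken (o : Option (ι → Bool)) (h : tokenWidth ι + u.length + v.length ≤ s) :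
    Exec Eq s (pushToken i o) (σ.put i u v) () (σ.put i (tokenCode o ++ u) v) :=
  exec_pushList _ (by simpa using h)

theorem exec_popToken (o : Option (ι → Bool)) (h : tokenWidth ι + u.length + v.length ≤ s) :
    Exec Eq s (popToken ι i) (σ.put i (tokenCode o ++ u) v) o (σ.put i u v) := by
  refine (exec_popBits (tokenBits o) h).bind ?_
  rw [tokenOfBits_tokenBits]
  exact exec_pure o

variable {Q : Type} [Finite Q]

/-- Move the columns on top of a stack to the other stack, transforming them on the way with the
finite transducer `f`. -/
noncomputable def sweep (i : Fin 2) (f : Q → (ι → Bool) → Q × (ι → Bool)) (q : Q) : Frag Q :=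
  loop (fun q => (popToken ι i).bind fun t =>
    match t with
    | none => pure (.inr q)
    | some c => (pushToken (1 - i) (some (f q c).2)).bind fun _ => pure (.inl (f q c).1)) q

/-- The end marker stops the sweep, so `u` may be arbitrary. Each column is pushed above the
previous ones, whence the reversal. -/
theorem exec_sweep (f : Q → (ι → Bool) → Q × (ι → Bool)) (q : Q) (l : List (ι → Bool))
    (h : tokenWidth ι * (l.length + 1) + u.length + v.length ≤ s) :
    Exec Eq s (sweep i f q) (σ.put i (columnsCode l ++ (endCode ι ++ u)) v)
      (transduce f q l).1
      (σ.put i u (columnsCode (transduce f q l).2.reverse ++ v)) := by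
  induction l generalizing q v with
  | nil => exact Exec.done ((exec_popToken none (by simp at h; omega)).bind (exec_pure _))
  | cons c l ih =>
    simp only [List.length_cons, mul_add, mul_one] at h
    simp only [columnsCode_cons, List.append_assoc]
    refine Exec.next (x' := (f q c).1) ((exec_popToken (some c) (by simp; omega)).bind ?_)
      (a₁ := σ.put i (columnsCode l ++ (endCode ι ++ u)) (tokenCode (some (f q c).2) ++ v)) ?_
    · refine Exec.bind (x := ()) (a₁ := σ.put i (columnsCode l ++ (endCode ι ++ u))
        (tokenCode (some (f q c).2) ++ v)) ?_ (exec_pure _)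
      rw [Store.put_swap, Store.put_swap σ i]
      exact exec_pushToken _ (by simp; omega)
    · have := ih (f q c).1 (v := tokenCode (some (f q c).2) ++ v) (by simp; linarith)
      simpa [transduce, sweep] using this

/-- Move the columns on top of a stack to the other stack. -/
noncomputable def carry (ι : Type) [Fintype ι] (i : Fin 2) : Frag Unit :=
  sweep (ι := ι) i (fun q c => (q, c)) ()

theorem exec_carry (l : List (ι → Bool))
    (h : tokenWidth ι * (l.length + 1) + u.length + v.length ≤ s) :
    Exec Eq s (carry ι i)
      (σ.put i (columnsCode l ++ (endCode ι ++ u)) v) ()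
      (σ.put i u (columnsCode l.reverse ++ v)) := by
  have e : (transduce (fun (q : Unit) (c : ι → Bool) => (q, c)) () l).2 = l := by
    induction l with
    | nil => rfl
    | cons c l ih => simp [transduce, ih (by simp [mul_add] at h ⊢; omega)]
  have := exec_sweep (s := s) (σ := σ) (i := i) (u := u) (v := v)
    (fun (q : Unit) (c : ι → Bool) => (q, c)) () l h
  rwa [e] at this

/-- Transform the columns on top of stack `1` with a transducer, and append more columns. -/
noncomputable def pass (f : Q → (ι → Bool) → Q × (ι → Bool)) (q : Q)
    (fin : Q → List (ι → Bool)) : Frag Q :=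
  (pushToken 0 (none : Option (ι → Bool))).bind fun _ => (sweep 1 f q).bind fun q' =>
  (pushToken 1 (none : Option (ι → Bool))).bind fun _ => (pushList 1 (columnsCode (fin q'))).bind
  fun _ => (carry ι 0).bind fun _ => pure q'

/-- The code of a block of columns, with an end marker. -/
noncomputable def blockCode (l : List (ι → Bool)) : List Bool :=
  columnsCode l ++ endCode ι

/-- Sweeping there and back restores the order. The marker on stack `0` protects the unstructured
contents `v` on the way back, and the new marker on stack `1` closes the block again; these are the
two extra tokens. The columns `fin` are pushed before the return and so end up at the most
significant end. -/
theorem exec_pass (f : Q → (ι → Bool) → Q × (ι → Bool)) (q : Q) (fin : Q → List (ι → Bool))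
    (l : List (ι → Bool))
    (h : tokenWidth ι * (l.length + (fin (transduce f q l).1).length + 2) + u.length + v.length
      ≤ s) :
    Exec Eq s (pass f q fin) (σ.put 1 (blockCode l ++ u) v) (transduce f q l).1
      (σ.put 1 (blockCode ((transduce f q l).2 ++ fin (transduce f q l).1) ++ u) v) := by
  simp only [mul_add, mul_two] at h
  refine Exec.bind (x := ()) (a₁ := σ.put 1 (blockCode l ++ u) (endCode ι ++ v)) ?_ ?_
  · rw [Store.put_swap, Store.put_swap σ 1]
    exact exec_pushToken _ (by simp [blockCode]; omega)
  simp only [blockCode, List.append_assoc]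
  refine (exec_sweep f q l (by simp [mul_add]; omega)).bind ?_
  refine (exec_pushToken none (by simp; omega)).bind ?_
  refine (exec_pushList _ (by simp; omega)).bind ?_
  rw [Store.put_swap]
  refine (exec_carry (i := 1 - 1) (transduce f q l).2.reverse
    (by simp [mul_add]; omega)).bind ?_
  rw [Store.put_swap]
  simpa using exec_pure _

/-- Execute a fragment below the block on top of stack `1`. -/
noncomputable def underBlock (ι : Type) [Fintype ι] {β : Type} [Finite β] (F : Frag β) : Frag β :=
  (pushToken 0 (none : Option (ι → Bool))).bind fun _ => (carry ι 1).bind fun _ =>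
  F.bind fun b => (pushToken 1 (none : Option (ι → Bool))).bind fun _ =>
  (carry ι 0).bind fun _ => pure b

/-- The block waits on stack `0`, above a marker, while `F` works on the exposed stack `1`. It finds
its way back because `F` leaves stack `0` as it was. -/
theorem exec_underBlock {β : Type} [Finite β] {F : Frag β} {b : β} {u' : List Bool}
    (l : List (ι → Bool))
    (hF : Exec Eq s F (σ.put 1 u (columnsCode l.reverse ++ (endCode ι ++ v))) b
      (σ.put 1 u' (columnsCode l.reverse ++ (endCode ι ++ v))))
    (h : tokenWidth ι * (l.length + 2) + u.length + v.length ≤ s)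
    (h' : tokenWidth ι * (l.length + 2) + u'.length + v.length ≤ s) :
    Exec Eq s (underBlock ι F) (σ.put 1 (blockCode l ++ u) v) b
      (σ.put 1 (blockCode l ++ u') v) := by
  simp only [mul_add, mul_two] at h h'
  refine Exec.bind (x := ()) (a₁ := σ.put 1 (blockCode l ++ u) (endCode ι ++ v)) ?_ ?_
  · rw [Store.put_swap, Store.put_swap σ 1]
    exact exec_pushToken _ (by simp [blockCode]; omega)
  simp only [blockCode, List.append_assoc]
  refine (exec_carry l (by simp [mul_add]; omega)).bind ?_
  refine hF.bind ?_
  refine (exec_pushToken none (by simp; omega)).bind ?_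
  rw [Store.put_swap]
  refine (exec_carry (i := 1 - 1) l.reverse (by simp [mul_add]; omega)).bind ?_
  rw [Store.put_swap]
  simpa using exec_pure _

end Tokens

/-! ### Binary counters in a block on top of stack 1 -/

section Counters

variable {ι : Type}

/-- The number whose binary digits, least significant first, are the entries at `x` of a list of
columns. -/
def columnsVal (l : List (ι → Bool)) (x : ι) : ℕ :=
  l.foldr (fun c n => (c x).toNat + 2 * n) 0

@[simp] theorem columnsVal_nil (x : ι) : columnsVal [] x = 0 := rfl

@[simp] theorem columnsVal_cons (c : ι → Bool) (l : List (ι → Bool)) (x : ι) :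
    columnsVal (c :: l) x = (c x).toNat + 2 * columnsVal l x := rfl

theorem columnsVal_append (l l' : List (ι → Bool)) (x : ι) :
    columnsVal (l ++ l') x = columnsVal l x + 2 ^ l.length * columnsVal l' x := by
  induction l with
  | nil => simp
  | cons c l ih => simp [ih, pow_succ]; ring

theorem columnsVal_lt (l : List (ι → Bool)) (x : ι) : columnsVal l x < 2 ^ l.length := by
  induction l with
  | nil => simp
  | cons c l ih =>
    have := Bool.toNat_le (c x)
    simp [pow_succ]
    omega

theorem columnsVal_transduce_of_eq {Q : Type} {f : Q → (ι → Bool) → Q × (ι → Bool)} {x y : ι}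
    (h : ∀ q c, (f q c).2 x = c y) (q : Q) (l : List (ι → Bool)) :
    columnsVal (transduce f q l).2 x = columnsVal l y := by
  induction l generalizing q with
  | nil => rfl
  | cons c l ih => simp [transduce, ih, h]

/-- Transducer that adds the carry bit `q` to counter `x`. -/
def incColumn [DecidableEq ι] (x : ι) (q : Bool) (c : ι → Bool) : Bool × (ι → Bool) :=
  (q && c x, Function.update c x (xor q (c x)))

/-- Transducer that subtracts the borrow bit `q` from counter `x`. -/
def decColumn [DecidableEq ι] (x : ι) (q : Bool) (c : ι → Bool) : Bool × (ι → Bool) :=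
  (q && !c x, Function.update c x (xor q (c x)))

/-- Counting the outgoing carry with its weight makes the identity exact for every incoming bit,
which is what the induction over columns requires. -/
theorem columnsVal_inc [DecidableEq ι] (x : ι) (q : Bool) (l : List (ι → Bool)) :
    columnsVal (transduce (incColumn x) q l).2 x
      + 2 ^ l.length * (transduce (incColumn x) q l).1.toNat = columnsVal l x + q.toNat := by
  induction l generalizing q with
  | nil => simp [transduce]
  | cons c l ih =>
    have := ih (incColumn x q c).1
    simp only [transduce, columnsVal_cons, List.length_cons, pow_succ]
    have e : (incColumn x q c).2 x = xor q (c x) := by simp [incColumn]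
    rw [e]
    have e2 : (incColumn x q c).1 = (q && c x) := rfl
    rw [e2] at this ⊢
    revert this
    generalize (transduce (incColumn x) (q && c x) l).1.toNat = t
    generalize columnsVal (transduce (incColumn x) (q && c x) l).2 x = z
    intro this
    have h3 : 2 ^ l.length * 2 * t = 2 * (2 ^ l.length * t) := by ring
    rw [h3]
    cases q <;> cases hc : c x <;> simp [hc] at this ⊢ <;> omega

/-- The borrow is treated like the carry in `columnsVal_inc`, with terms arranged to avoid truncated
subtraction. -/
theorem columnsVal_dec [DecidableEq ι] (x : ι) (q : Bool) (l : List (ι → Bool)) :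
    columnsVal (transduce (decColumn x) q l).2 x + q.toNat
      = columnsVal l x + 2 ^ l.length * (transduce (decColumn x) q l).1.toNat := by
  induction l generalizing q with
  | nil => simp [transduce]
  | cons c l ih =>
    have := ih (decColumn x q c).1
    simp only [transduce, columnsVal_cons, List.length_cons, pow_succ]
    have e : (decColumn x q c).2 x = xor q (c x) := by simp [decColumn]
    rw [e]
    have e2 : (decColumn x q c).1 = (q && !c x) := rfl
    rw [e2] at this ⊢
    revert this
    generalize (transduce (decColumn x) (q && !c x) l).1.toNat = t
    generalize columnsVal (transduce (decColumn x) (q && !c x) l).2 x = z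
    intro this
    have h3 : 2 ^ l.length * 2 * t = 2 * (2 ^ l.length * t) := by ring
    rw [h3]
    cases q <;> cases hc : c x <;> simp [hc] at this ⊢ <;> omega

theorem transduce_test (x : ι) (q : Bool) (l : List (ι → Bool)) :
    transduce (fun q c => (q || c x, c)) q l = (q || decide (0 < columnsVal l x), l) := by
  induction l generalizing q with
  | nil => simp [transduce]
  | cons c l ih =>
    simp only [transduce, ih, columnsVal_cons]
    by_cases hc : c x = true <;> cases q <;> simp [hc]

variable [Fintype ι]

/-- The store `σ` represents the memory `m.1` with counters `m.2`, of at most `L` bits each: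
a block with the counters lies on top of stack `1`. -/
def CounterRep (L : ℕ) (m : Store × (ι → ℕ)) (σ : Store) : Prop :=
  ∃ l : List (ι → Bool), l.length ≤ L ∧ columnsVal l = m.2 ∧
    σ = m.1.put 1 (blockCode l ++ m.1.stack 1) (m.1.stack 0)

/-- The space in which memory of size `S` with counters of `L` bits is handled. -/
def counterSpace (ι : Type) [Fintype ι] (L S : ℕ) : ℕ := tokenWidth ι * (L + 3) + S

/-- Execution of a fragment with counters. -/
def CExec {β : Type} (L S : ℕ) (F : Frag β) (m : Store × (ι → ℕ)) (b : β)
    (m' : Store × (ι → ℕ)) : Prop :=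
  Exec (CounterRep L) (counterSpace ι L S) F m b m'

variable {L S : ℕ} {σ : Store} {n : ι → ℕ}

/-- Leading zero columns are allowed, so the counters do not determine the block. The hypothesis
therefore speaks of all blocks with the right values. -/
theorem cexec_pass {Q : Type} [Finite Q] {f : Q → (ι → Bool) → Q × (ι → Bool)} {q q' : Q}
    {fin : Q → List (ι → Bool)} {n' : ι → ℕ} (hσ : σ.space ≤ S)
    (h : ∀ l : List (ι → Bool), l.length ≤ L → columnsVal l = n → (transduce f q l).1 = q' ∧
      l.length + (fin q').length ≤ L ∧
      columnsVal ((transduce f q l).2 ++ fin q') = n') :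
    CExec L S (pass f q fin) (σ, n) q' (σ, n') := by
  rintro _ ⟨l, hl, hn, rfl⟩ hs
  obtain ⟨h1, h2, h3⟩ := h l hl hn
  have hm : tokenWidth ι * (l.length + (fin q').length + 2) ≤ tokenWidth ι * (L + 3) :=
    Nat.mul_le_mul_left _ (by omega)
  have := exec_pass (s := counterSpace ι L S) (σ := σ) (u := σ.stack 1) (v := σ.stack 0) f q fin l
    (by rw [h1]; simp only [Store.space, counterSpace] at hσ ⊢; omega)
  rw [h1] at this
  obtain ⟨σ', rfl, h4, h5⟩ := this _ rfl hs
  exact ⟨_, ⟨_, by simpa using h2, h3, rfl⟩, h4, h5⟩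

/-- Increment a counter. -/
noncomputable def inc [DecidableEq ι] (x : ι) : Frag Unit :=
  (pass (incColumn x) true fun q => if q then [fun y => decide (y = x)] else []).bind
    fun _ => pure ()

/-- Whether a carry leaves the block depends on its length and not just on the values, so
`cexec_pass`, which fixes the final state in advance, does not apply. Both outcomes are treated by
means of `exec_pass`. -/
theorem cexec_inc [DecidableEq ι] (x : ι) (hσ : σ.space ≤ S) (hn : n x + 1 < 2 ^ L) :
    CExec L S (inc x) (σ, n) () (σ, Function.update n x (n x + 1)) := by
  have key : ∀ b : Bool, ∀ l : List (ι → Bool), l.length ≤ L → columnsVal l = n →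
      (transduce (incColumn x) true l).1 = b →
      l.length + (if b then [fun y : ι => decide (y = x)] else []).length ≤ L ∧
      columnsVal ((transduce (incColumn x) true l).2 ++
        (if b then [fun y : ι => decide (y = x)] else [])) = Function.update n x (n x + 1) := by
    intro b l hl hn' hb
    have h := columnsVal_inc x true l
    rw [hn', hb] at h
    constructor
    · cases b
      · simpa using hl
      · simp only [Bool.toNat_true, mul_one] at h
        -- A carry out of the last column forces `2 ^ l.length ≤ n x + 1`, so there is room for one
        -- more column.
        have : 2 ^ l.length < 2 ^ L := by omega
        have := (Nat.pow_lt_pow_iff_right (a := 2) (by norm_num)).1 this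
        simp; omega
    · funext y
      by_cases hy : y = x
      · subst hy
        rw [columnsVal_append]
        cases b <;> simp at h ⊢ <;> omega
      · rw [columnsVal_append, columnsVal_transduce_of_eq (y := y)]
        · rw [hn']
          cases b <;> simp [hy]
        · intro q c
          simp [incColumn, hy]
  intro τ hτ hs
  obtain ⟨l, hl, hn', rfl⟩ := hτ
  generalize hb : (transduce (incColumn x) true l).1 = b
  have hm : tokenWidth ι * (l.length +
      (if b then [fun y : ι => decide (y = x)] else []).length + 2) ≤ tokenWidth ι * (L + 3) :=
    Nat.mul_le_mul_left _ (by have := (key b l hl hn' hb).1; omega)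
  have := exec_pass (s := counterSpace ι L S) (σ := σ) (u := σ.stack 1) (v := σ.stack 0)
    (incColumn x) true (fun q => if q then [fun y => decide (y = x)] else []) l
    (by rw [hb]; simp only [Store.space, counterSpace] at hσ ⊢; omega)
  rw [hb] at this
  have := this.bind (G := fun _ => pure ()) (exec_pure ())
  obtain ⟨σ', rfl, h4, h5⟩ := this _ rfl hs
  exact ⟨_, ⟨_, by simpa using (key b l hl hn' hb).1, (key b l hl hn' hb).2, rfl⟩, h4, h5⟩

/-- Decrement a counter. -/
noncomputable def dec [DecidableEq ι] (x : ι) : Frag Unit :=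
  (pass (decColumn x) true fun _ => []).bind fun _ => pure ()

theorem cexec_dec [DecidableEq ι] (x : ι) (hσ : σ.space ≤ S) (hn : 0 < n x) :
    CExec L S (dec x) (σ, n) () (σ, Function.update n x (n x - 1)) := by
  refine Exec.bind (x := false) (cexec_pass hσ ?_) (exec_pure ())
  intro l hl hn'
  have h := columnsVal_dec x true l
  rw [hn'] at h
  have hlt := columnsVal_lt (transduce (decColumn x) true l).2 x
  rw [length_transduce] at hlt
  -- A final borrow would make the new value equal to `n x - 1 + 2 ^ l.length`, too large for
  -- `l.length` digits.
  have hb : (transduce (decColumn x) true l).1 = false := by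
    cases hb : (transduce (decColumn x) true l).1
    · rfl
    · rw [hb] at h
      simp at h
      omega
  refine ⟨hb, by simpa using hl, ?_⟩
  rw [hb] at h
  funext y
  by_cases hy : y = x
  · subst hy
    simp at h ⊢
    omega
  · rw [List.append_nil, columnsVal_transduce_of_eq (y := y)]
    · simp [hn', hy]
    · intro q c
      simp [decColumn, hy]

/-- Test whether a counter is positive. -/
noncomputable def isPos (x : ι) : Frag Bool :=
  pass (fun q (c : ι → Bool) => (q || c x, c)) false fun _ => []

theorem cexec_isPos (x : ι) (hσ : σ.space ≤ S) :
    CExec L S (isPos x) (σ, n) (decide (0 < n x)) (σ, n) := by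
  refine cexec_pass hσ ?_
  intro l hl hn'
  rw [transduce_test]
  simp [hn', hl]

/-- Copy counter `y` to counter `x`. -/
noncomputable def copy [DecidableEq ι] (x y : ι) : Frag Unit :=
  pass (fun q (c : ι → Bool) => (q, Function.update c x (c y))) () fun _ => []

theorem cexec_copy [DecidableEq ι] (x y : ι) (hσ : σ.space ≤ S) :
    CExec L S (copy x y) (σ, n) () (σ, Function.update n x (n y)) := by
  refine cexec_pass hσ ?_
  intro l hl hn'
  refine ⟨rfl, by simpa using hl, ?_⟩
  funext z
  by_cases hz : z = x
  · subst hz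
    rw [List.append_nil, columnsVal_transduce_of_eq (y := y)]
    · simp [hn']
    · simp
  · rw [List.append_nil, columnsVal_transduce_of_eq (y := z)]
    · simp [hn', hz]
    · simp [hz]

/-- Create the block of counters, all of them zero. -/
noncomputable def initCounters (ι : Type) [Fintype ι] : Frag Unit :=
  pushToken 1 (none : Option (ι → Bool))

/-- Push a bit on a stack, in the presence of counters. -/
noncomputable def cpush (ι : Type) [Fintype ι] (i : Fin 2) (b : Bool) : Frag Unit :=
  if i = 1 then underBlock ι (push 1 b) else push 0 b

/-- Pop a bit from a stack, in the presence of counters. -/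
noncomputable def cpop (ι : Type) [Fintype ι] (i : Fin 2) : Frag (Option Bool) :=
  if i = 1 then underBlock ι (pop 1) else pop 0

variable {i : Fin 2} {u v : List Bool}

theorem tokenWidth_mul_le {l : List (ι → Bool)} (hl : l.length ≤ L) :
    tokenWidth ι * (l.length + 2) + tokenWidth ι ≤ tokenWidth ι * (L + 3) := by
  rw [← Nat.mul_succ]
  exact Nat.mul_le_mul_left _ (by omega)

theorem cexec_cpush (b : Bool) (h : u.length + v.length + 1 ≤ S) :
    CExec L S (cpush ι i b) (σ.put i u v, n) () (σ.put i (b :: u) v, n) := by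
  rintro _ ⟨l, hl, hn, rfl⟩ hs
  have hm := tokenWidth_mul_le hl
  have hm' : tokenWidth ι * (l.length + 2)
    = tokenWidth ι * l.length + tokenWidth ι + tokenWidth ι := by ring
  match i with
  | 1 =>
    have := exec_underBlock (s := counterSpace ι L S) (σ := σ) (u := u) (v := v) l
      (exec_push_put b (by simp [counterSpace]; omega)) (by simp only [counterSpace]; omega)
      (by simp only [counterSpace, List.length_cons]; omega)
    obtain ⟨_, rfl, h4, h5⟩ := this _ rfl hs
    exact ⟨_, ⟨l, hl, hn, rfl⟩, h4, h5⟩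
  | 0 =>
    have := exec_push_put (s := counterSpace ι L S) (σ := σ) (i := 0) (u := u)
      (v := blockCode l ++ v) b (by simp [counterSpace, blockCode]; omega)
    rw [Store.put_swap σ 0 u, Store.put_swap σ 0 (b :: u)] at this
    obtain ⟨_, rfl, h4, h5⟩ := this _ rfl hs
    exact ⟨_, ⟨l, hl, hn, rfl⟩, h4, h5⟩

theorem cexec_cpop (h : u.length + v.length ≤ S) :
    CExec L S (cpop ι i) (σ.put i u v, n) u.head? (σ.put i u.tail v, n) := by
  rintro _ ⟨l, hl, hn, rfl⟩ hs
  have hm := tokenWidth_mul_le hl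
  have hm' : tokenWidth ι * (l.length + 2)
    = tokenWidth ι * l.length + tokenWidth ι + tokenWidth ι := by ring
  match i with
  | 1 =>
    have := exec_underBlock (s := counterSpace ι L S) (σ := σ) (u := u) (v := v) l
      (exec_pop_put (by simp [counterSpace]; omega)) (by simp only [counterSpace]; omega)
      (by simp only [counterSpace, List.length_tail]; omega)
    obtain ⟨_, rfl, h4, h5⟩ := this _ rfl hs
    exact ⟨_, ⟨l, hl, hn, rfl⟩, h4, h5⟩
  | 0 =>
    have := exec_pop_put (s := counterSpace ι L S) (σ := σ) (i := 0) (u := u)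
      (v := blockCode l ++ v) (by simp [counterSpace, blockCode]; omega)
    rw [Store.put_swap σ 0 u, Store.put_swap σ 0 u.tail] at this
    obtain ⟨_, rfl, h4, h5⟩ := this _ rfl hs
    exact ⟨_, ⟨l, hl, hn, rfl⟩, h4, h5⟩

theorem cexec_readProgram :
    CExec L S readProgram (σ, n) σ.program.head? ({ σ with program := σ.program.tail }, n) := by
  rintro _ ⟨l, hl, hn, rfl⟩ hs
  exact ⟨_, ⟨l, hl, hn, rfl⟩, hs, runs_readProgram hs⟩

theorem cexec_readInput :
    CExec L S readInput (σ, n) σ.input.head? ({ σ with input := σ.input.tail }, n) := by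
  rintro _ ⟨l, hl, hn, rfl⟩ hs
  exact ⟨_, ⟨l, hl, hn, rfl⟩, hs, runs_readInput hs⟩

theorem cexec_write (b : Bool) :
    CExec L S (write b) (σ, n) () ({ σ with output := σ.output ++ [b] }, n) := by
  rintro _ ⟨l, hl, hn, rfl⟩ hs
  exact ⟨_, ⟨l, hl, hn, rfl⟩, hs, runs_write b hs⟩

end Counters

theorem Exec.congr {A β : Type} {R : A → Store → Prop} {s : ℕ} {F : Frag β} {a a₁ a₂ : A} {b : β}
    (h : Exec R s F a b a₁) (e : a₁ = a₂) : Exec R s F a b a₂ := e ▸ h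

/-! ### Access to undelimited piles -/

section Shift

variable {ι : Type} [Fintype ι] [DecidableEq ι] {L S : ℕ} {σ : Store} {i : Fin 2}

/-- Move as many bits as counter `x` says from stack `i` to the other stack, and add their number
to counter `y`. -/
noncomputable def shift (x y : ι) (i : Fin 2) : Frag Unit :=
  loop (fun _ : Unit => (isPos x).bind fun b =>
    if b then
      (dec x).bind fun _ => (inc y).bind fun _ => (cpop ι i).bind fun o =>
      (cpush ι (1 - i) (o.getD false)).bind fun _ => pure (.inl ())
    else pure (.inr ())) ()

/-- The bits carry no delimiters, as these would multiply the space. Only the counter `x` knows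
where `u` ends, and the count accumulated in `y` makes it possible to move the bits back. -/
theorem cexec_shift {x y : ι} (hxy : x ≠ y) {n : ι → ℕ} {u r v : List Bool}
    (hx : n x = u.length) (hy : n y + u.length < 2 ^ L)
    (h : u.length + r.length + v.length ≤ S) :
    CExec L S (shift x y i) (σ.put i (u ++ r) v, n) ()
      (σ.put i r (u.reverse ++ v), Function.update (Function.update n x 0) y (n y + u.length)) := by
  induction u generalizing n v with
  | nil =>
    have e : Function.update (Function.update n x 0) y (n y + ([] : List Bool).length) = n := by
      funext z
      by_cases h1 : z = y
      · subst h1; simp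
      · by_cases h2 : z = x
        · subst h2; simpa [h1] using hx.symm
        · simp [h1, h2]
    rw [e]
    refine Exec.done (Exec.bind (x := false) ?_ (exec_pure _))
    have := cexec_isPos (L := L) (S := S) (σ := σ.put i ([] ++ r) v) (n := n) x
      (by simpa using h)
    rwa [hx] at this
  | cons b u ih =>
    simp only [List.length_cons] at hx hy h
    refine Exec.next (x' := ()) (a₁ := (σ.put i (u ++ r) (b :: v),
      Function.update (Function.update n x (n x - 1)) y (n y + 1))) ?_ ?_
    · refine Exec.bind (x := true) (a₁ := (σ.put i (b :: u ++ r) v, n)) ?_ ?_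
      · have := cexec_isPos (L := L) (S := S) (σ := σ.put i (b :: u ++ r) v) (n := n) x
          (by simp; omega)
        rwa [hx, decide_eq_true (by omega : 0 < u.length + 1)] at this
      refine Exec.bind (cexec_dec x (by simp; omega) (by omega)) ?_
      refine Exec.bind (cexec_inc y (by simp; omega)
        (by rw [Function.update_of_ne hxy.symm]; omega)) ?_
      rw [Function.update_of_ne hxy.symm]
      refine Exec.bind (cexec_cpop (by simp; omega)) ?_
      refine Exec.bind (x := ()) (a₁ := (σ.put i (u ++ r) (b :: v),
        Function.update (Function.update n x (n x - 1)) y (n y + 1))) ?_ (exec_pure _)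
      rw [Store.put_swap, Store.put_swap σ i]
      exact cexec_cpush b (by simp; omega)
    · have := ih (n := Function.update (Function.update n x (n x - 1)) y (n y + 1)) (v := b :: v)
        (by simp [hxy, hx]) (by simp; omega) (by simp; omega)
      refine Exec.congr this ?_
      congr 1
      · simp
      · funext z
        by_cases h1 : z = y
        · subst h1; simp; omega
        · by_cases h2 : z = x
          · subst h2; simp [h1]
          · simp [h1, h2]

end Shift

/-- The counters of a machine with `m` piles and counters `κ`: two counters for each pile (the
numbers of its bits in place and set aside), and the counters in `κ`. -/
abbrev PileCounter (m : ℕ) (κ : Type) : Type := Fin m ⊕ Fin m ⊕ κ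

section Focus

variable {m : ℕ} {κ : Type} [Fintype κ] [DecidableEq κ]

/-- Set the piles in `l` aside, execute `F`, and put the piles back. -/
noncomputable def focus (κ : Type) [Fintype κ] [DecidableEq κ] {β : Type} [Finite β]
    (l : List (Fin m)) (F : Frag β) : Frag β :=
  match l with
  | [] => F
  | k :: l => (shift (.inl k : PileCounter m κ) (.inr (.inl k)) 1).bind fun _ =>
      (focus κ l F).bind fun b =>
      (shift (.inr (.inl k) : PileCounter m κ) (.inl k) 0).bind fun _ => pure b

variable {L S : ℕ} {σ : Store}

/-- Each pile is reversed when set aside and reversed again on its return. The hypothesis on `F`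
must allow any `v` and `n`, because the other stack and the counters have changed by the time `F` is
executed. -/
theorem cexec_focus {β : Type} [Finite β] {F : Frag β} {b : β} {f : Fin m → List Bool}
    {u u' : List Bool}
    (hF : ∀ v (n : PileCounter m κ → ℕ), u.length + v.length ≤ S → u'.length + v.length ≤ S →
      CExec L S F (σ.put 1 u v, n) b (σ.put 1 u' v, n))
    (l : List (Fin m)) (hl : l.Nodup) (v : List Bool) (n : PileCounter m κ → ℕ)
    (h1 : ∀ k ∈ l, n (.inl k) = (f k).length) (h2 : ∀ k ∈ l, n (.inr (.inl k)) = 0)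
    (h3 : ∀ k ∈ l, (f k).length < 2 ^ L)
    (hu : (l.flatMap f).length + u.length + v.length ≤ S)
    (hu' : (l.flatMap f).length + u'.length + v.length ≤ S) :
    CExec L S (focus κ l F) (σ.put 1 (l.flatMap f ++ u) v, n) b
      (σ.put 1 (l.flatMap f ++ u') v, n) := by
  induction l generalizing v n with
  | nil => exact hF v n (by simpa using hu) (by simpa using hu')
  | cons k l ih =>
    rw [List.nodup_cons] at hl
    simp only [List.flatMap_cons, List.length_append] at hu hu'
    simp only [List.mem_cons, forall_eq_or_imp] at h1 h2 h3
    simp only [List.flatMap_cons, List.append_assoc]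
    have hs := cexec_shift (L := L) (S := S) (σ := σ) (i := 1)
      (x := (.inl k : PileCounter m κ)) (y := .inr (.inl k)) (by simp) (n := n) (u := f k)
      (r := l.flatMap f ++ u) (v := v) h1.1 (by rw [h2.1]; simpa using h3.1)
      (by simp only [List.length_append]; omega)
    refine Exec.bind hs ?_
    refine Exec.bind (ih hl.2 ((f k).reverse ++ v) _ ?_ ?_ h3.2
      (by simp only [List.length_append, List.length_reverse]; omega)
      (by simp only [List.length_append, List.length_reverse]; omega)) ?_
    · intro k' hk'
      have : k' ≠ k := fun h => hl.1 (h ▸ hk')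
      simp [this, h1.2 k' hk']
    · intro k' hk'
      have : k' ≠ k := fun h => hl.1 (h ▸ hk')
      simp [this, h2.2 k' hk']
    rw [Store.put_swap]
    have := cexec_shift (L := L) (S := S) (σ := σ) (i := 1 - 1)
      (x := (.inr (.inl k) : PileCounter m κ)) (y := .inl k)
      (by simp) (n := Function.update (Function.update n (.inl k) 0) (.inr (.inl k))
        (n (.inr (.inl k)) + (f k).length)) (u := (f k).reverse) (r := v) (v := l.flatMap f ++ u')
      (by simp [h2.1]) (by simpa using h3.1)
      (by simp only [List.length_append, List.length_reverse]; omega)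
    refine Exec.bind this ?_
    rw [Store.put_swap σ 1 (f k ++ _)]
    refine Exec.congr (exec_pure b) ?_
    congr 1
    · simp
    · funext z
      by_cases e1 : z = .inl k
      · subst e1; simp [h1.1]
      · by_cases e2 : z = .inr (.inl k)
        · subst e2; simp [h2.1]
        · simp [e1, e2]

end Focus

/-! ### Memory consisting of two stacks, piles and counters -/

/-- The memory of a machine with two stacks, `m` piles (stacks of known size) and counters `κ`. -/
structure Mem (m : ℕ) (κ : Type) : Type where
  program : List Bool
  input : List Bool
  stack : Fin 2 → List Bool
  pile : Fin m → List Bool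
  ctr : κ → ℕ
  output : List Bool

namespace Mem

variable {m : ℕ} {κ : Type}

/-- The piles as one list. -/
def heap (M : Mem m κ) : List Bool := (List.finRange m).flatMap M.pile

/-- The stacks, with the piles on top of stack `1`, and the counters. -/
def flat (M : Mem m κ) : Store × (PileCounter m κ → ℕ) :=
  (Store.put ⟨M.program, M.input, M.stack, M.output⟩ 1 (M.heap ++ M.stack 1) (M.stack 0),
    Sum.elim (fun k => (M.pile k).length) (Sum.elim (fun _ => 0) M.ctr))

/-- The stacks have total size at most `s`, the piles have total size at most `B`, and the counters
are at most `B`. -/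
structure Fits (M : Mem m κ) (s B : ℕ) : Prop where
  stack_le : (M.stack 0).length + (M.stack 1).length ≤ s
  heap_le : M.heap.length ≤ B
  ctr_le : ∀ x, M.ctr x ≤ B

/-- Setting the first part aside with `focus` exposes pile `k`. -/
theorem heap_split (M : Mem m κ) (k : Fin m) :
    M.heap = ((List.finRange m).take k).flatMap M.pile ++
      (M.pile k ++ ((List.finRange m).drop (k + 1)).flatMap M.pile) := by
  have : List.finRange m = (List.finRange m).take k ++
      (k :: (List.finRange m).drop (k + 1)) := by
    conv_lhs => rw [← List.take_append_drop k (List.finRange m)]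
    congr 1
    rw [List.drop_eq_getElem_cons (by simp)]
    simp
  rw [heap, this, List.flatMap_append, List.flatMap_cons, ← this]

theorem notMem_take (k : Fin m) : k ∉ (List.finRange m).take k := by
  intro h
  rw [List.mem_take_iff_getElem] at h
  obtain ⟨j, hj, e⟩ := h
  simp at e hj
  have := congrArg Fin.val e
  simp at this
  omega

theorem notMem_drop (k : Fin m) : k ∉ (List.finRange m).drop (k + 1) := by
  intro h
  rw [List.mem_drop_iff_getElem] at h
  obtain ⟨j, hj, e⟩ := h
  simp at e hj
  have := congrArg Fin.val e
  simp at this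
  omega

theorem heap_update (M : Mem m κ) (k : Fin m) (l : List Bool) :
    heap { M with pile := Function.update M.pile k l } =
      ((List.finRange m).take k).flatMap M.pile ++
      (l ++ ((List.finRange m).drop (k + 1)).flatMap M.pile) := by
  rw [heap_split _ k]
  have e : ∀ L : List (Fin m), k ∉ L → L.flatMap (Function.update M.pile k l) =
      L.flatMap M.pile := by
    intro L hL
    refine List.flatMap_congr fun x hx => ?_
    rw [Function.update_of_ne]
    rintro rfl
    exact hL hx
  simp only [e _ (notMem_take k), e _ (notMem_drop k), Function.update_self]

theorem length_pile_le (M : Mem m κ) (k : Fin m) : (M.pile k).length ≤ M.heap.length := by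
  rw [heap_split M k]
  simp
  omega

end Mem

section MExec

variable {m : ℕ} {κ : Type} [Fintype κ] [DecidableEq κ]

/-- Execution of a fragment with piles and counters. -/
def MExec {β : Type} (s B : ℕ) (F : Frag β) (M : Mem m κ) (b : β) (M' : Mem m κ) : Prop :=
  CExec (Nat.size B) (s + B) F M.flat b M'.flat

variable {s B : ℕ} {M M' : Mem m κ}

theorem Mem.Fits.space_le {m : ℕ} {κ : Type} {s B : ℕ} {M : Mem m κ} (h : M.Fits s B) : M.flat.1.space ≤ s + B := by
  have := h.1
  have := h.2
  simp [Mem.flat]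
  omega

/-- Push a bit on a pile. -/
noncomputable def pushPile (κ : Type) [Fintype κ] [DecidableEq κ] (k : Fin m) (b : Bool) :
    Frag Unit :=
  (focus κ ((List.finRange m).take k) (cpush (PileCounter m κ) 1 b)).bind fun _ =>
    inc (.inl k : PileCounter m κ)

/-- Pop a bit from a pile. -/
noncomputable def popPile (κ : Type) [Fintype κ] [DecidableEq κ] (k : Fin m) :
    Frag (Option Bool) :=
  (isPos (.inl k : PileCounter m κ)).bind fun b =>
  if b then
    (focus κ ((List.finRange m).take k) (cpop (PileCounter m κ) 1)).bind fun o =>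
      (dec (.inl k : PileCounter m κ)).bind fun _ => pure o
  else pure none

theorem mexec_pushPile (k : Fin m) (b : Bool) (h : M.Fits s B)
    (h' : ({ M with pile := Function.update M.pile k (b :: M.pile k) } : Mem m κ).Fits s B) :
    MExec s B (pushPile κ k b) M () { M with pile := Function.update M.pile k (b :: M.pile k) } := by
  have hB := Nat.lt_size_self B
  have h1 := h.1
  have h3 := h'.2
  rw [Mem.heap_update] at h3
  have hpl : ∀ k, (M.pile k).length ≤ B := fun k => (M.length_pile_le k).trans h.2
  have hnd := (List.nodup_finRange m).sublist (List.take_sublist k.1 _)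
  have e1 : M.flat = (Store.put ⟨M.program, M.input, M.stack, M.output⟩ 1
      (((List.finRange m).take k).flatMap M.pile ++ (M.pile k ++
        ((List.finRange m).drop (k + 1)).flatMap M.pile ++ M.stack 1)) (M.stack 0), M.flat.2) := by
    simp [Mem.flat, Mem.heap_split M k]
  have e2 : Mem.flat { M with pile := Function.update M.pile k (b :: M.pile k) } =
      (Store.put ⟨M.program, M.input, M.stack, M.output⟩ 1
      (((List.finRange m).take k).flatMap M.pile ++ (b :: M.pile k ++
        ((List.finRange m).drop (k + 1)).flatMap M.pile ++ M.stack 1)) (M.stack 0),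
        Function.update M.flat.2 (.inl k) (M.flat.2 (.inl k) + 1)) := by
    simp only [Mem.flat, Mem.heap_update]
    congr 1
    · simp
    · funext z
      rcases z with z | z | z
      · by_cases hz : z = k
        · subst hz; simp
        · simp [hz]
      · simp
      · simp
  unfold MExec
  rw [e1, e2]
  revert h3 hnd
  generalize hpre : (List.finRange m).take k = pre
  generalize ((List.finRange m).drop (k + 1)).flatMap M.pile = post
  intro h3 hnd
  simp only [List.length_append, List.length_cons] at h3
  have key := cexec_focus (κ := κ) (L := Nat.size B) (S := s + B)
    (σ := ⟨M.program, M.input, M.stack, M.output⟩)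
    (F := cpush (PileCounter m κ) 1 b) (b := ()) (f := M.pile)
    (u := M.pile k ++ post ++ M.stack 1) (u' := b :: M.pile k ++ post ++ M.stack 1)
    (fun v n h1 h2 => cexec_cpush b
      (by simp only [List.length_append, List.length_cons] at h2 ⊢; omega)) pre
    hnd (M.stack 0) M.flat.2 (by simp [Mem.flat]) (by simp [Mem.flat])
    (fun k _ => (hpl k).trans_lt hB)
    (by simp only [List.length_append]; omega)
    (by simp only [List.length_append, List.length_cons]; omega)
  unfold pushPile
  rw [hpre]
  have hk : M.flat.2 (.inl k) + 1 < 2 ^ Nat.size B := by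
    have := hpl k
    simp [Mem.flat]; omega
  revert key hk
  generalize M.flat.2 = n
  intro key hk
  have hi := cexec_inc (L := Nat.size B) (S := s + B) (.inl k)
    (σ := Store.put ⟨M.program, M.input, M.stack, M.output⟩ 1
      (pre.flatMap M.pile ++ (b :: M.pile k ++ post ++ M.stack 1)) (M.stack 0)) (n := n)
    (by simp only [Store.space_put, List.length_append, List.length_cons]; omega) hk
  exact Exec.bind key hi

/-- Emptiness must be read off the counter: below an empty pile lie other piles or the simulated
stack, and a pop could take a foreign bit. -/
theorem mexec_popPile (k : Fin m) (h : M.Fits s B) :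
    MExec s B (popPile κ k) M (M.pile k).head?
      { M with pile := Function.update M.pile k (M.pile k).tail } := by
  have hpos := cexec_isPos (L := Nat.size B) (S := s + B) (σ := M.flat.1) (n := M.flat.2) (.inl k)
    h.space_le
  rcases hk : M.pile k with _ | ⟨b, l⟩
  · refine Exec.bind (x := false) (a₁ := M.flat) ?_ ?_
    · have e : decide (0 < M.flat.2 (.inl k)) = false := by simp [Mem.flat, hk]
      rw [e] at hpos
      exact hpos
    · have e : ({ M with pile := Function.update M.pile k (List.tail []) } : Mem m κ) = M := by
        rw [List.tail_nil, ← hk, Function.update_eq_self]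
      rw [e]
      exact exec_pure _
  have hB := Nat.lt_size_self B
  have h1 := h.1
  have h3 := h.2
  rw [M.heap_split k, hk] at h3
  have hpl : ∀ k, (M.pile k).length ≤ B := fun k => (M.length_pile_le k).trans h.2
  have hnd := (List.nodup_finRange m).sublist (List.take_sublist k.1 _)
  have e1 : M.flat = (Store.put ⟨M.program, M.input, M.stack, M.output⟩ 1
      (((List.finRange m).take k).flatMap M.pile ++ (b :: l ++
        ((List.finRange m).drop (k + 1)).flatMap M.pile ++ M.stack 1)) (M.stack 0), M.flat.2) := by
    simp [Mem.flat, Mem.heap_split M k, hk]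
  have e2 : Mem.flat { M with pile := Function.update M.pile k (List.tail (b :: l)) } =
      (Store.put ⟨M.program, M.input, M.stack, M.output⟩ 1
      (((List.finRange m).take k).flatMap M.pile ++ (l ++
        ((List.finRange m).drop (k + 1)).flatMap M.pile ++ M.stack 1)) (M.stack 0),
        Function.update M.flat.2 (.inl k) (M.flat.2 (.inl k) - 1)) := by
    simp only [Mem.flat, Mem.heap_update]
    congr 1
    · simp
    · funext z
      rcases z with z | z | z
      · by_cases hz : z = k
        · subst hz; simp [hk]
        · simp [hz]
      · simp
      · simp
  refine Exec.bind (x := true) (a₁ := M.flat) ?_ ?_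
  · have e : decide (0 < M.flat.2 (.inl k)) = true := by simp [Mem.flat, hk]
    rw [e] at hpos
    exact hpos
  rw [e1, e2]
  revert h3 hnd
  generalize hpre : (List.finRange m).take k = pre
  generalize ((List.finRange m).drop (k + 1)).flatMap M.pile = post
  intro h3 hnd
  simp only [List.length_append, List.length_cons] at h3
  have key := cexec_focus (κ := κ) (L := Nat.size B) (S := s + B)
    (σ := ⟨M.program, M.input, M.stack, M.output⟩)
    (F := cpop (PileCounter m κ) 1) (b := some b) (f := M.pile)
    (u := b :: l ++ post ++ M.stack 1) (u' := l ++ post ++ M.stack 1)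
    (fun v n h1 h2 => cexec_cpop h1) pre
    hnd (M.stack 0) M.flat.2 (by simp [Mem.flat]) (by simp [Mem.flat])
    (fun k _ => (hpl k).trans_lt hB)
    (by simp only [List.length_append, List.length_cons]; omega)
    (by simp only [List.length_append]; omega)
  have hk' : 0 < M.flat.2 (.inl k) := by simp [Mem.flat, hk]
  revert key hk'
  generalize M.flat.2 = n
  intro key hk'
  have hi := cexec_dec (L := Nat.size B) (S := s + B) (.inl k)
    (σ := Store.put ⟨M.program, M.input, M.stack, M.output⟩ 1
      (pre.flatMap M.pile ++ (l ++ post ++ M.stack 1)) (M.stack 0)) (n := n)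
    (by simp only [Store.space_put, List.length_append]; omega) hk'
  exact Exec.bind key (Exec.bind hi (exec_pure _))

/-- Push a bit on one of the two stacks below the piles. -/
noncomputable def pushStack (m : ℕ) (κ : Type) [Fintype κ] [DecidableEq κ] (i : Fin 2) (b : Bool) :
    Frag Unit :=
  if i = 1 then focus κ (List.finRange m) (cpush (PileCounter m κ) 1 b)
  else cpush (PileCounter m κ) 0 b

/-- Pop a bit from one of the two stacks below the piles. -/
noncomputable def popStack (m : ℕ) (κ : Type) [Fintype κ] [DecidableEq κ] (i : Fin 2) :
    Frag (Option Bool) :=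
  if i = 1 then focus κ (List.finRange m) (cpop (PileCounter m κ) 1)
  else cpop (PileCounter m κ) 0

/-- The simulated stacks lie below all piles, so their ends are the real ends of the stacks and no
counter has to hold their sizes. This matters because `s` may be far larger than `B`, while the
counters have only about log `B` bits. -/
theorem mexec_pushStack (i : Fin 2) (b : Bool) (h : M.Fits s B)
    (h' : ({ M with stack := Function.update M.stack i (b :: M.stack i) } : Mem m κ).Fits s B) :
    MExec s B (pushStack m κ i b) M ()
      { M with stack := Function.update M.stack i (b :: M.stack i) } := by
  have hB := Nat.lt_size_self B
  have h1 := h'.1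
  have h2 := h.2
  have hpl : ∀ k, (M.pile k).length ≤ B := fun k => (M.length_pile_le k).trans h.2
  match i with
  | 1 =>
    simp at h1
    exact cexec_focus (F := cpush (PileCounter m κ) 1 b) (b := ()) (f := M.pile)
      (σ := ⟨M.program, M.input, M.stack, M.output⟩) (u := M.stack 1) (u' := b :: M.stack 1)
      (fun v n h1 h2 => cexec_cpush b (by simp only [List.length_cons] at h2; omega))
      (List.finRange m) (List.nodup_finRange m) (M.stack 0) M.flat.2 (by simp [Mem.flat])
      (by simp [Mem.flat]) (fun k _ => (hpl k).trans_lt hB)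
      (by simp only [Mem.heap] at h2; omega)
      (by simp only [Mem.heap, List.length_cons] at h2 ⊢; omega)
  | 0 =>
    simp at h1
    unfold MExec
    simp only [Mem.flat]
    rw [Store.put_swap, Store.put_swap _ 1]
    exact cexec_cpush b (by simp only [List.length_append]; omega)

theorem mexec_popStack (i : Fin 2) (h : M.Fits s B) :
    MExec s B (popStack m κ i) M (M.stack i).head?
      { M with stack := Function.update M.stack i (M.stack i).tail } := by
  have hB := Nat.lt_size_self B
  have h1 := h.1
  have h2 := h.2
  have hpl : ∀ k, (M.pile k).length ≤ B := fun k => (M.length_pile_le k).trans h.2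
  match i with
  | 1 =>
    exact cexec_focus (F := cpop (PileCounter m κ) 1) (f := M.pile)
      (σ := ⟨M.program, M.input, M.stack, M.output⟩) (u := M.stack 1) (u' := (M.stack 1).tail)
      (fun v n h1 h2 => cexec_cpop h1)
      (List.finRange m) (List.nodup_finRange m) (M.stack 0) M.flat.2 (by simp [Mem.flat])
      (by simp [Mem.flat]) (fun k _ => (hpl k).trans_lt hB)
      (by simp only [Mem.heap] at h2; omega)
      (by simp only [Mem.heap, List.length_tail] at h2 ⊢; omega)
  | 0 =>
    unfold MExec
    simp only [Mem.flat]
    rw [Store.put_swap, Store.put_swap _ 1]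
    exact cexec_cpop (by simp only [List.length_append]; omega)

theorem mexec_readProgram :
    MExec s B readProgram M M.program.head? { M with program := M.program.tail } :=
  cexec_readProgram

theorem mexec_readInput :
    MExec s B readInput M M.input.head? { M with input := M.input.tail } :=
  cexec_readInput

theorem mexec_write (b : Bool) :
    MExec s B (write b) M () { M with output := M.output ++ [b] } :=
  cexec_write b

theorem update_flat_ctr (M : Mem m κ) (x : κ) (y : ℕ) :
    Function.update M.flat.2 (.inr (.inr x)) y =
      (Mem.flat { M with ctr := Function.update M.ctr x y }).2 := by
  funext z
  rcases z with z | z | z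
  · rw [Function.update_of_ne (by simp)]; rfl
  · rw [Function.update_of_ne (by simp)]; rfl
  · by_cases hz : z = x
    · subst hz
      rw [Function.update_self]
      exact (Function.update_self z y M.ctr).symm
    · rw [Function.update_of_ne (by simpa using hz)]
      exact (Function.update_of_ne hz y M.ctr).symm

/-- Increment a counter in `κ`. -/
noncomputable def mInc (m : ℕ) {κ : Type} [Fintype κ] [DecidableEq κ] (x : κ) : Frag Unit :=
  inc (.inr (.inr x) : PileCounter m κ)

/-- Decrement a counter in `κ`. -/
noncomputable def mDec (m : ℕ) {κ : Type} [Fintype κ] [DecidableEq κ] (x : κ) : Frag Unit :=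
  dec (.inr (.inr x) : PileCounter m κ)

/-- Test whether a counter in `κ` is positive. -/
noncomputable def mIsPos (m : ℕ) {κ : Type} [Fintype κ] [DecidableEq κ] (x : κ) : Frag Bool :=
  isPos (.inr (.inr x) : PileCounter m κ)

/-- Copy a counter in `κ`. -/
noncomputable def mCopy (m : ℕ) {κ : Type} [Fintype κ] [DecidableEq κ] (x y : κ) : Frag Unit :=
  copy (.inr (.inr x) : PileCounter m κ) (.inr (.inr y))

theorem mexec_inc (x : κ) (h : M.Fits s B) (hx : M.ctr x + 1 ≤ B) :
    MExec s B (mInc m x) M () { M with ctr := Function.update M.ctr x (M.ctr x + 1) } := by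
  have := cexec_inc (L := Nat.size B) (S := s + B) (σ := M.flat.1) (n := M.flat.2)
    (.inr (.inr x)) h.space_le (hx.trans_lt (Nat.lt_size_self B))
  rw [update_flat_ctr] at this
  exact this

theorem mexec_dec (x : κ) (h : M.Fits s B) (hx : 0 < M.ctr x) :
    MExec s B (mDec m x) M () { M with ctr := Function.update M.ctr x (M.ctr x - 1) } := by
  have := cexec_dec (L := Nat.size B) (S := s + B) (σ := M.flat.1) (n := M.flat.2)
    (.inr (.inr x)) h.space_le hx
  rw [update_flat_ctr] at this
  exact this

theorem mexec_isPos (x : κ) (h : M.Fits s B) :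
    MExec s B (mIsPos m x) M (decide (0 < M.ctr x)) M :=
  cexec_isPos (L := Nat.size B) (S := s + B) (σ := M.flat.1) (n := M.flat.2)
    (.inr (.inr x)) h.space_le

theorem mexec_copy (x y : κ) (h : M.Fits s B) :
    MExec s B (mCopy m x y) M () { M with ctr := Function.update M.ctr x (M.ctr y) } := by
  have := cexec_copy (L := Nat.size B) (S := s + B) (σ := M.flat.1) (n := M.flat.2)
    (.inr (.inr x)) (.inr (.inr y)) h.space_le
  rw [update_flat_ctr] at this
  exact this

end MExec

/-! ### The memory of the decoding machine and its operations -/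

/-- The piles of the decoding machine: the unread and the read part of a program and of an input of
the simulated machine, the bits of the auxiliary input that have not been used yet, and two piles
for arithmetic. -/
inductive Pile : Type
  | progUnread | progRead | inpUnread | inpRead | side | num | aux

/-- The counters of the decoding machine; the counter `zero` is always zero. -/
inductive Ctr : Type
  | prec | len | half | time | index | zero

/-- The memory of the decoding machine. -/
structure St : Type where
  program : List Bool
  input : List Bool
  output : List Bool
  stack : Fin 2 → List Bool
  progUnread : List Bool
  progRead : List Bool
  inpUnread : List Bool
  inpRead : List Bool
  side : List Bool
  num : List Bool
  aux : List Bool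
  prec : ℕ
  len : ℕ
  half : ℕ
  time : ℕ
  index : ℕ

/-- The number of a pile. -/
def Pile.idx : Pile → Fin 7
  | progUnread => 0
  | progRead => 1
  | inpUnread => 2
  | inpRead => 3
  | side => 4
  | num => 5
  | aux => 6

/-- The number of a counter. -/
def Ctr.idx : Ctr → Fin 6
  | prec => 0
  | len => 1
  | half => 2
  | time => 3
  | index => 4
  | zero => 5

namespace St

/-- The contents of a pile. -/
def pile (S : St) : Pile → List Bool
  | .progUnread => S.progUnread
  | .progRead => S.progRead
  | .inpUnread => S.inpUnread
  | .inpRead => S.inpRead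
  | .side => S.side
  | .num => S.num
  | .aux => S.aux

/-- Replace the contents of a pile. -/
def setPile (S : St) (a : Pile) (l : List Bool) : St :=
  match a with
  | .progUnread => { S with progUnread := l }
  | .progRead => { S with progRead := l }
  | .inpUnread => { S with inpUnread := l }
  | .inpRead => { S with inpRead := l }
  | .side => { S with side := l }
  | .num => { S with num := l }
  | .aux => { S with aux := l }

/-- The value of a counter. -/
def ctr (S : St) : Ctr → ℕ
  | .prec => S.prec
  | .len => S.len
  | .half => S.half
  | .time => S.time
  | .index => S.index
  | .zero => 0

/-- Replace the value of a counter. -/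
def setCtr (S : St) (x : Ctr) (n : ℕ) : St :=
  match x with
  | .prec => { S with prec := n }
  | .len => { S with len := n }
  | .half => { S with half := n }
  | .time => { S with time := n }
  | .index => { S with index := n }
  | .zero => S

/-- The total size of the piles. -/
def load (S : St) : ℕ :=
  S.progUnread.length + S.progRead.length + S.inpUnread.length + S.inpRead.length +
    S.side.length + S.num.length + S.aux.length

/-- The memory in terms of numbered piles and counters. -/
def mem (S : St) : Mem 7 (Fin 6) where
  program := S.program
  input := S.input
  output := S.output
  stack := S.stack
  pile := ![S.progUnread, S.progRead, S.inpUnread, S.inpRead, S.side, S.num, S.aux]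
  ctr := ![S.prec, S.len, S.half, S.time, S.index, 0]

/-- The stacks have total size at most `s`, the piles have total size at most `B`, and the counters
are at most `B`. -/
structure Ok (S : St) (s B : ℕ) : Prop where
  stack_le : (S.stack 0).length + (S.stack 1).length ≤ s
  load_le : S.load ≤ B
  prec_le : S.prec ≤ B
  len_le : S.len ≤ B
  half_le : S.half ≤ B
  time_le : S.time ≤ B
  index_le : S.index ≤ B

variable {S : St} {s B : ℕ}

theorem Ok.fits (h : S.Ok s B) : S.mem.Fits s B := by
  obtain ⟨h1, h2, h3, h4, h5, h6, h7⟩ := h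
  refine ⟨h1, ?_, ?_⟩
  · refine le_trans (le_of_eq ?_) h2
    simp [Mem.heap, mem, load, List.finRange_succ, add_assoc]
  · intro x
    fin_cases x <;> simp [mem, *]

theorem mem_pile (a : Pile) : S.mem.pile a.idx = S.pile a := by
  cases a <;> rfl

theorem mem_ctr (x : Ctr) : S.mem.ctr x.idx = S.ctr x := by
  cases x <;> rfl

theorem mem_setPile (a : Pile) (l : List Bool) :
    (S.setPile a l).mem = { S.mem with pile := Function.update S.mem.pile a.idx l } := by
  have : (S.setPile a l).mem.pile = Function.update S.mem.pile a.idx l := by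
    funext k
    cases a <;> fin_cases k <;> rfl
  rw [← this]
  cases a <;> rfl

theorem mem_setCtr {x : Ctr} (hx : x ≠ .zero) (n : ℕ) :
    (S.setCtr x n).mem = { S.mem with ctr := Function.update S.mem.ctr x.idx n } := by
  have : (S.setCtr x n).mem.ctr = Function.update S.mem.ctr x.idx n := by
    funext k
    cases x <;> fin_cases k <;> first | rfl | exact absurd rfl hx
  rw [← this]
  cases x <;> rfl

theorem load_setPile (a : Pile) (l : List Bool) :
    (S.setPile a l).load + (S.pile a).length = S.load + l.length := by
  cases a <;> simp only [setPile, load, pile] <;> omega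

theorem Ok.setPile (h : S.Ok s B) {a : Pile} {l : List Bool} (hl : (S.setPile a l).load ≤ B) :
    (S.setPile a l).Ok s B := by
  cases a <;> exact ⟨h.1, hl, h.3, h.4, h.5, h.6, h.7⟩

theorem pile_setPile (a : Pile) (l : List Bool) : (S.setPile a l).pile a = l := by
  cases a <;> rfl

theorem pile_setPile_of_ne {a b : Pile} (hab : b ≠ a) (l : List Bool) :
    (S.setPile a l).pile b = S.pile b := by
  cases a <;> cases b <;> first | rfl | exact absurd rfl hab

theorem setPile_setPile (a : Pile) (l l' : List Bool) :
    (S.setPile a l).setPile a l' = S.setPile a l' := by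
  cases a <;> rfl

theorem setPile_comm {a b : Pile} (hab : b ≠ a) (l l' : List Bool) :
    (S.setPile a l).setPile b l' = (S.setPile b l').setPile a l := by
  cases a <;> cases b <;> first | rfl | exact absurd rfl hab

theorem setPile_self (a : Pile) : S.setPile a (S.pile a) = S := by
  cases a <;> rfl

end St

/-- Execution of a fragment of the decoding machine. -/
def SExec {β : Type} (s B : ℕ) (F : Frag β) (S : St) (b : β) (S' : St) : Prop :=
  MExec s B F S.mem b S'.mem

section Ops

variable {α β : Type} {s B : ℕ} {S S₁ S₂ : St}

theorem sexec_pure (b : β) : SExec s B (pure b) S b S := exec_pure b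

theorem SExec.bind [Finite α] {F : Frag α} {G : α → Frag β} {x : α} {b : β}
    (h₁ : SExec s B F S x S₁) (h₂ : SExec s B (G x) S₁ b S₂) : SExec s B (F.bind G) S b S₂ :=
  Exec.bind h₁ h₂

theorem SExec.done [Finite α] {G : α → Frag (α ⊕ β)} {x : α} {b : β}
    (h₁ : SExec s B (G x) S (.inr b) S₁) : SExec s B (loop G x) S b S₁ :=
  Exec.done h₁

theorem SExec.next [Finite α] {G : α → Frag (α ⊕ β)} {x x' : α} {b : β}
    (h₁ : SExec s B (G x) S (.inl x') S₁) (h₂ : SExec s B (loop G x') S₁ b S₂) :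
    SExec s B (loop G x) S b S₂ :=
  Exec.next h₁ h₂

/-- Push a bit on a pile. -/
noncomputable def put (a : Pile) (b : Bool) : Frag Unit := pushPile (Fin 6) a.idx b

/-- Pop a bit from a pile. -/
noncomputable def take (a : Pile) : Frag (Option Bool) := popPile (Fin 6) a.idx

/-- Push a bit on a stack of the simulated machine. -/
noncomputable def putStack (i : Fin 2) (b : Bool) : Frag Unit := pushStack 7 (Fin 6) i b

/-- Pop a bit from a stack of the simulated machine. -/
noncomputable def takeStack (i : Fin 2) : Frag (Option Bool) := popStack 7 (Fin 6) i

/-- Increment a counter. -/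
noncomputable def incr (x : Ctr) : Frag Unit := mInc 7 x.idx

/-- Decrement a counter. -/
noncomputable def decr (x : Ctr) : Frag Unit := mDec 7 x.idx

/-- Test whether a counter is positive. -/
noncomputable def test (x : Ctr) : Frag Bool := mIsPos 7 x.idx

/-- Copy counter `y` to counter `x`. -/
noncomputable def assign (x y : Ctr) : Frag Unit := mCopy 7 x.idx y.idx

theorem sexec_put (a : Pile) (b : Bool) (h : S.Ok s B) (h' : S.load + 1 ≤ B) :
    SExec s B (put a b) S () (S.setPile a (b :: S.pile a)) := by
  have hl := S.load_setPile a (b :: S.pile a)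
  have h2 : (S.setPile a (b :: S.pile a)).Ok s B := h.setPile (by simp at hl; omega)
  have h3 := h2.fits
  rw [St.mem_setPile, ← St.mem_pile] at h3
  have := mexec_pushPile a.idx b h.fits h3
  unfold SExec
  rw [St.mem_setPile, ← St.mem_pile]
  exact this

theorem sexec_take (a : Pile) (h : S.Ok s B) :
    SExec s B (take a) S (S.pile a).head? (S.setPile a (S.pile a).tail) := by
  have := mexec_popPile a.idx h.fits
  unfold SExec
  rw [St.mem_setPile, ← St.mem_pile]
  exact this

theorem sexec_putStack (i : Fin 2) (b : Bool) (h : S.Ok s B)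
    (h' : (S.stack 0).length + (S.stack 1).length + 1 ≤ s) :
    SExec s B (putStack i b) S () { S with stack := Function.update S.stack i (b :: S.stack i) } := by
  refine mexec_pushStack i b h.fits ⟨?_, h.fits.2, h.fits.3⟩
  have : S.mem.stack = S.stack := rfl
  rw [this]
  match i with
  | 0 => simp; omega
  | 1 => simp; omega

theorem sexec_takeStack (i : Fin 2) (h : S.Ok s B) :
    SExec s B (takeStack i) S (S.stack i).head?
      { S with stack := Function.update S.stack i (S.stack i).tail } :=
  mexec_popStack i h.fits

theorem sexec_readProgram :
    SExec s B readProgram S S.program.head? { S with program := S.program.tail } :=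
  mexec_readProgram

theorem sexec_readInput :
    SExec s B readInput S S.input.head? { S with input := S.input.tail } :=
  mexec_readInput

theorem sexec_write (b : Bool) :
    SExec s B (write b) S () { S with output := S.output ++ [b] } :=
  mexec_write b

theorem sexec_incr {x : Ctr} (hx : x ≠ .zero) (h : S.Ok s B) (h' : S.ctr x + 1 ≤ B) :
    SExec s B (incr x) S () (S.setCtr x (S.ctr x + 1)) := by
  have := mexec_inc x.idx h.fits (by rwa [St.mem_ctr])
  unfold SExec
  rw [St.mem_setCtr hx, ← St.mem_ctr]
  exact this

theorem sexec_decr {x : Ctr} (h : S.Ok s B) (h' : 0 < S.ctr x) :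
    SExec s B (decr x) S () (S.setCtr x (S.ctr x - 1)) := by
  have hx : x ≠ .zero := by rintro rfl; exact absurd h' (lt_irrefl 0)
  have := mexec_dec x.idx h.fits (by rwa [St.mem_ctr])
  unfold SExec
  rw [St.mem_setCtr hx, ← St.mem_ctr]
  exact this

theorem sexec_test (x : Ctr) (h : S.Ok s B) : SExec s B (test x) S (decide (0 < S.ctr x)) S := by
  have := mexec_isPos x.idx h.fits
  rwa [St.mem_ctr] at this

theorem sexec_assign {x : Ctr} (hx : x ≠ .zero) (y : Ctr) (h : S.Ok s B) :
    SExec s B (assign x y) S () (S.setCtr x (S.ctr y)) := by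
  have := mexec_copy x.idx y.idx h.fits
  unfold SExec
  rw [St.mem_setCtr hx, ← St.mem_ctr]
  exact this

/-- Move a pile to another pile, in reverse order. -/
noncomputable def transfer (a b : Pile) : Frag Unit :=
  loop (fun _ : Unit => (take a).bind fun o =>
    match o with
    | none => pure (.inr ())
    | some x => (put b x).bind fun _ => pure (.inl ())) ()

theorem sexec_transfer {a b : Pile} (hab : b ≠ a) (h : S.Ok s B) :
    SExec s B (transfer a b) S ()
      ((S.setPile a []).setPile b ((S.pile a).reverse ++ S.pile b)) := by
  generalize hl : S.pile a = l
  induction l generalizing S with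
  | nil =>
    have h1 := sexec_take a h
    have e : (S.setPile a []).setPile b ([].reverse ++ S.pile b) = S.setPile a (S.pile a).tail := by
      rw [hl, List.tail_nil, List.reverse_nil, List.nil_append]
      conv_lhs => rw [← St.pile_setPile_of_ne (S := S) hab []]
      rw [St.setPile_self]
    rw [e]
    rw [hl] at h1 ⊢
    exact SExec.done (h1.bind (sexec_pure _))
  | cons x l ih =>
    have h1 := sexec_take a h
    rw [hl] at h1
    have l1 := S.load_setPile a l
    rw [hl] at l1
    simp only [List.length_cons] at l1
    have hb := h.load_le
    have o1 : (S.setPile a l).Ok s B := h.setPile (by omega)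
    have h2 := sexec_put b x o1 (by omega)
    rw [St.pile_setPile_of_ne hab] at h2
    have l2 := (S.setPile a l).load_setPile b (x :: S.pile b)
    rw [St.pile_setPile_of_ne hab] at l2
    simp only [List.length_cons] at l2
    have := ih (S := (S.setPile a l).setPile b (x :: S.pile b)) (o1.setPile (by omega))
      (by rw [St.pile_setPile_of_ne hab.symm, St.pile_setPile])
    rw [St.pile_setPile, St.setPile_comm hab.symm, St.setPile_setPile, St.setPile_setPile] at this
    rw [List.reverse_cons, List.append_assoc]
    exact SExec.next (h1.bind (h2.bind (sexec_pure _))) this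

/-- Empty a stack of the simulated machine. -/
noncomputable def drain (i : Fin 2) : Frag Unit :=
  loop (fun _ : Unit => (takeStack i).bind fun o =>
    match o with
    | none => pure (.inr ())
    | some _ => pure (.inl ())) ()

theorem sexec_drain (i : Fin 2) (h : S.Ok s B) :
    SExec s B (drain i) S () { S with stack := Function.update S.stack i [] } := by
  generalize hl : S.stack i = l
  have h1 := sexec_takeStack i h
  induction l generalizing S with
  | nil =>
    rw [hl] at h1
    exact SExec.done (h1.bind (sexec_pure _))
  | cons x l ih =>
    rw [hl] at h1
    have o1 : St.Ok { S with stack := Function.update S.stack i l } s B := by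
      refine ⟨?_, h.2, h.3, h.4, h.5, h.6, h.7⟩
      have := h.1
      match i with
      | 0 => simp [hl] at this ⊢; omega
      | 1 => simp [hl] at this ⊢; omega
    have := ih o1 (by simp) (sexec_takeStack i o1)
    rw [Function.update_idem] at this
    exact SExec.next (h1.bind (sexec_pure _)) this

end Ops

attribute [instance] StackMachine.finite

/-! ### Simulating U to obtain one bit of its output -/

section Simulation

variable (U : StackMachine)

/-- Simulate a step of `U`. The output bit whose number is the initial value of the counter `time`
is kept in the second component of the state. -/
noncomputable def simStep (c : U.State × Option Bool) :
    Frag ((U.State × Option Bool) ⊕ Option Bool) :=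
  match U.request c.1 with
  | .readProgram q₀ q₁ qe => (take .progUnread).bind fun o =>
    match o with
    | none => pure (.inl (qe, c.2))
    | some x => (put .progRead x).bind fun _ => pure (.inl (if x then q₁ else q₀, c.2))
  | .readInput q₀ q₁ qe => (take .inpUnread).bind fun o =>
    match o with
    | none => pure (.inl (qe, c.2))
    | some x => (put .inpRead x).bind fun _ => pure (.inl (if x then q₁ else q₀, c.2))
  | .write b q => (test .time).bind fun z =>
    if z then (decr .time).bind fun _ => pure (.inl (q, c.2))
    else pure (.inl (q, c.2.or (some b)))
  | .push i b q => (putStack i b).bind fun _ => pure (.inl (q, c.2))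
  | .pop i q₀ q₁ qe => (takeStack i).bind fun o =>
    match o with
    | none => pure (.inl (qe, c.2))
    | some x => pure (.inl (if x then q₁ else q₀, c.2))
  | .isEmpty i qy qn => (takeStack i).bind fun o =>
    match o with
    | none => pure (.inl (qy, c.2))
    | some x => (putStack i x).bind fun _ => pure (.inl (qn, c.2))
  | .halt => pure (.inr c.2)

/-- Simulate `U` on the contents of the piles `progUnread` and `inpUnread`, and return the output
bit whose number is in the counter `index`. -/
noncomputable def getBit : Frag (Option Bool) :=
  (assign .time .index).bind fun _ => (loop (simStep U) (U.start, none)).bind fun o =>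
  (drain 0).bind fun _ => (drain 1).bind fun _ => (transfer .progRead .progUnread).bind fun _ =>
  (transfer .inpRead .inpUnread).bind fun _ => (assign .time .zero).bind fun _ => pure o

variable {U} {s B : ℕ} {S : St}

/-- The memory in the course of a simulation, after `u` has been read from the program and `v` has
been read from the input, both in reverse order. -/
def simSt (S : St) (a : U.Config) (u v : List Bool) : St :=
  { S with
    progUnread := a.program
    progRead := u
    inpUnread := a.input
    inpRead := v
    stack := a.stack
    time := S.index - a.output.length }

/-- Reading moves bits from the unread to the read half of a tape, so the total size of the piles
stays the same. -/
theorem ok_simSt (h : S.Ok s B) (h₁ : S.progRead = []) (h₂ : S.inpRead = []) {a : U.Config}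
    {u v : List Bool} (ha : a.space ≤ s) (hu : u.reverse ++ a.program = S.progUnread)
    (hv : v.reverse ++ a.input = S.inpUnread) : (simSt S a u v).Ok s B := by
  refine ⟨ha, ?_, h.3, h.4, h.5, (Nat.sub_le _ _).trans h.7, h.7⟩
  have := h.load_le
  have e₁ := congrArg List.length hu
  have e₂ := congrArg List.length hv
  simp only [St.load, simSt, h₁, h₂] at this ⊢
  simp at e₁ e₂ this
  omega

/-- The output tape of `U` is not kept in memory. The counter `time` holds how many output bits are
still to be skipped, and the control holds the wanted bit once it has been written. -/
theorem sexec_simStep (h : S.Ok s B) (h₁ : S.progRead = []) (h₂ : S.inpRead = []) {a a' : U.Config}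
    {u v : List Bool} (ha : a.space ≤ s) (ha' : a'.space ≤ s) (hs : U.step a = some a')
    (hu : u.reverse ++ a.program = S.progUnread) (hv : v.reverse ++ a.input = S.inpUnread) :
    ∃ u' v', u'.reverse ++ a'.program = S.progUnread ∧ v'.reverse ++ a'.input = S.inpUnread ∧
      SExec s B (simStep U (a.state, a.output[S.index]?)) (simSt S a u v)
        (.inl (a'.state, a'.output[S.index]?)) (simSt S a' u' v') := by
  have ok := ok_simSt h h₁ h₂ ha hu hv
  have hB := ok.load_le
  obtain ⟨q, p, x, stk, out⟩ := a
  simp only at hu hv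
  unfold simStep
  simp only [StackMachine.step] at hs
  generalize U.request q = r at hs
  cases r with
  | readProgram q₀ q₁ qe =>
    have ht := sexec_take .progUnread ok
    rcases p with _ | ⟨b, p⟩
    · simp only [Option.some.injEq] at hs
      subst hs
      exact ⟨u, v, hu, hv, ht.bind (sexec_pure _)⟩
    · have e : a' = ⟨if b then q₁ else q₀, p, x, stk, out⟩ := by
        cases b <;> simpa using hs.symm
      subst e
      refine ⟨b :: u, v, by simpa using hu, hv, ht.bind ?_⟩
      have ok1 : ((simSt S (⟨q, b :: p, x, stk, out⟩ : U.Config) u v).setPile .progUnread p).Ok s B :=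
        ok.setPile (by simp [simSt, St.load, St.setPile] at hB ⊢; omega)
      exact (sexec_put .progRead b ok1
        (by simp [simSt, St.load, St.setPile] at hB ⊢; omega)).bind (sexec_pure _)
  | readInput q₀ q₁ qe =>
    have ht := sexec_take .inpUnread ok
    rcases x with _ | ⟨b, x⟩
    · simp only [Option.some.injEq] at hs
      subst hs
      exact ⟨u, v, hu, hv, ht.bind (sexec_pure _)⟩
    · have e : a' = ⟨if b then q₁ else q₀, p, x, stk, out⟩ := by
        cases b <;> simpa using hs.symm
      subst e
      refine ⟨u, b :: v, hu, by simpa using hv, ht.bind ?_⟩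
      have ok1 : ((simSt S (⟨q, p, b :: x, stk, out⟩ : U.Config) u v).setPile .inpUnread x).Ok s B :=
        ok.setPile (by simp [simSt, St.load, St.setPile] at hB ⊢; omega)
      exact (sexec_put .inpRead b ok1
        (by simp [simSt, St.load, St.setPile] at hB ⊢; omega)).bind (sexec_pure _)
  | write b q' =>
    simp only [Option.some.injEq] at hs
    subst hs
    refine ⟨u, v, hu, hv, ?_⟩
    have ht := sexec_test .time ok
    have et : (simSt S (⟨q, p, x, stk, out⟩ : U.Config) u v).ctr .time = S.index - out.length := rfl
    rw [et] at ht
    by_cases hlt : out.length < S.index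
    · rw [decide_eq_true (by omega)] at ht
      refine ht.bind ((sexec_decr ok (by rw [et]; omega)).bind ?_)
      -- The wanted position has not been reached, so both sides are `none`.
      have e1 : (out ++ [b])[S.index]? = out[S.index]? := by
        rw [List.getElem?_append_right (by omega), List.getElem?_eq_none (by simp; omega),
          List.getElem?_eq_none (by omega)]
      have e2 : simSt S (⟨q', p, x, stk, out ++ [b]⟩ : U.Config) u v =
          (simSt S (⟨q, p, x, stk, out⟩ : U.Config) u v).setCtr .time
            (S.index - out.length - 1) := by
        simp only [simSt, St.setCtr, List.length_append, List.length_singleton]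
        congr 1
      simp only [e1]
      rw [e2]
      exact sexec_pure _
    · rw [decide_eq_false (by omega)] at ht
      refine ht.bind ?_
      -- From the wanted position on, `or` retains the first bit written and ignores later ones.
      have e1 : (out ++ [b])[S.index]? = out[S.index]?.or (some b) := by
        rcases Nat.lt_or_ge S.index out.length with h | h
        · rw [List.getElem?_append_left h, List.getElem?_eq_getElem h]
          rfl
        · have : S.index = out.length := by omega
          simp [this]
      have e2 : simSt S (⟨q', p, x, stk, out ++ [b]⟩ : U.Config) u v =
          simSt S (⟨q, p, x, stk, out⟩ : U.Config) u v := by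
        simp only [simSt, List.length_append, List.length_singleton]
        congr 1
        omega
      simp only [e1]
      rw [e2]
      exact sexec_pure _
  | push i b q' =>
    simp only [Option.some.injEq] at hs
    subst hs
    refine ⟨u, v, hu, hv, ?_⟩
    have hsp : (stk 0).length + (stk 1).length + 1 ≤ s := by
      simp only [Config.space] at ha'
      match i with
      | 0 => simp at ha'; omega
      | 1 => simp at ha'; omega
    exact (sexec_putStack i b ok hsp).bind (sexec_pure _)
  | pop i q₀ q₁ qe =>
    have ht := sexec_takeStack i ok
    have et : (simSt S (⟨q, p, x, stk, out⟩ : U.Config) u v).stack i = stk i := rfl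
    rw [et] at ht
    rcases hi : stk i with _ | ⟨b, l⟩
    · simp only [hi, Option.some.injEq] at hs
      subst hs
      rw [hi] at ht
      refine ⟨u, v, hu, hv, ht.bind ?_⟩
      have e : Function.update (simSt S (⟨q, p, x, stk, out⟩ : U.Config) u v).stack i
          (List.tail []) = stk := by
        rw [List.tail_nil, ← hi]
        exact Function.update_eq_self _ _
      rw [e]
      exact sexec_pure _
    · have e : a' = ⟨if b then q₁ else q₀, p, x, Function.update stk i l, out⟩ := by
        cases b <;> simpa [hi] using hs.symm
      subst e
      rw [hi] at ht
      exact ⟨u, v, hu, hv, ht.bind (sexec_pure _)⟩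
  | isEmpty i qy qn =>
    have ht := sexec_takeStack i ok
    have et : (simSt S (⟨q, p, x, stk, out⟩ : U.Config) u v).stack i = stk i := rfl
    rw [et] at ht
    rcases hi : stk i with _ | ⟨b, l⟩
    · simp only [hi, Option.some.injEq] at hs
      subst hs
      rw [hi] at ht
      refine ⟨u, v, hu, hv, ht.bind ?_⟩
      have e : Function.update (simSt S (⟨q, p, x, stk, out⟩ : U.Config) u v).stack i
          (List.tail []) = stk := by
        rw [List.tail_nil, ← hi]
        exact Function.update_eq_self _ _
      rw [e]
      exact sexec_pure _
    · simp only [hi, Option.some.injEq] at hs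
      subst hs
      rw [hi] at ht
      refine ⟨u, v, hu, hv, ht.bind ?_⟩
      have e : Function.update (simSt S (⟨q, p, x, stk, out⟩ : U.Config) u v).stack i
          (List.tail (b :: l)) = Function.update stk i l := rfl
      rw [e]
      -- Emptiness is tested by a pop. The popped bit is returned to its place, so the simulated
      -- space does not grow.
      have hsp : ((Function.update stk i l) 0).length + ((Function.update stk i l) 1).length + 1
          ≤ s := by
        simp only [Config.space] at ha
        match i with
        | 0 => simp [hi] at ha ⊢; omega
        | 1 => simp [hi] at ha ⊢; omega
      have ok1 : St.Ok { simSt S (⟨q, p, x, stk, out⟩ : U.Config) u v with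
          stack := Function.update stk i l } s B :=
        ⟨by simp only; omega, ok.2, ok.3, ok.4, ok.5, ok.6, ok.7⟩
      refine (sexec_putStack i b ok1 hsp).bind ?_
      have e : Function.update (Function.update stk i l) i (b :: Function.update stk i l i) = stk := by
        rw [Function.update_self, Function.update_idem, ← hi, Function.update_eq_self]
      simp only [e]
      exact sexec_pure _
  | halt => simp at hs

theorem sexec_simulate (h : S.Ok s B) (h₁ : S.progRead = []) (h₂ : S.inpRead = [])
    {a a' : U.Config}
    (hr : Relation.ReflTransGen (fun b b' : U.Config => U.step b = some b' ∧ b'.space ≤ s) a a')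
    (hh : U.step a' = none) {u v : List Bool} (ha : a.space ≤ s)
    (hu : u.reverse ++ a.program = S.progUnread) (hv : v.reverse ++ a.input = S.inpUnread) :
    ∃ u' v', u'.reverse ++ a'.program = S.progUnread ∧ v'.reverse ++ a'.input = S.inpUnread ∧
      a'.space ≤ s ∧ SExec s B (loop (simStep U) (a.state, a.output[S.index]?)) (simSt S a u v)
        a'.output[S.index]? (simSt S a' u' v') := by
  induction hr using Relation.ReflTransGen.head_induction_on generalizing u v with
  | refl =>
    refine ⟨u, v, hu, hv, ha, SExec.done ?_⟩
    have e : U.request a'.state = .halt := by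
      rw [StackMachine.step_eq_act] at hh
      simp only [Option.map_eq_none_iff] at hh
      generalize U.request a'.state = r at hh
      cases r <;> simp only [Request.act] at hh <;> first | rfl | (split at hh <;> simp at hh) |
        simp at hh
    unfold simStep
    rw [e]
    exact sexec_pure _
  | head hab _ ih =>
    obtain ⟨u₁, v₁, hu₁, hv₁, e₁⟩ := sexec_simStep h h₁ h₂ ha hab.2 hab.1 hu hv
    obtain ⟨u₂, v₂, hu₂, hv₂, hs₂, e₂⟩ := ih hab.2 hu₁ hv₁
    exact ⟨u₂, v₂, hu₂, hv₂, hs₂, SExec.next e₁ e₂⟩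

/-- `U` may halt with nonempty stacks and partly read tapes. Draining the stacks and rewinding the
tapes restores `S` exactly, so the simulation can be repeated for each digit; this trades time for
the space that the whole output would take. -/
theorem sexec_getBit (h : S.Ok s B) (h₁ : S.progRead = []) (h₂ : S.inpRead = [])
    (h₃ : S.stack = fun _ => []) (h₄ : S.time = 0) {out : List Bool}
    (hU : U.Computes s S.progUnread S.inpUnread out) :
    SExec s B (getBit U) S out[S.index]? S := by
  obtain ⟨a, hr, hh, rfl⟩ := hU
  obtain ⟨u, v, hu, hv, hs, he⟩ := sexec_simulate h h₁ h₂ hr hh (u := []) (v := [])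
    (by simp [Config.space, init]) rfl rfl
  have e : S.setCtr .time (S.ctr .index) = simSt S (U.init S.progUnread S.inpUnread) [] [] := by
    obtain ⟨⟩ := S
    simp only at h₁ h₂ h₃
    subst h₁ h₂ h₃
    rfl
  have ok := ok_simSt h h₁ h₂ hs hu hv
  refine SExec.bind (sexec_assign (x := .time) nofun .index h) ?_
  rw [e]
  refine he.bind ?_
  refine (sexec_drain 0 ok).bind ?_
  have ok1 : St.Ok { simSt S a u v with stack := Function.update (simSt S a u v).stack 0 [] } s B :=
    ⟨by simp; exact (Nat.le_add_left _ _).trans ok.1, ok.2, ok.3, ok.4, ok.5, ok.6, ok.7⟩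
  refine (sexec_drain 1 ok1).bind ?_
  have e1 : Function.update (Function.update (simSt S a u v).stack 0 []) 1 [] = S.stack := by
    rw [h₃]
    funext k
    match k with
    | 0 => simp
    | 1 => simp
  simp only [e1]
  have ok2 : St.Ok { simSt S a u v with stack := S.stack } s B :=
    ⟨by simp [h₃], ok.2, ok.3, ok.4, ok.5, ok.6, ok.7⟩
  have t1 : SExec s B (transfer .progRead .progUnread) { simSt S a u v with stack := S.stack } ()
      { simSt S a u v with
        stack := S.stack, progRead := [], progUnread := u.reverse ++ a.program } :=
    sexec_transfer nofun ok2
  rw [hu, ← h₁] at t1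
  have ok3 : St.Ok { simSt S a u v with
      stack := S.stack, progRead := S.progRead, progUnread := S.progUnread } s B := by
    refine ⟨ok2.1, ?_, ok.3, ok.4, ok.5, ok.6, ok.7⟩
    have := ok.2
    have e₁ := congrArg List.length hu
    simp only [St.load, simSt, h₁] at this ⊢
    simp at e₁ this ⊢
    omega
  have t2 : SExec s B (transfer .inpRead .inpUnread) { simSt S a u v with
      stack := S.stack, progRead := S.progRead, progUnread := S.progUnread } ()
      { simSt S a u v with
        stack := S.stack, progRead := S.progRead, progUnread := S.progUnread, inpRead := [],
        inpUnread := v.reverse ++ a.input } :=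
    sexec_transfer nofun ok3
  rw [hv, ← h₂] at t2
  refine t1.bind (t2.bind ?_)
  have ok4 : St.Ok { simSt S a u v with
      stack := S.stack, progRead := S.progRead, progUnread := S.progUnread, inpRead := S.inpRead,
      inpUnread := S.inpUnread } s B := by
    refine ⟨ok2.1, h.2, ok.3, ok.4, ok.5, ok.6, ok.7⟩
  have t3 := sexec_assign (x := .time) nofun .zero ok4
  have e3 : St.setCtr { simSt S a u v with
      stack := S.stack, progRead := S.progRead, progUnread := S.progUnread, inpRead := S.inpRead,
      inpUnread := S.inpUnread } .time (St.ctr { simSt S a u v with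
      stack := S.stack, progRead := S.progRead, progUnread := S.progUnread, inpRead := S.inpRead,
      inpUnread := S.inpUnread } .zero) = S := by
    obtain ⟨⟩ := S
    simp only at h₄
    subst h₄
    rfl
  rw [e3] at t3
  exact t3.bind (sexec_pure _)

end Simulation

end Frag

/-! ### Binary digits -/

/-- The number with the given binary digits, least significant first. -/
def bitsVal (l : List Bool) : ℕ := l.foldr Nat.bit 0

@[simp] theorem bitsVal_nil : bitsVal [] = 0 := rfl

@[simp] theorem bitsVal_cons (b : Bool) (l : List Bool) :
    bitsVal (b :: l) = Nat.bit b (bitsVal l) := rfl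

theorem bitsVal_append (l l' : List Bool) :
    bitsVal (l ++ l') = bitsVal l + 2 ^ l.length * bitsVal l' := by
  induction l with
  | nil => simp
  | cons b l ih => simp [ih, Nat.bit_val, pow_succ]; ring

theorem bits_bitsVal_append_true (l : List Bool) :
    Nat.bits (bitsVal (l ++ [true])) = l ++ [true] := by
  induction l with
  | nil => simp
  | cons b l ih =>
    rw [List.cons_append, bitsVal_cons, Nat.bits_append_bit, ih]
    intro h
    rw [h] at ih
    simp at ih

/-- Here `l` starts with the most significant digit. Once its leading zeros are gone, the reversed
list ends in `true` or is empty, hence is canonical. -/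
theorem reverse_dropWhile_not (l : List Bool) :
    (l.dropWhile (!·)).reverse = Nat.bits (bitsVal l.reverse) := by
  induction l with
  | nil => simp
  | cons b l ih =>
    cases b
    · simp [ih, bitsVal_append]
    · simp [bits_bitsVal_append_true]

theorem bitsVal_bits (n : ℕ) : bitsVal n.bits = n := by
  induction n using Nat.binaryRec' with
  | zero => simp
  | bit b n h ih => rw [Nat.bits_append_bit _ _ h, bitsVal_cons, ih]

theorem length_bits (n : ℕ) : n.bits.length = n.size := Nat.size_eq_bits_len n

namespace Frag

namespace St

/-- The memory is ready for a simulation. -/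
structure Ready (S : St) : Prop where
  progRead : S.progRead = []
  inpRead : S.inpRead = []
  stack : S.stack = fun _ => []
  time : S.time = 0

end St

/-! ### Comparison and subtraction with recomputed digits -/

section Arithmetic

variable (U : StackMachine)

/-- Set the counter `index` to the number of digits of the positive part of the integer that `U`
outputs. -/
noncomputable def seekEnd : Frag Unit :=
  (assign .index .zero).bind fun _ => (getBit U).bind fun o =>
  match o with
  | some true => pure ()
  | _ =>
    (loop (fun _ : Unit => (getBit U).bind fun o =>
      match o with
      | none => pure (.inr ())
      | some _ => (incr .index).bind fun _ => pure (.inl ())) ()).bind fun _ => decr .index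

/-- The borrow bit when the bits `n` and `c` are subtracted from the bit `x`. -/
def borrow (x n c : Bool) : Bool := (!x && (n || c)) || (n && c)

/-- Get the next digit of the output of `U`, the least significant ones first. -/
noncomputable def nextDigit : Frag (Option Bool) :=
  (test .index).bind fun z =>
  if z then (getBit U).bind fun o => (decr .index).bind fun _ => pure (some (o.getD false))
  else pure none

/-- Compare the number in the pile `num` with the output of `U`, and move it, or, if `w` holds, the
difference, to the pile `aux`. The result is the final borrow bit. -/
noncomputable def subtract (w c : Bool) : Frag Bool :=
  loop (fun c => (nextDigit U).bind fun n => (take .num).bind fun x =>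
    match x with
    | none => match n with
      | none => pure (.inr c)
      | some n => pure (.inl (n || c))
    | some x =>
      (put .aux (if w then xor x (xor (n.getD false) c) else x)).bind fun _ =>
        pure (.inl (borrow x (n.getD false) c))) c

/-- Move a number from the pile `aux` to the pile `num` and remove leading zeros. -/
noncomputable def normalize : Frag Unit :=
  (loop (fun _ : Unit => (take .aux).bind fun o =>
    match o with
    | none => pure (.inr ())
    | some false => pure (.inl ())
    | some true => (put .aux true).bind fun _ => pure (.inr ())) ()).bind fun _ =>
  transfer .aux .num

variable {U} {s B : ℕ} {S : St}

/-- Without normalization the remainder would keep the length of the initial number. The space bound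
relies on its shrinking to `Nat.size` digits. -/
theorem sexec_normalize (h : S.Ok s B) (hS : S.num = []) :
    SExec s B normalize S () { S with aux := [], num := Nat.bits (bitsVal S.aux.reverse) } := by
  rw [← reverse_dropWhile_not]
  obtain ⟨l, hl⟩ : ∃ l, S.aux = l := ⟨_, rfl⟩
  have hle : (l.dropWhile (!·)).length ≤ l.length := (List.dropWhile_sublist _).length_le
  refine SExec.bind (x := ()) (S₁ := { S with aux := S.aux.dropWhile (!·) }) ?_ ?_
  · rw [hl]
    clear hle
    induction l generalizing S with
    | nil =>
      have ht := sexec_take .aux h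
      have e : S.pile .aux = [] := hl
      rw [e] at ht
      exact SExec.done (ht.bind (sexec_pure _))
    | cons b l ih =>
      have ht := sexec_take .aux h
      have e : S.pile .aux = b :: l := hl
      rw [e] at ht
      have hB := h.load_le
      have ok : (S.setPile .aux l).Ok s B :=
        h.setPile (by simp only [St.load, St.setPile, hl, List.length_cons] at hB ⊢; omega)
      cases b
      · have := ih ok hS rfl
        exact SExec.next (ht.bind (sexec_pure _)) this
      · have hp := sexec_put .aux true ok
          (by simp only [St.load, St.setPile, hl, List.length_cons] at hB ⊢; omega)
        exact SExec.done (ht.bind (hp.bind (sexec_pure _)))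
  · have hB := h.load_le
    have ok : St.Ok { S with aux := S.aux.dropWhile (!·) } s B :=
      ⟨h.1, by simp only [St.load, hl] at hB ⊢; omega, h.3, h.4, h.5, h.6, h.7⟩
    have t : SExec s B (transfer .aux .num) { S with aux := S.aux.dropWhile (!·) } ()
        { S with aux := [], num := (S.aux.dropWhile (!·)).reverse ++ S.num } :=
      sexec_transfer nofun ok
    have e : (S.aux.dropWhile (!·)).reverse ++ S.num = (S.aux.dropWhile (!·)).reverse := by
      rw [hS, List.append_nil]
    rw [e] at t
    exact t

theorem St.Ready.setIndex (h : S.Ready) (n : ℕ) : St.Ready { S with index := n } :=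
  ⟨h.1, h.2, h.3, h.4⟩

theorem St.Ok.setIndex (h : S.Ok s B) {n : ℕ} (hn : n ≤ B) : St.Ok { S with index := n } s B :=
  ⟨h.1, h.2, h.3, h.4, h.5, h.6, hn⟩

theorem sexec_getBit_of_ready (h : S.Ok s B) (hr : S.Ready) {out : List Bool}
    (hU : U.Computes s S.progUnread S.inpUnread out) :
    SExec s B (getBit U) S out[S.index]? S :=
  sexec_getBit h hr.1 hr.2 hr.3 hr.4 hU

/-- The output starts with the sign. A negative integer is replaced by `0`, with no digits.
Otherwise the end of the output is found by asking for one position after another, and the sign is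
discounted by the final decrement. -/
theorem sexec_seekEnd (h : S.Ok s B) (hr : S.Ready) {N : ℤ}
    (hU : U.Computes s S.progUnread S.inpUnread (intCode N)) (hN : (intCode N).length ≤ B) :
    SExec s B (seekEnd U) S () { S with index := N.toNat.size } := by
  have ok0 := h.setIndex (Nat.zero_le B)
  refine SExec.bind (sexec_assign (x := .index) nofun .zero h) ?_
  have g0 := sexec_getBit_of_ready ok0 (hr.setIndex 0) hU
  refine SExec.bind g0 ?_
  have e0 : (intCode N)[0]? = some (decide (N < 0)) := rfl
  rw [e0]
  by_cases hneg : N < 0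
  · rw [decide_eq_true hneg]
    have e : N.toNat.size = 0 := by
      rw [Int.toNat_of_nonpos hneg.le]; rfl
    rw [e]
    exact sexec_pure _
  · rw [decide_eq_false hneg]
    have key : ∀ i, i ≤ (intCode N).length →
        SExec s B (loop (fun _ : Unit => (getBit U).bind fun o =>
          match o with
          | none => pure (.inr ())
          | some _ => (incr .index).bind fun _ => pure (.inl ())) ())
          { S with index := i } () { S with index := (intCode N).length } := by
      intro i hi
      induction hi using Nat.decreasingInduction with
      | self =>
        have g := sexec_getBit_of_ready (h.setIndex hN) (hr.setIndex _) hU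
        have e : (intCode N)[(intCode N).length]? = none := List.getElem?_eq_none le_rfl
        simp only [e] at g
        exact SExec.done (g.bind (sexec_pure _))
      | of_succ i hi ih =>
        have ok := h.setIndex (n := i) (by omega)
        have g := sexec_getBit_of_ready ok (hr.setIndex _) hU
        have e : (intCode N)[i]? = some (intCode N)[i] := List.getElem?_eq_getElem hi
        simp only [e] at g
        have hi' := sexec_incr (x := .index) nofun ok (by simp only [St.ctr]; omega)
        exact SExec.next (g.bind (hi'.bind (sexec_pure _))) ih
    refine (key 0 (Nat.zero_le _)).bind ?_
    have hd := sexec_decr (x := .index) (h.setIndex hN) (by simp [St.ctr, intCode])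
    have e : (intCode N).length - 1 = N.toNat.size := by
      have : N.toNat = N.natAbs := by omega
      simp [intCode, natCode, this, length_bits]
    rw [← e]
    exact hd

/-- `n` consists of the digits of an output, least significant first, from position `|n|` down. -/
def DigitsOf (out n : List Bool) : Prop :=
  ∀ i (h : i < n.length), out[n.length - i]? = some n[i]

/-- The sign occupies position `0`, so the digit of weight `2 ^ i` sits at position size minus `i`,
and index `0` means that no digit is left. -/
theorem digitsOf_intCode (N : ℤ) : DigitsOf (intCode N) N.toNat.bits := by
  intro i hi
  have hpos : 0 ≤ N := by
    by_contra hneg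
    rw [Int.toNat_of_nonpos (by omega)] at hi
    simp at hi
  have e : N.natAbs = N.toNat := by omega
  rw [intCode, natCode, e]
  have e2 : N.toNat.bits.length - i = (N.toNat.bits.length - 1 - i) + 1 := by omega
  rw [e2, List.getElem?_cons_succ, List.getElem?_reverse (by omega)]
  have e3 : N.toNat.bits.length - 1 - (N.toNat.bits.length - 1 - i) = i := by omega
  rw [e3, List.getElem?_eq_getElem hi]

theorem DigitsOf.tail {out : List Bool} {b : Bool} {n : List Bool} (h : DigitsOf out (b :: n)) :
    DigitsOf out n := by
  intro i hi
  have := h (i + 1) (by simpa using hi)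
  simpa using this

theorem sexec_nextDigit (h : S.Ok s B) (hr : S.Ready) {out n : List Bool}
    (hU : U.Computes s S.progUnread S.inpUnread out) (hn : DigitsOf out n)
    (hi : S.index = n.length) :
    SExec s B (nextDigit U) S n.head? { S with index := n.tail.length } := by
  have ht := sexec_test .index h
  have e : S.ctr .index = n.length := hi
  rw [e] at ht
  rcases n with _ | ⟨b, n⟩
  · refine ht.bind ?_
    have : ({ S with index := ([] : List Bool).tail.length } : St) = S := by
      obtain ⟨⟩ := S
      simp only at hi
      subst hi
      rfl
    rw [this]
    exact sexec_pure _
  · refine ht.bind ?_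
    have g := sexec_getBit_of_ready h hr hU
    have hb := hn 0 (by simp)
    rw [Nat.sub_zero] at hb
    rw [hi, hb] at g
    have hd := sexec_decr (x := .index) h (by rw [e]; simp)
    rw [e] at hd
    exact g.bind (hd.bind (sexec_pure _))

/-- School subtraction from the least significant digit; the final borrow is the comparison. With `w
= false` the digits of `r` survive, so the comparison can precede the decision to subtract. -/
theorem sexec_subtract (h : S.Ok s B) (hr : S.Ready) {out n r : List Bool}
    (hU : U.Computes s S.progUnread S.inpUnread out) (hn : DigitsOf out n)
    (hi : S.index = n.length) (hnum : S.num = r) (w c : Bool) :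
    ∃ d : List Bool,
      SExec s B (subtract U w c) S (decide (bitsVal r < bitsVal n + c.toNat))
        { S with num := [], index := 0, aux := d.reverse ++ S.aux } ∧
      d.length = r.length ∧ (w = false → d = r) ∧
      (w = true → bitsVal n + c.toNat ≤ bitsVal r →
        bitsVal d + (bitsVal n + c.toNat) = bitsVal r) := by
  -- Either number may run out of digits first, so the induction is on a bound for both lengths
  -- together.
  obtain ⟨f, hf⟩ : ∃ f, r.length + n.length ≤ f := ⟨_, le_rfl⟩
  have e3 : ∀ c, decide (bitsVal [] < bitsVal [] + Bool.toNat c) = c := by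
    intro c; cases c <;> simp
  induction f generalizing S n r c with
  | zero =>
    obtain rfl : r = [] := List.length_eq_zero_iff.1 (by omega)
    obtain rfl : n = [] := List.length_eq_zero_iff.1 (by omega)
    refine ⟨[], ?_, rfl, fun _ => rfl, fun _ _ => by simp_all⟩
    have hd := sexec_nextDigit h hr hU hn hi
    have ht := sexec_take .num (h.setIndex (n := 0) (Nat.zero_le _))
    have e : St.pile { S with index := 0 } .num = [] := hnum
    rw [e] at ht
    rw [e3]
    exact SExec.done (hd.bind (ht.bind (sexec_pure _)))
  | succ f ih =>
    have hd := sexec_nextDigit h hr hU hn hi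
    have hidx := h.index_le
    have ok := h.setIndex (n := n.tail.length) (by simp; omega)
    have ht := sexec_take .num ok
    have htail : DigitsOf out n.tail := by
      cases n with
      | nil => exact hn
      | cons b n => exact hn.tail
    rcases r with _ | ⟨x, r⟩
    · have e : St.pile { S with index := n.tail.length } .num = [] := hnum
      rw [e] at ht
      have e' : St.setPile { S with index := n.tail.length } .num (List.tail []) =
          { S with index := n.tail.length } := by
        obtain ⟨⟩ := S
        simp only at hnum
        subst hnum
        rfl
      rcases n with _ | ⟨b, n⟩
      · refine ⟨[], ?_, rfl, fun _ => rfl, fun _ _ => by simp_all⟩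
        rw [e3]
        exact SExec.done (hd.bind (ht.bind (sexec_pure _)))
      · rw [e'] at ht
        obtain ⟨d, h1, h0, h2, h3⟩ := ih ok (hr.setIndex _) hU htail rfl hnum (b || c)
          (by simp at hf ⊢; omega)
        refine ⟨d, ?_, h0, h2, ?_⟩
        -- When `r` is exhausted, a further digit of the output matters only by being nonzero, and
        -- is merged into the borrow.
        · have e3 : decide (bitsVal [] < bitsVal (b :: n) + c.toNat) =
              decide (bitsVal [] < bitsVal n + (b || c).toNat) := by
            cases b <;> cases c <;> simp [Nat.bit_val]
          rw [e3]
          exact SExec.next (hd.bind (ht.bind (sexec_pure _))) h1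
        · intro hw hle
          have := h3 hw (by
            cases b <;> cases c <;> simp [Nat.bit_val] at hle ⊢ <;> omega)
          cases b <;> cases c <;> simp [Nat.bit_val] at this hle ⊢ <;> omega
    · have e : St.pile { S with index := n.tail.length } .num = x :: r := hnum
      rw [e] at ht
      have hB := h.load_le
      have ok1 : St.Ok { S with index := n.tail.length, num := r } s B :=
        ok.setPile (a := .num) (l := r)
          (by simp only [St.load, St.setPile, hnum, List.length_cons] at hB ⊢; omega)
      have hp := sexec_put .aux (if w then xor x (xor (n.headD false) c) else x) ok1
        (by simp only [St.load, hnum, List.length_cons] at hB ⊢; omega)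
      have ok2 : St.Ok { S with
          index := n.tail.length
          num := r
          aux := (if w then xor x (xor (n.headD false) c) else x) :: S.aux } s B :=
        ok1.setPile (a := .aux) (l := _ :: S.aux)
          (by simp only [St.load, St.setPile, hnum, List.length_cons] at hB ⊢; omega)
      obtain ⟨d, h1, h0, h2, h3⟩ := ih ok2 ⟨hr.1, hr.2, hr.3, hr.4⟩ hU htail rfl rfl
        (borrow x (n.headD false) c) (by simp at hf ⊢; omega)
      have eh : n.head?.getD false = n.headD false := by cases n <;> rfl
      have ev : bitsVal n = (n.headD false).toNat + 2 * bitsVal n.tail := by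
        cases n <;> simp [Nat.bit_val, add_comm]
      refine ⟨(if w then xor x (xor (n.headD false) c) else x) :: d, ?_, by simp [h0], ?_, ?_⟩
      · have e3 : decide (bitsVal (x :: r) < bitsVal n + c.toNat) =
            decide (bitsVal r < bitsVal n.tail + (borrow x (n.headD false) c).toNat) := by
          rw [ev]
          congr 1
          cases x <;> cases n.headD false <;> cases c <;>
            simp [Nat.bit_val, borrow] <;> omega
        rw [e3, List.reverse_cons, List.append_assoc]
        refine SExec.next (hd.bind (ht.bind ?_)) h1
        simp only [List.head?_cons, eh]
        exact hp.bind (sexec_pure _)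
      · intro hw
        simp [hw, h2 hw]
      · intro hw hle
        rw [ev] at hle ⊢
        have := h3 hw (by
          revert hle
          cases x <;> cases n.headD false <;> cases c <;>
            simp [Nat.bit_val, borrow] <;> omega)
        revert this
        rw [hw]
        cases x <;> cases n.headD false <;> cases c <;>
            simp [Nat.bit_val, borrow] <;> omega

end Arithmetic

/-! ### The arithmetic decoding loop -/

section Decoding

variable (U : StackMachine)

/-- Decode one bit: the next bit of the auxiliary input and the decoded bit are appended to the
input of the simulated machine. -/
noncomputable def decodeStep (last : Bool) : Frag (Bool ⊕ Bool) :=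
  (take .side).bind fun o =>
  match o with
  | none => pure (.inr last)
  | some b =>
    (transfer .inpUnread .inpRead).bind fun _ => (put .inpRead b).bind fun _ =>
    (put .inpRead false).bind fun _ => (transfer .inpRead .inpUnread).bind fun _ =>
    (seekEnd U).bind fun _ => (subtract U false false).bind fun c => normalize.bind fun _ =>
    if c then pure (.inl false)
    else
      (seekEnd U).bind fun _ => (subtract U true false).bind fun _ => normalize.bind fun _ =>
      (transfer .inpUnread .inpRead).bind fun _ => (take .inpRead).bind fun _ =>
      (put .inpRead true).bind fun _ => (transfer .inpRead .inpUnread).bind fun _ =>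
      pure (.inl true)

variable {U} {s B : ℕ} {S : St}

/-- `U` is run on the branch with the tentative bit `0`. If its mass fits into the remainder, it is
subtracted and the tentative bit becomes `1`. One bit of `side` turns into two bits of the simulated
input, whence the extra unit in `hB`. -/
theorem sexec_decodeStep (h : S.Ok s B) (hr : S.Ready) (haux : S.aux = []) {b : Bool}
    {ys z : List Bool} (hside : S.side = b :: ys) (hinp : S.inpUnread = z) {r : ℕ}
    (hnum : S.num = r.bits) {N : ℤ}
    (hU : U.Computes s S.progUnread (z ++ [b, false]) (intCode N))
    (hN : (intCode N).length ≤ B) (hB : S.load + 1 ≤ B) (last : Bool) :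
    SExec s B (decodeStep U last) S (.inl (decide (N.toNat ≤ r)))
      { S with
        side := ys
        inpUnread := z ++ [b, decide (N.toNat ≤ r)]
        num := (if N.toNat ≤ r then r - N.toNat else r).bits
        index := 0 } := by
  obtain ⟨program, input, output, stack, p, pr, iu, ir, side, num, aux, k, j, hf, t, i⟩ := S
  obtain ⟨h1, h2, h3, h4⟩ := hr
  simp only at h1 h2 h3 h4 haux hside hinp hnum hU
  subst h1 h2 h3 h4 haux hside hinp hnum
  have hl : p.length + iu.length + ys.length + r.bits.length + 2 ≤ B := by
    simp [St.load] at hB ⊢; omega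
  have hi := h.index_le
  -- append the bits `b` and `false` to the input
  have t0 := sexec_take .side h
  have ok1 : St.Ok ⟨program, input, output, fun _ => [], p, [], iu, [], ys, r.bits, [],
      k, j, hf, 0, i⟩ s B :=
    ⟨h.1, by simp only [St.load, List.length_nil]; omega, h.3, h.4, h.5, h.6, h.7⟩
  have t1 := sexec_transfer (a := .inpUnread) (b := .inpRead) nofun ok1
  have ok2 : St.Ok ⟨program, input, output, fun _ => [], p, [], [], iu.reverse ++ [], ys, r.bits,
      [], k, j, hf, 0, i⟩ s B :=
    ⟨h.1, by simp [St.load]; omega, h.3, h.4, h.5, h.6, h.7⟩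
  have t2 := sexec_put .inpRead b ok2 (by simp [St.load]; omega)
  have ok3 : St.Ok ⟨program, input, output, fun _ => [], p, [], [], b :: (iu.reverse ++ []), ys,
      r.bits, [], k, j, hf, 0, i⟩ s B :=
    ⟨h.1, by simp [St.load]; omega, h.3, h.4, h.5, h.6, h.7⟩
  have t3 := sexec_put .inpRead false ok3 (by simp [St.load]; omega)
  have ok4 : St.Ok ⟨program, input, output, fun _ => [], p, [], [],
      false :: b :: (iu.reverse ++ []), ys, r.bits, [], k, j, hf, 0, i⟩ s B :=
    ⟨h.1, by simp [St.load]; omega, h.3, h.4, h.5, h.6, h.7⟩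
  have t4 : SExec s B (transfer .inpRead .inpUnread) _ () ⟨program, input, output, fun _ => [], p,
      [], (false :: b :: (iu.reverse ++ [])).reverse ++ [], [], ys, r.bits, [], k, j, hf, 0, i⟩ :=
    sexec_transfer (a := .inpRead) (b := .inpUnread) nofun ok4
  have e4 : (false :: b :: (iu.reverse ++ [])).reverse ++ [] = iu ++ [b, false] := by simp
  rw [e4] at t4
  refine t0.bind (t1.bind (t2.bind (t3.bind (t4.bind ?_))))
  -- compare
  have hsize : N.toNat.size ≤ B := by
    refine le_trans ?_ hN
    rcases le_or_gt 0 N with h0 | h0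
    · have : N.toNat = N.natAbs := by omega
      simp [intCode, natCode, this, length_bits]
    · simp [Int.toNat_of_nonpos h0.le]
  have ok5 : ∀ i ≤ B, St.Ok ⟨program, input, output, fun _ => [], p, [], iu ++ [b, false], [], ys,
      r.bits, [], k, j, hf, 0, i⟩ s B := fun i hi =>
    ⟨h.1, by simp [St.load]; omega, h.3, h.4, h.5, h.6, hi⟩
  have t5 := sexec_seekEnd (ok5 i hi) ⟨rfl, rfl, rfl, rfl⟩ hU hN
  refine t5.bind ?_
  obtain ⟨d, t6, -, hd, -⟩ := sexec_subtract (ok5 _ hsize) ⟨rfl, rfl, rfl, rfl⟩ hU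
    (digitsOf_intCode N) (length_bits _).symm rfl false false
  have ok6 : St.Ok ⟨program, input, output, fun _ => [], p, [], iu ++ [b, false], [], ys,
      [], d.reverse ++ [], k, j, hf, 0, 0⟩ s B :=
    ⟨h.1, by simp [St.load, hd rfl]; omega, h.3, h.4, h.5, h.6, Nat.zero_le _⟩
  have t7 := sexec_normalize ok6 rfl
  have e7 : bitsVal (d.reverse ++ []).reverse = r := by simp [hd rfl, bitsVal_bits]
  simp only [e7] at t7
  refine t6.bind (t7.bind ?_)
  simp only [bitsVal_bits, Bool.toNat_false, add_zero]
  by_cases hlt : r < N.toNat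
  · rw [if_pos (decide_eq_true hlt)]
    have e1 : decide (N.toNat ≤ r) = false := by simpa using hlt
    rw [e1, if_neg (by omega)]
    exact sexec_pure _
  -- subtract
  rw [if_neg (by simpa using hlt)]
  have e1 : decide (N.toNat ≤ r) = true := by simpa using hlt
  rw [e1, if_pos (by omega)]
  have t5 := sexec_seekEnd (ok5 0 (Nat.zero_le _)) ⟨rfl, rfl, rfl, rfl⟩ hU hN
  refine t5.bind ?_
  obtain ⟨d, t6, hdl, -, hd⟩ := sexec_subtract (ok5 _ hsize) ⟨rfl, rfl, rfl, rfl⟩ hU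
    (digitsOf_intCode N) (length_bits _).symm rfl true false
  have ok6 : St.Ok ⟨program, input, output, fun _ => [], p, [], iu ++ [b, false], [], ys,
      [], d.reverse ++ [], k, j, hf, 0, 0⟩ s B :=
    ⟨h.1, by simp [St.load, hdl]; omega, h.3, h.4, h.5, h.6, Nat.zero_le _⟩
  have t7 := sexec_normalize ok6 rfl
  have e7 : bitsVal (d.reverse ++ []).reverse = r - N.toNat := by
    have := hd rfl (by simp [bitsVal_bits]; omega)
    simp [bitsVal_bits] at this ⊢
    omega
  simp only [e7] at t7
  refine t6.bind (t7.bind ?_)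
  have hle : (r - N.toNat).bits.length ≤ r.bits.length := by
    rw [length_bits, length_bits]; exact Nat.size_le_size (Nat.sub_le _ _)
  -- replace the last bit of the input by `true`
  have ok8 : St.Ok ⟨program, input, output, fun _ => [], p, [], iu ++ [b, false], [], ys,
      (r - N.toNat).bits, [], k, j, hf, 0, 0⟩ s B :=
    ⟨h.1, by simp [St.load]; omega, h.3, h.4, h.5, h.6, Nat.zero_le _⟩
  have t8 : SExec s B (transfer .inpUnread .inpRead) _ () ⟨program, input, output, fun _ => [], p,
      [], [], (iu ++ [b, false]).reverse ++ [], ys, (r - N.toNat).bits, [], k, j, hf, 0, 0⟩ :=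
    sexec_transfer (a := .inpUnread) (b := .inpRead) nofun ok8
  have e8 : (iu ++ [b, false]).reverse ++ [] = false :: b :: iu.reverse := by simp
  rw [e8] at t8
  have ok9 : St.Ok ⟨program, input, output, fun _ => [], p, [], [], false :: b :: iu.reverse, ys,
      (r - N.toNat).bits, [], k, j, hf, 0, 0⟩ s B :=
    ⟨h.1, by simp [St.load]; omega, h.3, h.4, h.5, h.6, Nat.zero_le _⟩
  have t9 := sexec_take .inpRead ok9
  have ok10 : St.Ok ⟨program, input, output, fun _ => [], p, [], [], b :: iu.reverse, ys,
      (r - N.toNat).bits, [], k, j, hf, 0, 0⟩ s B :=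
    ⟨h.1, by simp [St.load]; omega, h.3, h.4, h.5, h.6, Nat.zero_le _⟩
  have t10 := sexec_put .inpRead true ok10 (by simp [St.load]; omega)
  have ok11 : St.Ok ⟨program, input, output, fun _ => [], p, [], [], true :: b :: iu.reverse, ys,
      (r - N.toNat).bits, [], k, j, hf, 0, 0⟩ s B :=
    ⟨h.1, by simp [St.load]; omega, h.3, h.4, h.5, h.6, Nat.zero_le _⟩
  have t11 : SExec s B (transfer .inpRead .inpUnread) _ () ⟨program, input, output, fun _ => [], p,
      [], (true :: b :: iu.reverse).reverse ++ [], [], ys, (r - N.toNat).bits, [],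
      k, j, hf, 0, 0⟩ :=
    sexec_transfer (a := .inpRead) (b := .inpUnread) nofun ok11
  have e11 : (true :: b :: iu.reverse).reverse ++ [] = iu ++ [b, true] := by simp
  rw [e11] at t11
  exact t8.bind (t9.bind (t10.bind (t11.bind (sexec_pure _))))

/-- The string `y₀ e₀ y₁ e₁ ⋯` of length `2 i`. -/
def interleave (y e : ℕ → Bool) (i : ℕ) : List Bool := (List.range i).flatMap fun k => [y k, e k]

theorem interleave_succ (y e : ℕ → Bool) (i : ℕ) :
    interleave y e (i + 1) = interleave y e i ++ [y i, e i] := by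
  simp [interleave, List.range_succ]

@[simp] theorem length_interleave (y e : ℕ → Bool) (i : ℕ) :
    (interleave y e i).length = 2 * i := by
  induction i with
  | zero => rfl
  | succ i ih => simp [interleave_succ, ih]; ring

/-- The terms of `hB` are the contents of the memory at stage `i`: the program, the coded precision,
`i` decoded pairs, `j - i` unused bits and the remainder. The initial value `false` of the loop is
never returned, since `0 < j`. -/
theorem sexec_decode (h : S.Ok s B) (hr : S.Ready) (haux : S.aux = []) (hidx : S.index = 0)
    {K : List Bool} {y e : ℕ → Bool} {N : ℕ → ℤ} {r : ℕ → ℕ} {j : ℕ}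
    (hj : 0 < j)
    (hU : ∀ i < j, U.Computes s S.progUnread (K ++ interleave y e i ++ [y i, false])
      (intCode (N i)))
    (hN : ∀ i < j, (intCode (N i)).length ≤ B)
    (he : ∀ i < j, e i = decide ((N i).toNat ≤ r i))
    (hsub : ∀ i < j, r (i + 1) = if (N i).toNat ≤ r i then r i - (N i).toNat else r i)
    (hB : ∀ i ≤ j, S.progUnread.length + K.length + 2 * i + (j - i) + (r i).size + 1 ≤ B) :
    SExec s B (loop (decodeStep U) false)
      { S with inpUnread := K, side := (List.range j).map y, num := (r 0).bits } (e (j - 1))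
      { S with inpUnread := K ++ interleave y e j, side := [], num := (r j).bits } := by
  have key : ∀ i ≤ j, ∀ last, (0 < i → last = e (i - 1)) →
      SExec s B (loop (decodeStep U) last)
        { S with
          inpUnread := K ++ interleave y e i
          side := (List.range' i (j - i)).map y
          num := (r i).bits } (e (j - 1))
        { S with inpUnread := K ++ interleave y e j, side := [], num := (r j).bits } := by
    have ok : ∀ i ≤ j, St.Ok { S with
          inpUnread := K ++ interleave y e i
          side := (List.range' i (j - i)).map y
          num := (r i).bits } s B := by
      intro i hi
      refine ⟨h.1, ?_, h.3, h.4, h.5, h.6, h.7⟩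
      have := hB i hi
      simp [St.load, hr.1, hr.2, haux, length_bits]
      omega
    intro i hi
    induction hi using Nat.decreasingInduction with
    | self =>
      intro last hlast
      have t := sexec_take .side (ok j le_rfl)
      have e1 : (List.range' j (j - j)).map y = [] := by simp
      rw [hlast hj]
      rw [e1] at t ⊢
      exact SExec.done (t.bind (sexec_pure _))
    | of_succ i hi ih =>
      intro last _
      have e1 : (List.range' i (j - i)).map y = y i :: (List.range' (i + 1) (j - (i + 1))).map y := by
        have : j - i = (j - (i + 1)) + 1 := by omega
        rw [this, List.range'_succ]
        rfl
      have t := sexec_decodeStep (ok i hi.le) ⟨hr.1, hr.2, hr.3, hr.4⟩ haux e1 rfl rfl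
        (by simpa using hU i hi) (hN i hi)
        (by
          have := hB i hi.le
          simp [St.load, hr.1, hr.2, haux, length_bits]
          omega) last
      rw [← he i hi, ← hsub i hi] at t
      have e2 : K ++ interleave y e i ++ [y i, e i] = K ++ interleave y e (i + 1) := by
        rw [interleave_succ, List.append_assoc]
      rw [e2] at t
      have e3 : ({ S with
        inpUnread := K ++ interleave y e (i + 1)
        side := (List.range' (i + 1) (j - (i + 1))).map y
        num := (r (i + 1)).bits
        index := 0 } : St) = { S with
        inpUnread := K ++ interleave y e (i + 1)
        side := (List.range' (i + 1) (j - (i + 1))).map y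
        num := (r (i + 1)).bits } := by
        rw [← hidx]
      have ih' := ih (e i) (fun _ => rfl)
      rw [← e3] at ih'
      exact SExec.next t ih'
  have := key 0 (Nat.zero_le _) false (fun h => absurd h (lt_irrefl 0))
  simpa [interleave, List.range_eq_range'] using this

end Decoding

/-! ### Reading the tapes and setting up the precision -/

section Reading

variable {s B : ℕ} {S : St}

/-- Read a string in prefix code from the program tape to the pile `progRead`. -/
noncomputable def readCoded : Frag Unit :=
  loop (fun _ : Unit => readProgram.bind fun o =>
    match o with
    | some false => readProgram.bind fun b =>
      (put .progRead (b.getD false)).bind fun _ => pure (.inl ())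
    | _ => pure (.inr ())) ()

theorem prefixCode_cons (b : Bool) (l : List Bool) :
    prefixCode (b :: l) = false :: b :: prefixCode l := rfl

theorem sexec_readCoded (h : S.Ok s B) {p w : List Bool} (hp : S.program = prefixCode p ++ w)
    (hB : S.load + p.length ≤ B) :
    SExec s B readCoded S () { S with program := w, progRead := p.reverse ++ S.progRead } := by
  induction p generalizing S with
  | nil =>
    have t := sexec_readProgram (s := s) (B := B) (S := S)
    have e : prefixCode [] ++ w = true :: w := rfl
    rw [hp, e] at t
    exact SExec.done (t.bind (sexec_pure _))
  | cons b p ih =>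
    have t := sexec_readProgram (s := s) (B := B) (S := S)
    rw [hp, prefixCode_cons] at t
    have t1 := sexec_readProgram (s := s) (B := B)
      (S := { S with program := b :: (prefixCode p ++ w) })
    have ok1 : St.Ok { S with program := prefixCode p ++ w } s B :=
      ⟨h.1, h.2, h.3, h.4, h.5, h.6, h.7⟩
    simp only [List.length_cons] at hB
    have t2 := sexec_put .progRead b ok1 (by simp only [St.load] at hB ⊢; omega)
    have := ih (S := { S with program := prefixCode p ++ w, progRead := b :: S.progRead })
      ⟨h.1, by simp only [St.load, List.length_cons] at hB ⊢; omega, h.3, h.4, h.5, h.6, h.7⟩ rfl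
      (by simp only [St.load, List.length_cons] at hB ⊢; omega)
    rw [List.reverse_cons, List.append_assoc]
    exact SExec.next (t.bind (t1.bind (t2.bind (sexec_pure _)))) this

/-- Read the rest of the program tape to the pile `num`, and add its length to the counter
`prec`. -/
noncomputable def readRest : Frag Unit :=
  loop (fun _ : Unit => readProgram.bind fun o =>
    match o with
    | some b => (put .num b).bind fun _ => (incr .prec).bind fun _ => pure (.inl ())
    | none => pure (.inr ())) ()

/-- The last symbol read lies on top, so the codeword stands on the tape with its most significant
digit first. -/
theorem sexec_readRest (h : S.Ok s B) {w : List Bool} (hw : S.program = w)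
    (hB : S.load + w.length ≤ B) (hB' : S.prec + w.length ≤ B) :
    SExec s B readRest S ()
      { S with program := [], num := w.reverse ++ S.num, prec := S.prec + w.length } := by
  induction w generalizing S with
  | nil =>
    have t := sexec_readProgram (s := s) (B := B) (S := S)
    rw [hw] at t
    exact SExec.done (t.bind (sexec_pure _))
  | cons b w ih =>
    have t := sexec_readProgram (s := s) (B := B) (S := S)
    rw [hw] at t
    simp only [List.length_cons] at hB hB'
    have ok1 : St.Ok { S with program := w } s B := ⟨h.1, h.2, h.3, h.4, h.5, h.6, h.7⟩
    have t1 := sexec_put .num b ok1 (by simp only [St.load] at hB ⊢; omega)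
    have ok2 : St.Ok { S with program := w, num := b :: S.num } s B :=
      ⟨h.1, by simp only [St.load, List.length_cons] at hB ⊢; omega, h.3, h.4, h.5, h.6, h.7⟩
    have t2 := sexec_incr (x := .prec) nofun ok2 (by simp only [St.ctr]; omega)
    have := ih (S := { S with program := w, num := b :: S.num, prec := S.prec + 1 })
      ⟨h.1, ok2.2, by simp only; omega, h.4, h.5, h.6, h.7⟩ rfl
      (by simp only [St.load, List.length_cons] at hB ⊢; omega) (by simp only; omega)
    have e : S.prec + (b :: w).length = S.prec + 1 + w.length := by
      simp only [List.length_cons]; omega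
    rw [List.reverse_cons, List.append_assoc, e]
    exact SExec.next (t.bind (t1.bind (t2.bind (sexec_pure _)))) this

/-- Read the auxiliary input to the pile `side`, and its length to the counter `len`. -/
noncomputable def readSide : Frag Unit :=
  (loop (fun _ : Unit => readInput.bind fun o =>
    match o with
    | some b => (put .inpRead b).bind fun _ => (incr .len).bind fun _ => pure (.inl ())
    | none => pure (.inr ())) ()).bind fun _ => transfer .inpRead .side

theorem sexec_readSide (h : S.Ok s B) {y : List Bool} (hy : S.input = y)
    (hr : S.inpRead = []) (hs : S.side = []) (hB : S.load + y.length ≤ B)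
    (hB' : S.len + y.length ≤ B) :
    SExec s B readSide S () { S with input := [], side := y, len := S.len + y.length } := by
  have key : SExec s B (loop (fun _ : Unit => readInput.bind fun o =>
      match o with
      | some b => (put .inpRead b).bind fun _ => (incr .len).bind fun _ => pure (.inl ())
      | none => pure (.inr ())) ()) S () { S with
        input := [], inpRead := y.reverse ++ S.inpRead, len := S.len + y.length } := by
    clear hr hs
    induction y generalizing S with
    | nil =>
      have t := sexec_readInput (s := s) (B := B) (S := S)
      rw [hy] at t
      exact SExec.done (t.bind (sexec_pure _))
    | cons b y ih =>
      have t := sexec_readInput (s := s) (B := B) (S := S)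
      rw [hy] at t
      simp only [List.length_cons] at hB hB'
      have ok1 : St.Ok { S with input := y } s B := ⟨h.1, h.2, h.3, h.4, h.5, h.6, h.7⟩
      have t1 := sexec_put .inpRead b ok1 (by simp only [St.load] at hB ⊢; omega)
      have ok2 : St.Ok { S with input := y, inpRead := b :: S.inpRead } s B :=
        ⟨h.1, by simp only [St.load, List.length_cons] at hB ⊢; omega, h.3, h.4, h.5, h.6, h.7⟩
      have t2 := sexec_incr (x := .len) nofun ok2 (by simp only [St.ctr]; omega)
      have := ih (S := { S with input := y, inpRead := b :: S.inpRead, len := S.len + 1 })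
        ⟨h.1, ok2.2, h.3, by simp only; omega, h.5, h.6, h.7⟩ rfl
        (by simp only [St.load, List.length_cons] at hB ⊢; omega) (by simp only; omega)
      have e : S.len + (b :: y).length = S.len + 1 + y.length := by
        simp only [List.length_cons]; omega
      rw [List.reverse_cons, List.append_assoc, e]
      exact SExec.next (t.bind (t1.bind (t2.bind (sexec_pure _)))) this
  have ok : St.Ok { S with
      input := [], inpRead := y.reverse ++ S.inpRead, len := S.len + y.length } s B :=
    ⟨h.1, by simp [St.load] at hB ⊢; omega, h.3, by simp only; omega, h.5, h.6, h.7⟩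
  have t : SExec s B (transfer .inpRead .side) { S with
      input := [], inpRead := y.reverse ++ S.inpRead, len := S.len + y.length } ()
      { S with
        input := []
        inpRead := []
        side := (y.reverse ++ S.inpRead).reverse ++ S.side
        len := S.len + y.length } := sexec_transfer nofun ok
  have e : (y.reverse ++ S.inpRead).reverse ++ S.side = y := by simp [hr, hs]
  rw [e] at t
  have e2 : ({ S with input := [], inpRead := [], side := y, len := S.len + y.length } : St) =
      { S with input := [], side := y, len := S.len + y.length } := by rw [← hr]
  rw [e2] at t
  exact key.bind t

/-- Halve the counter `len` and return the remainder. -/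
noncomputable def halve : Frag Bool :=
  (loop (fun _ : Unit => (test .len).bind fun z =>
    if z then (decr .len).bind fun _ => (test .len).bind fun z =>
      if z then (decr .len).bind fun _ => (incr .half).bind fun _ => pure (.inl ())
      else pure (.inr true)
    else pure (.inr false)) ()).bind fun b =>
  (assign .len .half).bind fun _ => (assign .half .zero).bind fun _ => pure b

theorem St.Ok.setLen (h : S.Ok s B) {n : ℕ} (hn : n ≤ B) : St.Ok { S with len := n } s B :=
  ⟨h.1, h.2, h.3, hn, h.5, h.6, h.7⟩

theorem St.Ok.setHalf (h : S.Ok s B) {n : ℕ} (hn : n ≤ B) : St.Ok { S with half := n } s B :=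
  ⟨h.1, h.2, h.3, h.4, hn, h.6, h.7⟩

theorem St.Ok.setTime (h : S.Ok s B) {n : ℕ} (hn : n ≤ B) : St.Ok { S with time := n } s B :=
  ⟨h.1, h.2, h.3, h.4, h.5, hn, h.7⟩

theorem sexec_halve (h : S.Ok s B) (hh : S.half = 0) :
    SExec s B halve S (decide (S.len % 2 = 1)) { S with len := S.len / 2 } := by
  have key : ∀ a c, a ≤ B → c + a / 2 ≤ B →
      SExec s B (loop (fun _ : Unit => (test .len).bind fun z =>
        if z then (decr .len).bind fun _ => (test .len).bind fun z =>
          if z then (decr .len).bind fun _ => (incr .half).bind fun _ => pure (.inl ())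
          else pure (.inr true)
        else pure (.inr false)) ())
        { S with len := a, half := c } (decide (a % 2 = 1))
        { S with len := 0, half := c + a / 2 } := by
    intro a
    induction a using Nat.strong_induction_on with
    | _ a ih =>
      intro c ha hc
      have ok : ∀ a ≤ B, ∀ c ≤ B, St.Ok { S with len := a, half := c } s B := fun a ha c hc =>
        (h.setLen ha).setHalf hc
      have ok1 := ok a ha c (by omega)
      have t1 := sexec_test .len ok1
      have e1 : St.ctr { S with len := a, half := c } .len = a := rfl
      rw [e1] at t1
      match a, ih with
      | 0, _ => exact SExec.done (t1.bind (sexec_pure _))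
      | 1, _ =>
        have t2 := sexec_decr (x := .len) ok1 (by rw [e1]; omega)
        have t3 := sexec_test .len (ok 0 (by omega) c (by omega))
        exact SExec.done (t1.bind (t2.bind (t3.bind (sexec_pure _))))
      | a + 2, ih =>
        have t2 := sexec_decr (x := .len) ok1 (by rw [e1]; omega)
        have t3 := sexec_test .len (ok (a + 1) (by omega) c (by omega))
        have t4 := sexec_decr (x := .len) (ok (a + 1) (by omega) c (by omega))
          (by simp only [St.ctr]; omega)
        have t5 := sexec_incr (x := .half) nofun (ok a (by omega) c (by omega))
          (by simp only [St.ctr]; omega)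
        have := ih a (by omega) (c + 1) (by omega) (by omega)
        have e2 : decide ((a + 2) % 2 = 1) = decide (a % 2 = 1) := by simp
        have e3 : c + (a + 2) / 2 = c + 1 + a / 2 := by omega
        rw [e2, e3]
        rw [decide_eq_true (by omega : 0 < a + 2)] at t1
        have e4 : St.ctr { S with len := a + 1, half := c } .len = a + 1 := rfl
        rw [e4, decide_eq_true (by omega : 0 < a + 1)] at t3
        exact SExec.next (t1.bind (t2.bind (t3.bind (t4.bind (t5.bind (sexec_pure _)))))) this
  have hl := h.len_le
  have k := key S.len 0 hl (by omega)
  have e0 : ({ S with len := S.len, half := 0 } : St) = S := by rw [← hh]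
  rw [e0, zero_add] at k
  have ok1 : St.Ok { S with len := 0, half := S.len / 2 } s B :=
    (h.setLen (Nat.zero_le _)).setHalf (n := S.len / 2) (by omega)
  have t1 := sexec_assign (x := .len) nofun .half ok1
  have ok2 : St.Ok { S with len := S.len / 2, half := S.len / 2 } s B :=
    (h.setLen (n := S.len / 2) (by omega)).setHalf (n := S.len / 2) (by omega)
  have t2 := sexec_assign (x := .half) nofun .zero ok2
  have e1 : St.setCtr { S with len := S.len / 2, half := S.len / 2 } .half
      (St.ctr { S with len := S.len / 2, half := S.len / 2 } .zero) =
      { S with len := S.len / 2 } := by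
    have : ({ S with len := S.len / 2 } : St) = { S with len := S.len / 2, half := 0 } := by
      rw [← hh]
    rw [this]
    rfl
  rw [e1] at t2
  exact k.bind (t1.bind (t2.bind (sexec_pure _)))

theorem size_half {n : ℕ} (hn : 0 < n) : n.size = (n / 2).size + 1 := by
  rw [← length_bits, ← length_bits]
  conv_lhs => rw [← Nat.bit_bodd_div2 n]
  rw [Nat.bits_append_bit, Nat.div2_val]
  · rfl
  · intro h
    rw [Nat.div2_val] at h
    have : n = 1 := by omega
    subst this
    rfl

theorem bits_half {n : ℕ} (hn : 0 < n) : n.bits = decide (n % 2 = 1) :: (n / 2).bits := by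
  conv_lhs => rw [← Nat.bit_bodd_div2 n]
  rw [Nat.bits_append_bit, Nat.div2_val]
  · congr 1
    rw [Nat.mod_two_of_bodd]
    cases n.bodd <;> rfl
  · intro h
    rw [Nat.div2_val] at h
    have : n = 1 := by omega
    subst this
    rfl

/-- Increase the counter `prec` by one plus the number of binary digits of `len`, and shift the
number in the pile `num` accordingly. -/
noncomputable def setPrec : Frag Unit :=
  (incr .prec).bind fun _ => (put .num false).bind fun _ =>
  loop (fun _ : Unit => (test .len).bind fun z =>
    if z then halve.bind fun _ => (incr .prec).bind fun _ => (put .num false).bind fun _ =>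
      pure (.inl ())
    else pure (.inr ())) ()

/-- The new low zeros multiply the codeword by `2 ^ (S.len.size + 1)`. When `len` is the number of
bits to decode, this raises the precision enough for the accumulated errors of all steps to stay
below the margin. -/
theorem sexec_setPrec (h : S.Ok s B) (hh : S.half = 0) (hB : S.load + S.len.size + 1 ≤ B)
    (hB' : S.prec + S.len.size + 1 ≤ B) :
    SExec s B setPrec S () { S with
      prec := S.prec + (S.len.size + 1)
      num := List.replicate (S.len.size + 1) false ++ S.num
      len := 0 } := by
  have ok : ∀ n ≤ B, ∀ k ≤ B, ∀ c, S.load + c ≤ B → St.Ok { S with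
      len := n, prec := k, num := List.replicate c false ++ S.num } s B := by
    intro n hn k hk c hc
    refine ⟨h.1, ?_, hk, hn, h.5, h.6, h.7⟩
    simp [St.load] at hc ⊢
    omega
  have key : ∀ n k c, n ≤ B → k + n.size ≤ B → S.load + c + n.size ≤ B →
      SExec s B (loop (fun _ : Unit => (test .len).bind fun z =>
        if z then halve.bind fun _ => (incr .prec).bind fun _ => (put .num false).bind fun _ =>
          pure (.inl ())
        else pure (.inr ())) ())
        { S with len := n, prec := k, num := List.replicate c false ++ S.num } ()
        { S with
          len := 0, prec := k + n.size, num := List.replicate (c + n.size) false ++ S.num } := by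
    intro n
    induction n using Nat.strong_induction_on with
    | _ n ih =>
      intro k c hn hk hc
      have t1 := sexec_test .len (ok n hn k (by omega) c (by omega))
      have e1 : St.ctr { S with len := n, prec := k, num := List.replicate c false ++ S.num } .len
        = n := rfl
      rw [e1] at t1
      rcases Nat.eq_zero_or_pos n with rfl | hpos
      · simp only [Nat.size_zero, add_zero]
        exact SExec.done (t1.bind (sexec_pure _))
      · rw [decide_eq_true hpos] at t1
        have hs := size_half hpos
        have t2 := sexec_halve (ok n hn k (by omega) c (by omega)) hh
        have t3 := sexec_incr (x := .prec) nofun (ok (n / 2) (by omega) k (by omega) c (by omega))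
          (by simp only [St.ctr]; omega)
        have t4 := sexec_put .num false (ok (n / 2) (by omega) (k + 1) (by omega) c (by omega))
          (by simp [St.load] at hc ⊢; omega)
        have := ih (n / 2) (by omega) (k + 1) (c + 1) (by omega) (by omega) (by omega)
        have e2 : k + n.size = k + 1 + (n / 2).size := by omega
        have e3 : c + n.size = c + 1 + (n / 2).size := by omega
        rw [e2, e3]
        exact SExec.next (t1.bind (t2.bind (t3.bind (t4.bind (sexec_pure _))))) this
  have hl := h.len_le
  have t1 := sexec_incr (x := .prec) nofun h (by simp only [St.ctr]; omega)
  have t2 := sexec_put .num false (S := { S with prec := S.prec + 1 })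
    ⟨h.1, h.2, by simp only; omega, h.4, h.5, h.6, h.7⟩ (by simp only [St.load] at hB ⊢; omega)
  have := key S.len (S.prec + 1) 1 hl (by omega) (by omega)
  have e2 : S.prec + (S.len.size + 1) = S.prec + 1 + S.len.size := by omega
  have e3 : S.len.size + 1 = 1 + S.len.size := by omega
  rw [e2, e3]
  exact t1.bind (t2.bind this)

/-- Write the code of the counter `prec` to the pile `inpUnread`. -/
noncomputable def emitPrec : Frag Unit :=
  (put .inpUnread true).bind fun _ => (assign .len .prec).bind fun _ =>
  loop (fun _ : Unit => (test .len).bind fun z =>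
    if z then halve.bind fun b => (put .inpUnread b).bind fun _ =>
      (put .inpUnread false).bind fun _ => pure (.inl ())
    else pure (.inr ())) ()

/-- Repeated halving produces the least significant digit first, and pushing reverses the order into
that of `natCode`. -/
theorem sexec_emitPrec (h : S.Ok s B) (hh : S.half = 0) (hi : S.inpUnread = [])
    (hl : S.len = 0) (hB : S.load + 2 * S.prec.size + 1 ≤ B) :
    SExec s B emitPrec S () { S with inpUnread := prefixCode (natCode S.prec) } := by
  have ok : ∀ n ≤ B, ∀ l : List Bool, S.load + l.length ≤ B → St.Ok { S with
      len := n, inpUnread := l } s B := by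
    intro n hn k hk
    refine ⟨h.1, ?_, h.3, hn, h.5, h.6, h.7⟩
    simp [St.load, hi] at hk ⊢
    omega
  have key : ∀ n (l : List Bool), n ≤ B → S.load + l.length + 2 * n.size ≤ B →
      SExec s B (loop (fun _ : Unit => (test .len).bind fun z =>
        if z then halve.bind fun b => (put .inpUnread b).bind fun _ =>
          (put .inpUnread false).bind fun _ => pure (.inl ())
        else pure (.inr ())) ())
        { S with len := n, inpUnread := l } ()
        { S with
          len := 0
          inpUnread := (natCode n).flatMap (fun b => [false, b]) ++ l } := by
    intro n
    induction n using Nat.strong_induction_on with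
    | _ n ih =>
      intro l hn hl
      have t1 := sexec_test .len (ok n hn l (by omega))
      have e1 : St.ctr { S with len := n, inpUnread := l } .len = n := rfl
      rw [e1] at t1
      rcases Nat.eq_zero_or_pos n with rfl | hpos
      · have e2 : (natCode 0).flatMap (fun b => [false, b]) ++ l = l := by simp [natCode]
        rw [e2]
        exact SExec.done (t1.bind (sexec_pure _))
      · rw [decide_eq_true hpos] at t1
        have hs := size_half hpos
        have t2 := sexec_halve (ok n hn l (by omega)) hh
        have t3 := sexec_put .inpUnread (decide (n % 2 = 1)) (ok (n / 2) (by omega) l (by omega))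
          (by simp [St.load, hi] at hl ⊢; omega)
        have t4 := sexec_put .inpUnread false (ok (n / 2) (by omega) (decide (n % 2 = 1) :: l)
          (by simp; omega)) (by simp [St.load, hi] at hl ⊢; omega)
        have := ih (n / 2) (by omega) (false :: decide (n % 2 = 1) :: l) (by omega)
          (by simp; omega)
        have e2 : (natCode n).flatMap (fun b => [false, b]) ++ l =
            (natCode (n / 2)).flatMap (fun b => [false, b]) ++
              (false :: decide (n % 2 = 1) :: l) := by
          rw [natCode, bits_half hpos]
          simp [natCode]
        rw [e2]
        exact SExec.next (t1.bind (t2.bind (t3.bind (t4.bind (sexec_pure _))))) this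
  have hp := h.prec_le
  have t1 := sexec_put .inpUnread true h (by omega)
  have t2 := sexec_assign (x := .len) nofun .prec (ok S.len h.len_le [true] (by simp; omega))
  have := key S.prec [true] hp (by simp; omega)
  have e0 : S.setPile .inpUnread (true :: S.pile .inpUnread) =
      { S with len := S.len, inpUnread := [true] } := by
    have : S.pile .inpUnread = [] := hi
    rw [this]
    rfl
  rw [e0] at t1
  have e3 : ({ S with
      len := 0
      inpUnread := (natCode S.prec).flatMap (fun b => [false, b]) ++ [true] } : St) =
      { S with inpUnread := prefixCode (natCode S.prec) } := by
    rw [← hl]; rfl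
  rw [e3] at this
  exact t1.bind (t2.bind this)

/-- Read a number, in prefix code, from the program tape to the counter `index`. -/
noncomputable def readNumber : Frag Unit :=
  loop (fun _ : Unit => readProgram.bind fun o =>
    match o with
    | some false => readProgram.bind fun b =>
      (loop (fun _ : Unit => (test .index).bind fun z =>
        if z then (decr .index).bind fun _ => (incr .half).bind fun _ => (incr .half).bind fun _ =>
          pure (.inl ())
        else pure (.inr ())) ()).bind fun _ =>
      (assign .index .half).bind fun _ => (assign .half .zero).bind fun _ =>
      if b.getD false then (incr .index).bind fun _ => pure (.inl ()) else pure (.inl ())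
    | _ => pure (.inr ())) ()

theorem sexec_double (h : S.Ok s B) (a c : ℕ) (ha : c + 2 * a ≤ B) :
    SExec s B (loop (fun _ : Unit => (test .index).bind fun z =>
        if z then (decr .index).bind fun _ => (incr .half).bind fun _ => (incr .half).bind fun _ =>
          pure (.inl ())
        else pure (.inr ())) ())
      { S with index := a, half := c } () { S with index := 0, half := c + 2 * a } := by
  have ok : ∀ a ≤ B, ∀ c ≤ B, St.Ok { S with index := a, half := c } s B := fun a ha c hc =>
    (h.setIndex ha).setHalf hc
  induction a generalizing c with
  | zero =>
    have t1 := sexec_test .index (ok 0 (by omega) c (by omega))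
    exact SExec.done (t1.bind (sexec_pure _))
  | succ a ih =>
    have t1 := sexec_test .index (ok (a + 1) (by omega) c (by omega))
    have e1 : St.ctr { S with index := a + 1, half := c } .index = a + 1 := rfl
    rw [e1, decide_eq_true (by omega : 0 < a + 1)] at t1
    have t2 := sexec_decr (x := .index) (ok (a + 1) (by omega) c (by omega)) (by rw [e1]; omega)
    have t3 := sexec_incr (x := .half) nofun (ok a (by omega) c (by omega))
      (by simp only [St.ctr]; omega)
    have t4 := sexec_incr (x := .half) nofun (ok a (by omega) (c + 1) (by omega))
      (by simp only [St.ctr]; omega)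
    have := ih (c + 1 + 1) (by omega)
    have e2 : c + 2 * (a + 1) = c + 1 + 1 + 2 * a := by ring
    rw [e2]
    exact SExec.next (t1.bind (t2.bind (t3.bind (t4.bind (sexec_pure _))))) this

/-- Intermediate values of Horner's scheme do not exceed the final one, so a bound on the number
read bounds the counters throughout. -/
theorem le_foldl_double (l : List Bool) (a : ℕ) :
    a ≤ l.foldl (fun a b => 2 * a + b.toNat) a := by
  induction l generalizing a with
  | nil => exact le_rfl
  | cons b l ih =>
    have : a ≤ 2 * a + b.toNat := by omega
    exact this.trans (ih _)

theorem foldl_natCode (n : ℕ) : (natCode n).foldl (fun a b => 2 * a + b.toNat) 0 = n := by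
  rw [natCode, List.foldl_reverse]
  conv_rhs => rw [← bitsVal_bits n]
  unfold bitsVal
  congr 1
  funext b a
  rw [Nat.bit_val]

theorem sexec_readNumber (h : S.Ok s B) (hh : S.half = 0) (hi : S.index = 0) {n : ℕ} (hn : n ≤ B)
    {w : List Bool} (hp : S.program = prefixCode (natCode n) ++ w) :
    SExec s B readNumber S () { S with program := w, index := n } := by
  have key : ∀ (l : List Bool) a, l.foldl (fun a b => 2 * a + b.toNat) a ≤ B →
      SExec s B readNumber { S with program := prefixCode l ++ w, index := a } ()
        { S with program := w, index := l.foldl (fun a b => 2 * a + b.toNat) a } := by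
    intro l
    have ok : ∀ u, ∀ a ≤ B, St.Ok { S with program := u, index := a } s B := fun u a ha =>
      ⟨h.1, h.2, h.3, h.4, h.5, h.6, ha⟩
    induction l with
    | nil =>
      intro a ha
      have t := sexec_readProgram (s := s) (B := B)
        (S := { S with program := true :: w, index := a })
      exact SExec.done (t.bind (sexec_pure _))
    | cons b l ih =>
      intro a ha
      rw [List.foldl_cons] at ha ⊢
      have hle := (le_foldl_double l (2 * a + b.toNat)).trans ha
      have t := sexec_readProgram (s := s) (B := B)
        (S := { S with program := false :: b :: (prefixCode l ++ w), index := a })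
      have t1 := sexec_readProgram (s := s) (B := B)
        (S := { S with program := b :: (prefixCode l ++ w), index := a })
      have t2 := sexec_double (ok (prefixCode l ++ w) a (by omega)) a 0 (by omega)
      have e0 : ({ S with program := prefixCode l ++ w, index := a, half := 0 } : St) =
          { S with program := prefixCode l ++ w, index := a } := by rw [← hh]
      simp only [zero_add] at t2
      rw [e0] at t2
      have ok3 : St.Ok { S with
          program := prefixCode l ++ w, index := 0, half := 2 * a } s B :=
        (ok _ 0 (by omega)).setHalf (by omega)
      have t3 := sexec_assign (x := .index) nofun .half ok3
      have ok4 : St.Ok { S with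
          program := prefixCode l ++ w, index := 2 * a, half := 2 * a } s B :=
        (ok _ (2 * a) (by omega)).setHalf (by omega)
      have t4 := sexec_assign (x := .half) nofun .zero ok4
      have e1 : St.setCtr { S with program := prefixCode l ++ w, index := 2 * a, half := 2 * a }
          .half (St.ctr { S with program := prefixCode l ++ w, index := 2 * a, half := 2 * a } .zero)
          = { S with program := prefixCode l ++ w, index := 2 * a } := by
        have : ({ S with program := prefixCode l ++ w, index := 2 * a } : St) =
            { S with program := prefixCode l ++ w, index := 2 * a, half := 0 } := by rw [← hh]
        rw [this]
        rfl
      rw [e1] at t4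
      refine SExec.next (t.bind (t1.bind (t2.bind (t3.bind (t4.bind ?_))))) (ih _ ha)
      cases b
      · exact sexec_pure _
      · have t5 := sexec_incr (x := .index) nofun (ok (prefixCode l ++ w) (2 * a) (by omega))
          (by simp only [St.ctr, Bool.toNat_true] at hle ⊢; omega)
        exact t5.bind (sexec_pure _)
  have := key (natCode n) 0 (by rwa [foldl_natCode])
  rw [foldl_natCode] at this
  have e : ({ S with program := prefixCode (natCode n) ++ w, index := 0 } : St) = S := by
    rw [← hp, ← hi]
  rwa [e] at this

/-- Decrease the counters `time` and `index` by the minimum of both. -/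
noncomputable def cancel : Frag Unit :=
  loop (fun _ : Unit => (test .index).bind fun z =>
    if z then (test .time).bind fun z =>
      if z then (decr .index).bind fun _ => (decr .time).bind fun _ => pure (.inl ())
      else pure (.inr ())
    else pure (.inr ())) ()

theorem sexec_cancel (h : S.Ok s B) (a b : ℕ) (ha : a ≤ B) (hb : b ≤ B) :
    SExec s B cancel { S with time := a, index := b } ()
      { S with time := a - b, index := b - a } := by
  have ok : ∀ a ≤ B, ∀ b ≤ B, St.Ok { S with time := a, index := b } s B := fun a ha c hc =>
    (h.setTime ha).setIndex hc
  induction b generalizing a with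
  | zero =>
    have t1 := sexec_test .index (ok a ha 0 hb)
    rw [Nat.sub_zero, Nat.zero_sub]
    exact SExec.done (t1.bind (sexec_pure _))
  | succ b ih =>
    have t1 := sexec_test .index (ok a ha (b + 1) hb)
    have e1 : St.ctr { S with time := a, index := b + 1 } .index = b + 1 := rfl
    rw [e1, decide_eq_true (by omega : 0 < b + 1)] at t1
    have t2 := sexec_test .time (ok a ha (b + 1) hb)
    have e2 : St.ctr { S with time := a, index := b + 1 } .time = a := rfl
    rw [e2] at t2
    rcases a with _ | a
    · rw [Nat.sub_zero, Nat.zero_sub]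
      exact SExec.done (t1.bind (t2.bind (sexec_pure _)))
    · rw [decide_eq_true (by omega : 0 < a + 1)] at t2
      have t3 := sexec_decr (x := .index) (ok (a + 1) ha (b + 1) hb) (by rw [e1]; omega)
      have t4 := sexec_decr (x := .time) (ok (a + 1) ha b (by omega))
        (by simp only [St.ctr]; omega)
      have := ih a (by omega) (by omega)
      rw [Nat.add_sub_add_right, Nat.add_sub_add_right]
      exact SExec.next (t1.bind (t2.bind (t3.bind (t4.bind (sexec_pure _))))) this

/-- Return the symbol of the program tape whose position, counted from `1`, is in the counter
`time`. -/
noncomputable def lookup : Frag (Option Bool) :=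
  loop (fun _ : Unit => (decr .time).bind fun _ => readProgram.bind fun o => (test .time).bind
    fun z => if z then pure (.inl ()) else pure (.inr o)) ()

theorem sexec_lookup (h : S.Ok s B) (a : ℕ) (ha : a + 1 ≤ B) (l : List Bool) :
    SExec s B lookup { S with time := a + 1, program := l } l[a]?
      { S with time := 0, program := l.drop (a + 1) } := by
  have ok : ∀ a ≤ B, ∀ u, St.Ok { S with time := a, program := u } s B := fun a ha c =>
    ⟨h.1, h.2, h.3, h.4, h.5, ha, h.7⟩
  induction a generalizing l with
  | zero =>
    have t1 := sexec_decr (x := .time) (ok 1 ha l) (by simp only [St.ctr]; omega)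
    have t2 := sexec_readProgram (s := s) (B := B) (S := { S with time := 0, program := l })
    have t3 := sexec_test .time (ok 0 (Nat.zero_le _) l.tail)
    have e : l[0]? = l.head? := by cases l <;> rfl
    rw [e, zero_add, List.drop_one]
    exact SExec.done (t1.bind (t2.bind (t3.bind (sexec_pure _))))
  | succ a ih =>
    have t1 := sexec_decr (x := .time) (ok (a + 1 + 1) ha l) (by simp only [St.ctr]; omega)
    have t2 := sexec_readProgram (s := s) (B := B) (S := { S with time := a + 1, program := l })
    have t3 := sexec_test .time (ok (a + 1) (by omega) l.tail)
    have e1 : St.ctr { S with time := a + 1, program := l.tail } .time = a + 1 := rfl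
    rw [e1, decide_eq_true (by omega : 0 < a + 1)] at t3
    have := ih (by omega) l.tail
    have e : l[a + 1]? = l.tail[a]? := by cases l <;> simp
    have e2 : l.drop (a + 1 + 1) = l.tail.drop (a + 1) := by cases l <;> simp
    rw [e, e2]
    exact SExec.next (t1.bind (t2.bind (t3.bind (sexec_pure _)))) this

/-- Skip as many symbols of the program tape as the counter `index` says. -/
noncomputable def skip : Frag Unit :=
  loop (fun _ : Unit => (test .index).bind fun z =>
    if z then (decr .index).bind fun _ => readProgram.bind fun _ => pure (.inl ())
    else pure (.inr ())) ()

theorem sexec_skip (h : S.Ok s B) {l w : List Bool} (hl : l.length ≤ B) :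
    SExec s B skip { S with index := l.length, program := l ++ w } ()
      { S with index := 0, program := w } := by
  have ok : ∀ a ≤ B, ∀ u, St.Ok { S with index := a, program := u } s B := fun a ha c =>
    ⟨h.1, h.2, h.3, h.4, h.5, h.6, ha⟩
  induction l with
  | nil =>
    have t1 := sexec_test .index (ok 0 (Nat.zero_le _) w)
    exact SExec.done (t1.bind (sexec_pure _))
  | cons b l ih =>
    simp only [List.length_cons] at hl
    have t1 := sexec_test .index (ok (l.length + 1) hl (b :: l ++ w))
    have e1 : St.ctr { S with index := l.length + 1, program := b :: l ++ w } .index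
      = l.length + 1 := rfl
    rw [e1, decide_eq_true (by omega : 0 < l.length + 1)] at t1
    have t2 := sexec_decr (x := .index) (ok (l.length + 1) hl (b :: l ++ w)) (by rw [e1]; omega)
    have t3 := sexec_readProgram (s := s) (B := B)
      (S := { S with index := l.length, program := b :: l ++ w })
    exact SExec.next (t1.bind (t2.bind (t3.bind (sexec_pure _)))) (ih (by omega))

end Reading

/-! ### The decoding machine -/

section Program

variable (U : StackMachine)

/-- Read a program of `U`, in prefix code, and a binary number from the program tape, and decode as
many bits as there are bits in the pile `side`; write the last of them. -/
noncomputable def decodeLast : Frag Unit :=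
  readCoded.bind fun _ => (transfer .progRead .progUnread).bind fun _ => readRest.bind fun _ =>
  setPrec.bind fun _ => emitPrec.bind fun _ => (transfer .num .aux).bind fun _ =>
  normalize.bind fun _ => (loop (decodeStep U) false).bind fun b => write b

/-- The program of the decoding machine. If the first symbol of the program tape is `true`, then
there follow, in prefix code, a number `q`, the length of a string `l`, and the string `l`; when
the auxiliary input has length `q + i + 1`, the output is the symbol `i` of `l`. In all other cases
the output is found by `decodeLast`. -/
noncomputable def decoder : Frag Unit :=
  readSide.bind fun _ => readProgram.bind fun o =>
  if o.getD false then
    readNumber.bind fun _ => (assign .time .len).bind fun _ => cancel.bind fun _ =>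
    (assign .index .zero).bind fun _ => readNumber.bind fun _ => (test .time).bind fun z =>
    if z then lookup.bind fun o => write (o.getD false)
    else skip.bind fun _ => decodeLast U
  else decodeLast U

variable {U} {s B : ℕ}

/-- The memory of the decoding machine after the auxiliary input has been read. -/
def St.ofSide (program side : List Bool) : St :=
  ⟨program, [], [], fun _ => [], [], [], [], [], side, [], [], 0, side.length, 0, 0, 0⟩

set_option maxHeartbeats 400000 in
-- The precision `k` varies with `j`, because the machine knows only the length `j` of its own
-- input; the same `w` can still serve all `j`. `hB₀` is for the preparation, when the shifted
-- codeword occupies all `k` digits, and `hB` for the loop, where it is normalized.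
theorem sexec_decodeLast {p w : List Bool} {y e : ℕ → Bool} {N : ℕ → ℤ} {r : ℕ → ℕ} {j k : ℕ}
    (hj : 0 < j) (hk : k = w.length + (j.size + 1))
    (hr : r 0 = bitsVal (List.replicate (j.size + 1) false ++ w.reverse))
    (hU : ∀ i < j, U.Computes s p (prefixCode (natCode k) ++ interleave y e i ++ [y i, false])
      (intCode (N i)))
    (hN : ∀ i < j, (intCode (N i)).length ≤ B)
    (he : ∀ i < j, e i = decide ((N i).toNat ≤ r i))
    (hsub : ∀ i < j, r (i + 1) = if (N i).toNat ≤ r i then r i - (N i).toNat else r i)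
    (hB₀ : p.length + j + k + 2 * k.size + 1 ≤ B)
    (hB : ∀ i ≤ j, p.length + (prefixCode (natCode k)).length + 2 * i + (j - i) + (r i).size + 1
      ≤ B) :
    ∃ S, SExec s B (decodeLast U) (St.ofSide (prefixCode p ++ w) ((List.range j).map y)) () S ∧
      S.output = [e (j - 1)] := by
  -- The loop comes first because it alone needs the entries of the side input. Afterwards the side
  -- input is generalized to a list of length `j`.
  have t8 := fun h => sexec_decode (U := U) (s := s) (B := B)
    (S := ⟨[], [], [], fun _ => [], p, [], [], [], [], [], [], k, 0, 0, 0, 0⟩)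
    h ⟨rfl, rfl, rfl, rfl⟩ rfl rfl hj hU hN he hsub hB
  simp only at t8
  have hl : ((List.range j).map y).length = j := by simp
  generalize (List.range j).map y = ys at t8 hl ⊢
  subst hl
  have ok1 : St.Ok (St.ofSide (prefixCode p ++ w) ys) s B :=
    ⟨by simp [St.ofSide], by simp [St.ofSide, St.load]; omega, Nat.zero_le _,
      by simp [St.ofSide]; omega, Nat.zero_le _, Nat.zero_le _, Nat.zero_le _⟩
  have t1 := sexec_readCoded ok1 (p := p) (w := w) rfl (by simp [St.ofSide, St.load]; omega)
  have ok2 : St.Ok ⟨w, [], [], fun _ => [], [], p.reverse ++ [], [], [], ys, [], [], 0, ys.length,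
      0, 0, 0⟩ s B :=
    ⟨by simp, by simp [St.load]; omega, Nat.zero_le _, ok1.4, Nat.zero_le _, Nat.zero_le _,
      Nat.zero_le _⟩
  have t2 := sexec_transfer (a := .progRead) (b := .progUnread) nofun ok2
  have e2 : (p.reverse ++ []).reverse ++ [] = p := by simp
  simp only [St.setPile, St.pile, e2] at t2
  have ok3 : St.Ok ⟨w, [], [], fun _ => [], p, [], [], [], ys, [], [], 0, ys.length,
      0, 0, 0⟩ s B :=
    ⟨by simp, by simp [St.load]; omega, Nat.zero_le _, ok1.4, Nat.zero_le _, Nat.zero_le _,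
      Nat.zero_le _⟩
  have t3 := sexec_readRest ok3 rfl (by simp [St.load]; omega) (by simp only; omega)
  have ok4 : St.Ok ⟨[], [], [], fun _ => [], p, [], [], [], ys, w.reverse ++ [], [],
      0 + w.length, ys.length, 0, 0, 0⟩ s B :=
    ⟨by simp, by simp [St.load]; omega, by simp only; omega, ok1.4, Nat.zero_le _,
      Nat.zero_le _, Nat.zero_le _⟩
  have t4 := sexec_setPrec ok4 rfl (by simp [St.load]; omega) (by simp only; omega)
  simp only [List.append_nil] at t3
  have e4 : 0 + w.length + (ys.length.size + 1) = k := by omega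
  simp only [e4, List.append_nil] at t4
  have hRl : (List.replicate (ys.length.size + 1) false ++ w.reverse).length = k := by simp; omega
  generalize List.replicate (ys.length.size + 1) false ++ w.reverse = R at t4 hr hRl
  have ok5 : St.Ok ⟨[], [], [], fun _ => [], p, [], [], [], ys, R, [], k, 0, 0, 0, 0⟩ s B :=
    ⟨by simp, by simp [St.load, hRl]; omega, by simp only; omega, Nat.zero_le _, Nat.zero_le _,
      Nat.zero_le _, Nat.zero_le _⟩
  have t5 := sexec_emitPrec ok5 rfl rfl rfl (by simp [St.load, hRl]; omega)
  simp only at t5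
  have hK : (prefixCode (natCode k)).length = 2 * k.size + 1 := by
    simp [prefixCode, natCode, length_bits, mul_comm]
  have ok6 : St.Ok ⟨[], [], [], fun _ => [], p, [], prefixCode (natCode k), [], ys, R, [],
      k, 0, 0, 0, 0⟩ s B :=
    ⟨by simp, by simp [St.load, hRl, hK]; omega, by simp only; omega, Nat.zero_le _,
      Nat.zero_le _, Nat.zero_le _, Nat.zero_le _⟩
  have t6 := sexec_transfer (a := .num) (b := .aux) nofun ok6
  simp only [St.setPile, St.pile, List.append_nil] at t6
  have ok7 : St.Ok ⟨[], [], [], fun _ => [], p, [], prefixCode (natCode k), [], ys, [], R.reverse,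
      k, 0, 0, 0, 0⟩ s B :=
    ⟨by simp, by simp [St.load, hRl, hK]; omega, by simp only; omega, Nat.zero_le _,
      Nat.zero_le _, Nat.zero_le _, Nat.zero_le _⟩
  have t7 := sexec_normalize ok7 rfl
  have e7 : bitsVal R.reverse.reverse = r 0 := by rw [List.reverse_reverse, hr]
  simp only [e7] at t7
  have ok8 : St.Ok ⟨[], [], [], fun _ => [], p, [], [], [], [], [], [], k, 0, 0, 0, 0⟩ s B :=
    ⟨by simp, by simp [St.load]; omega, by simp only; omega, Nat.zero_le _,
      Nat.zero_le _, Nat.zero_le _, Nat.zero_le _⟩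
  replace t8 := t8 ok8
  have t9 : SExec s B (normalize.bind fun _ => (loop (decodeStep U) false).bind fun b => write b)
      _ () _ := t7.bind (t8.bind (sexec_write _))
  have t10 : SExec s B ((transfer .num .aux).bind fun _ =>
      normalize.bind fun _ => (loop (decodeStep U) false).bind fun b => write b) _ () _ :=
    t6.bind t9
  have t11 : SExec s B (emitPrec.bind fun _ => (transfer .num .aux).bind fun _ =>
      normalize.bind fun _ => (loop (decodeStep U) false).bind fun b => write b) _ () _ :=
    t5.bind t10
  exact ⟨_, t1.bind (t2.bind (t3.bind (t4.bind t11))), rfl⟩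

/-- The state of `decoder` after the first symbol of the program tape. -/
theorem sexec_decoder_start {ys u : List Bool} (b : Bool) {S' : St} (hl : ys.length ≤ B)
    (h : SExec s B (if b then
      readNumber.bind fun _ => (assign .time .len).bind fun _ => cancel.bind fun _ =>
      (assign .index .zero).bind fun _ => readNumber.bind fun _ => (test .time).bind fun z =>
      if z then lookup.bind fun o => write (o.getD false)
      else skip.bind fun _ => decodeLast U
      else decodeLast U) (St.ofSide u ys) () S') :
    SExec s B (decoder U)
      ⟨b :: u, ys, [], fun _ => [], [], [], [], [], [], [], [], 0, 0, 0, 0, 0⟩ () S' := by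
  have ok : St.Ok ⟨b :: u, ys, [], fun _ => [], [], [], [], [], [], [], [], 0, 0, 0, 0, 0⟩ s B :=
    ⟨by simp, by simp [St.load], Nat.zero_le _, Nat.zero_le _, Nat.zero_le _, Nat.zero_le _,
      Nat.zero_le _⟩
  have t1 := sexec_readSide ok (y := ys) rfl rfl rfl (by simpa [St.load] using hl) (by simpa using hl)
  have e1 : 0 + ys.length = ys.length := Nat.zero_add _
  simp only [e1] at t1
  exact t1.bind (sexec_readProgram.bind h)

theorem sexec_decoder_false {ys u : List Bool} {S' : St} (hl : ys.length ≤ B)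
    (h : SExec s B (decodeLast U) (St.ofSide u ys) () S') :
    SExec s B (decoder U)
      ⟨false :: u, ys, [], fun _ => [], [], [], [], [], [], [], [], 0, 0, 0, 0, 0⟩ () S' :=
  sexec_decoder_start false hl h

theorem ok_ofSide {ys : List Bool} (hl : ys.length ≤ B) (u : List Bool) {len time index : ℕ}
    (h₁ : len ≤ B) (h₂ : time ≤ B) (h₃ : index ≤ B) :
    St.Ok ⟨u, [], [], fun _ => [], [], [], [], [], ys, [], [], 0, len, 0, time, index⟩ s B :=
  ⟨by simp, by simpa [St.load] using hl, Nat.zero_le _, h₁, Nat.zero_le _, h₂, h₃⟩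

/-- Cancellation leaves the truncated difference `ys.length - q` in `time`. It is positive exactly
when the wanted bit lies beyond the first `q`, and it then is the position in the literal list,
counted from `1`. -/
theorem sexec_decoder_prefix {ys u : List Bool} {q a : ℕ} {S' : St} (hl : ys.length ≤ B)
    (hq : q ≤ B) (ha : a ≤ B)
    (h : SExec s B (if decide (0 < ys.length - q) then lookup.bind fun o => write (o.getD false)
      else skip.bind fun _ => decodeLast U)
      ⟨u, [], [], fun _ => [], [], [], [], [], ys, [], [], 0, ys.length, 0, ys.length - q, a⟩
      () S') :
    SExec s B (decoder U)
      ⟨true :: (prefixCode (natCode q) ++ (prefixCode (natCode a) ++ u)), ys, [], fun _ => [],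
        [], [], [], [], [], [], [], 0, 0, 0, 0, 0⟩ () S' := by
  refine sexec_decoder_start true hl ?_
  have t1 := sexec_readNumber (s := s) (ok_ofSide hl
    (prefixCode (natCode q) ++ (prefixCode (natCode a) ++ u)) hl (Nat.zero_le _) (Nat.zero_le _))
    rfl rfl hq rfl
  have t2 := sexec_assign (x := .time) nofun .len (ok_ofSide (s := s) hl
    (prefixCode (natCode a) ++ u) hl (Nat.zero_le _) hq)
  have t3 := sexec_cancel (ok_ofSide (s := s) hl
    (prefixCode (natCode a) ++ u) hl hl hq) ys.length q hl hq
  have t4 := sexec_assign (x := .index) nofun .zero (ok_ofSide (s := s) hl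
    (prefixCode (natCode a) ++ u) hl (show ys.length - q ≤ B by omega)
    (show q - ys.length ≤ B by omega))
  have t5 := sexec_readNumber (ok_ofSide (s := s) hl
    (prefixCode (natCode a) ++ u) hl (show ys.length - q ≤ B by omega) (Nat.zero_le _))
    rfl rfl ha rfl
  have t6 := sexec_test .time (ok_ofSide (s := s) hl u hl (show ys.length - q ≤ B by omega) ha)
  exact t1.bind (t2.bind (t3.bind (t4.bind (t5.bind (t6.bind h)))))

theorem sexec_decoder_lookup {ys l u : List Bool} {q i : ℕ} (hl : ys.length ≤ B)
    (hq : q ≤ B) (ha : l.length ≤ B) (hy : ys.length = q + i + 1) (hi : i < l.length) :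
    ∃ S, SExec s B (decoder U)
      ⟨true :: (prefixCode (natCode q) ++ (prefixCode (natCode l.length) ++ (l ++ u))), ys, [],
        fun _ => [], [], [], [], [], [], [], [], 0, 0, 0, 0, 0⟩ () S ∧ S.output = [l[i]] := by
  have t : SExec s B (lookup.bind fun o => write (o.getD false)) _ () _ :=
    (sexec_lookup (ok_ofSide (s := s) hl (l ++ u) hl (show i + 1 ≤ B by omega) ha) i
      (by omega) (l ++ u)).bind (sexec_write _)
  obtain ⟨S', t, hS⟩ : ∃ S', SExec s B (lookup.bind fun o => write (o.getD false))
      ⟨l ++ u, [], [], fun _ => [], [], [], [], [], ys, [], [], 0, ys.length, 0, i + 1, l.length⟩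
      () S' ∧ S'.output = [l[i]] := ⟨_, t, by simp [List.getElem?_append_left hi, hi]⟩
  refine ⟨S', sexec_decoder_prefix hl hq ha ?_, hS⟩
  rw [decide_eq_true (by omega : 0 < ys.length - q), if_pos rfl]
  have e : ys.length - q = i + 1 := by omega
  rw [e]
  exact t

theorem sexec_decoder_skip {ys l u : List Bool} {q : ℕ} {S' : St} (hl : ys.length ≤ B)
    (hq : q ≤ B) (ha : l.length ≤ B) (hy : ys.length ≤ q)
    (h : SExec s B (decodeLast U) (St.ofSide u ys) () S') :
    SExec s B (decoder U)
      ⟨true :: (prefixCode (natCode q) ++ (prefixCode (natCode l.length) ++ (l ++ u))), ys, [],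
        fun _ => [], [], [], [], [], [], [], [], 0, 0, 0, 0, 0⟩ () S' := by
  refine sexec_decoder_prefix hl hq ha ?_
  have e : ys.length - q = 0 := by omega
  rw [e, if_neg (by simp)]
  have t := sexec_skip (ok_ofSide (s := s) hl (l ++ u) hl (Nat.zero_le _) ha) ha (w := u)
  exact t.bind h

variable (U) in
/-- The decoding machine. -/
noncomputable def decodingMachine : StackMachine :=
  ((initCounters (PileCounter 7 (Fin 6))).bind fun _ => decoder U).machine

/-- A lone end marker is a block without columns and represents counters that are all zero, so the
abstract execution can start from there. -/
theorem computes_decodingMachine {p y : List Bool} {S : St}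
    (h : SExec s B (decoder U)
      ⟨p, y, [], fun _ => [], [], [], [], [], [], [], [], 0, 0, 0, 0, 0⟩ () S) :
    (decodingMachine U).Computes
      (counterSpace (PileCounter 7 (Fin 6)) (Nat.size B) (s + B)) p y S.output := by
  have t0 := exec_pushToken (ι := PileCounter 7 (Fin 6)) (i := 1)
    (s := counterSpace (PileCounter 7 (Fin 6)) (Nat.size B) (s + B))
    (σ := ⟨p, y, fun _ => [], []⟩) (u := []) (v := []) none (by simp [counterSpace]; nlinarith)
  obtain ⟨σ₁, e₁, hs₁, r₁⟩ := t0 _ rfl (by simp)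
  have rep : CounterRep (Nat.size B) (St.mem
      ⟨p, y, [], fun _ => [], [], [], [], [], [], [], [], 0, 0, 0, 0, 0⟩).flat σ₁ := by
    refine ⟨[], Nat.zero_le _, ?_, ?_⟩
    · funext x
      rcases x with x | x | x
      · fin_cases x <;> rfl
      · rfl
      · fin_cases x <;> rfl
    · rw [← e₁]
      simp [St.mem, Mem.flat, Mem.heap, Store.put, blockCode, columnsCode, List.finRange_succ]
  obtain ⟨σ₂, ⟨l, -, -, e₂⟩, hs₂, r₂⟩ := h σ₁ rep hs₁
  have := computes_machine (F := (initCounters (PileCounter 7 (Fin 6))).bind fun _ => decoder U)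
    (p := p) (y := y) (runs_bind (F := initCounters (PileCounter 7 (Fin 6))) (a := ())
      (G := fun _ => decoder U) (by
        have e : (⟨p, y, fun _ => [], []⟩ : Store) = Store.put ⟨p, y, fun _ => [], []⟩ 1 [] [] :=
          (Store.put_stack _).symm
        rw [e]
        exact r₁) r₂)
  rw [e₂] at this
  exact this

end Program

end Frag

/-! ### Elementary properties of complexity -/

theorem StackMachine.Computes.mono {M : StackMachine} {s s' : ℕ} {p y x : List Bool}
    (h : M.Computes s p y x) (hs : s ≤ s') : M.Computes s' p y x := by
  obtain ⟨a, h1, h2, h3⟩ := h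
  exact ⟨a, Relation.ReflTransGen.mono (fun _ _ h => ⟨h.1, h.2.trans hs⟩) _ _ h1, h2, h3⟩

theorem StackMachine.complexity_anti {M : StackMachine} {s s' : ℕ} (hs : s ≤ s')
    (l : List (List Bool × List Bool)) : M.complexity s' l ≤ M.complexity s l :=
  biInf_mono fun _ h t ht => (h t ht).mono hs

theorem StackMachine.complexity_le {M : StackMachine} {s : ℕ} {l : List (List Bool × List Bool)}
    {p : List Bool} (h : ∀ t ∈ l, M.Computes s p t.2 t.1) : M.complexity s l ≤ p.length :=
  biInf_le (fun p : List Bool => (p.length : ℕ∞)) h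

theorem StackMachine.exists_length_eq_functionComplexity {M : StackMachine} {s : ℕ → ℕ → ℕ}
    {F : List Bool → ℝ} (h : M.functionComplexity s F ≠ ⊤) :
    ∃ p, M.Approximates s p F ∧ (p.length : ℕ∞) = M.functionComplexity s F := by
  have hne : {p : List Bool | M.Approximates s p F}.Nonempty := by
    by_contra hne
    rw [Set.not_nonempty_iff_eq_empty] at hne
    exact h (by simp [functionComplexity, hne])
  have := csInf_mem (hne.image fun p : List Bool => (p.length : ℕ∞))
  rw [sInf_image] at this
  obtain ⟨p, hp, e⟩ := this
  exact ⟨p, hp, e⟩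

namespace Frag

/-! ### The nested intervals of an even semimeasure -/

section Intervals

variable (P : List Bool → ℝ) (y e : ℕ → Bool)

/-- The value of `P` at the string with `i` pairs of bits. -/
def mass (i : ℕ) : ℝ := P (interleave y e i)

/-- The value of `P` at the continuation of the string with `i` pairs of bits in which the next
even bit is `0`. -/
def split (i : ℕ) : ℝ := P (interleave y e i ++ [y i, false])

/-- The lower end of the interval, of length `mass P y e i`, of the string with `i` pairs of
bits. -/
def lowerEnd (i : ℕ) : ℝ := ∑ k ∈ Finset.range i, if e k then split P y e k else 0

variable {P y e}

/-- The odd bit is free by `of_even`. The even bit is governed by `of_odd`: the 1-branch has at most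
the mass that the 0-branch leaves. -/
theorem mass_succ_add (hP : IsEvenSemimeasure P) (i : ℕ) :
    mass P y e (i + 1) + (if e i then split P y e i else 0) ≤ mass P y e i := by
  have h1 := hP.of_even (interleave y e i) (by simp) (y i)
  have h2 := hP.of_odd (interleave y e i ++ [y i]) (by simp)
  have h3 := hP.nonneg (interleave y e i ++ [y i, false])
  have h4 := hP.nonneg (interleave y e i ++ [y i, true])
  simp only [List.append_assoc, List.singleton_append] at h2
  unfold mass split
  rw [interleave_succ]
  cases e i <;> simp <;> linarith

theorem mass_nonneg (hP : IsEvenSemimeasure P) (i : ℕ) : 0 ≤ mass P y e i := hP.nonneg _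

theorem mass_le_one (hP : IsEvenSemimeasure P) (i : ℕ) : mass P y e i ≤ 1 := hP.le_one _

theorem split_nonneg (hP : IsEvenSemimeasure P) (i : ℕ) : 0 ≤ split P y e i := hP.nonneg _

theorem lowerEnd_mono (hP : IsEvenSemimeasure P) {i q : ℕ} (h : i ≤ q) :
    lowerEnd P y e i ≤ lowerEnd P y e q := by
  refine monotone_nat_of_le_succ (fun i => ?_) h
  rw [lowerEnd, lowerEnd, Finset.sum_range_succ]
  have := split_nonneg (y := y) (e := e) hP i
  split_ifs <;> linarith

/-- Together with `lowerEnd_mono` this says that the intervals are nested. -/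
theorem upperEnd_anti (hP : IsEvenSemimeasure P) {i q : ℕ} (h : i ≤ q) :
    lowerEnd P y e q + mass P y e q ≤ lowerEnd P y e i + mass P y e i := by
  refine antitone_nat_of_succ_le (f := fun i => lowerEnd P y e i + mass P y e i) (fun i => ?_) h
  have := mass_succ_add (y := y) (e := e) hP i
  simp only [lowerEnd, Finset.sum_range_succ]
  linarith

theorem mass_anti (hP : IsEvenSemimeasure P) {i q : ℕ} (h : i ≤ q) :
    mass P y e q ≤ mass P y e i := by
  have := lowerEnd_mono (y := y) (e := e) hP h
  have := upperEnd_anti (y := y) (e := e) hP h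
  linarith

/-- Arithmetic decoding with approximate probabilities, if the point `ρ 0` is not too close to the
ends of the intervals. -/
theorem decoding_correct {j : ℕ} {δ : ℝ} {e : ℕ → Bool} {A ρ : ℕ → ℝ} {M r : ℕ → ℕ}
    (hM : ∀ i < j, |A i - M i| ≤ 1) (hr : (r 0 : ℝ) = ρ 0)
    (hsub : ∀ i < j, r (i + 1) = if M i ≤ r i then r i - M i else r i)
    (hρ : ∀ i < j, ρ (i + 1) = ρ i - if e i then A i else 0)
    (h₁ : ∀ i < j, e i = true → A i + δ ≤ ρ i) (h₀ : ∀ i < j, e i = false → ρ i + δ ≤ A i)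
    (hδ : j < δ) {i : ℕ} (hi : i ≤ j) :
    |(r i : ℝ) - ρ i| ≤ i ∧ (i < j → e i = decide (M i ≤ r i)) := by
  -- The remainder is off by at most `i` and the approximation by at most `1`, in total at most `j <
  -- δ`, so the comparison gives the true bit.
  have key : ∀ i < j, |(r i : ℝ) - ρ i| ≤ i → e i = decide (M i ≤ r i) := by
    intro i hi h
    have hM := abs_le.mp (hM i hi)
    have h := abs_le.mp h
    have hij : (i : ℝ) + 1 ≤ j := by exact_mod_cast hi
    cases he : e i
    · have := h₀ i hi he
      have : (r i : ℝ) < M i := by linarith [h.2, hM.2]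
      have : r i < M i := by exact_mod_cast this
      simpa using this
    · have := h₁ i hi he
      have : (M i : ℝ) < r i := by linarith [h.1, hM.1]
      have : M i < r i := by exact_mod_cast this
      simpa using this.le
  suffices h : |(r i : ℝ) - ρ i| ≤ i from ⟨h, fun hj => key i hj h⟩
  induction i with
  | zero => simp [hr]
  | succ i ih =>
    have ih := ih (by omega)
    have hk := key i hi ih
    have hM := abs_le.mp (hM i hi)
    have ih := abs_le.mp ih
    -- By `hk` both sequences subtract in the same cases, so the error grows by at most `1`.
    rw [hsub i hi, hρ i hi, hk]
    rw [abs_le]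
    by_cases hle : M i ≤ r i
    · simp only [hle, if_true, decide_true]
      push_cast [Nat.cast_sub hle]
      constructor <;> linarith [ih.1, ih.2, hM.1, hM.2]
    · simp only [hle, if_false, decide_false, Bool.false_eq_true]
      push_cast
      constructor <;> linarith [ih.1, ih.2]

end Intervals

/-! ### Margins and the size of the remainders -/

section

variable {U : StackMachine} {P : List Bool → ℝ} {s : ℕ → ℕ → ℕ} {p : List Bool}

theorem bitsVal_replicate_false (n : ℕ) : bitsVal (List.replicate n false) = 0 := by
  induction n with
  | zero => rfl
  | succ n ih => simp [List.replicate_succ, ih]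

theorem exists_bitsVal {n l : ℕ} (h : n < 2 ^ l) : ∃ w : List Bool, w.length = l ∧ bitsVal w = n := by
  have : n.bits.length ≤ l := by rw [length_bits]; exact Nat.size_le.mpr h
  refine ⟨n.bits ++ List.replicate (l - n.bits.length) false, by simp; omega, ?_⟩
  rw [bitsVal_append, bitsVal_bits, bitsVal_replicate_false, mul_zero, add_zero]

theorem length_intCode_le {N : ℤ} {k : ℕ} (h : |N| ≤ 2 ^ k + 1) : (intCode N).length ≤ k + 3 := by
  have h1 : N.natAbs < 2 ^ (k + 2) := by
    have h2 : (0 : ℤ) < 2 ^ k := by positivity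
    have h3 : (N.natAbs : ℤ) < 2 ^ (k + 2) := by
      rw [Int.natCast_natAbs, pow_add]; linarith
    exact_mod_cast h3
  have := Nat.size_le.mpr h1
  simp [intCode, natCode, length_bits]
  omega

/-- The remainder at stage `i` is at most `mass P y e i * 2 ^ k`, which by `hd` gives it at most `q
- i + d + j.size + 4` digits. The decrease in `i` compensates for the growth of the decoded string,
so `hB'` bounds the memory at all stages. -/
theorem sexec_decodeLast_of_mass (hP : IsEvenSemimeasure P) (hp : U.Approximates s p P)
    {y e : ℕ → Bool} {w : List Bool} {q j d s₀ B : ℕ} (hj : 0 < j) (hjq : j ≤ q)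
    (hw₁ : (lowerEnd P y e q + mass P y e q / 4) * 2 ^ w.length ≤ bitsVal w.reverse)
    (hw₂ : bitsVal w.reverse ≤ (lowerEnd P y e q + 3 * mass P y e q / 4) * 2 ^ w.length)
    (hl₁ : 2 ≤ 2 ^ w.length * mass P y e q) (hl₂ : 2 ^ w.length * mass P y e q ≤ 4)
    (hd : ∀ i ≤ q, mass P y e i * 2 ^ i ≤ mass P y e q * 2 ^ q * 2 ^ d)
    {k : ℕ} (hk : k = w.length + (j.size + 1))
    (hs : ∀ i < j, s k (2 * i + 2) ≤ s₀)
    (hB : p.length + j + k + 2 * k.size + 1 ≤ B)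
    (hB' : p.length + j + q + d + j.size + 2 * k.size + 6 ≤ B) :
    ∃ S, SExec s₀ B (decodeLast U) (St.ofSide (prefixCode p ++ w) ((List.range j).map y)) () S ∧
      S.output = [e (j - 1)] := by
  have hN : ∀ i, ∃ N : ℤ, |split P y e i - (N : ℝ) / 2 ^ k| ≤ 1 / 2 ^ k ∧
      U.Computes (s k (2 * i + 2)) p (pairCode (natCode k) (interleave y e i ++ [y i, false]))
        (intCode N) := by
    intro i
    have := hp k (interleave y e i ++ [y i, false])
    have e : (interleave y e i ++ [y i, false]).length = 2 * i + 2 := by simp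
    rwa [e] at this
  choose N hN₁ hN₂ using hN
  have h2k : (0 : ℝ) < 2 ^ k := by positivity
  have hN₃ : ∀ i, |split P y e i * 2 ^ k - N i| ≤ 1 := by
    intro i
    have := mul_le_mul_of_nonneg_right (hN₁ i) h2k.le
    rw [div_mul_cancel₀ _ h2k.ne', ← abs_of_pos h2k, ← abs_mul, abs_of_pos h2k, sub_mul,
      div_mul_cancel₀ _ h2k.ne'] at this
    exact this
  have hN₄ : ∀ i, (intCode (N i)).length ≤ k + 3 := by
    intro i
    refine length_intCode_le ?_
    have h1 := abs_le.mp (hN₃ i)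
    have h2 : split P y e i ≤ 1 := hP.le_one _
    have h3 : 0 ≤ split P y e i := split_nonneg hP i
    have h4 : |(N i : ℝ)| ≤ 2 ^ k + 1 := by
      rw [abs_le]
      constructor <;> nlinarith [h1.1, h1.2]
    exact_mod_cast h4
  -- Replacing a negative approximation by `0` moves it closer to the nonnegative true value.
  have hM : ∀ i, |split P y e i * 2 ^ k - ((N i).toNat : ℕ)| ≤ 1 := by
    intro i
    have h1 := hN₃ i
    have h3 : 0 ≤ split P y e i := split_nonneg hP i
    rcases le_or_gt 0 (N i) with h0 | h0
    · have : (((N i).toNat : ℤ) : ℝ) = N i := by rw [Int.toNat_of_nonneg h0]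
      rw [Int.cast_natCast] at this
      rwa [this]
    · have h5 : (N i : ℝ) < 0 := by exact_mod_cast h0
      rw [Int.toNat_of_nonpos h0.le, Nat.cast_zero]
      have h1 := abs_le.mp h1
      have : 0 ≤ split P y e i * 2 ^ k := by positivity
      rw [abs_le]
      constructor <;> linarith [h1.2]
  let r : ℕ → ℕ := fun i => Nat.rec (motive := fun _ => ℕ) (bitsVal (List.replicate (j.size + 1) false ++ w.reverse))
    (fun i r => if (N i).toNat ≤ r then r - (N i).toNat else r) i
  have hsub : ∀ i : ℕ, r (i + 1) = if (N i).toNat ≤ r i then r i - (N i).toNat else r i := fun i => rfl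
  have hr : r 0 = bitsVal (List.replicate (j.size + 1) false ++ w.reverse) := rfl
  have hr' : (r 0 : ℝ) = bitsVal w.reverse * 2 ^ (j.size + 1) := by
    rw [hr, bitsVal_append, bitsVal_replicate_false]
    push_cast
    simp [mul_comm]
  clear_value r
  have hk' : (2 : ℝ) ^ k = 2 ^ w.length * 2 ^ (j.size + 1) := by rw [hk, pow_add]
  set μ := mass P y e q with hμ
  have hj2 : (j : ℝ) < 2 ^ j.size := by exact_mod_cast Nat.lt_size_self j
  have hpos : (0 : ℝ) < 2 ^ (j.size + 1) := by positivity
  have hr₁ : (lowerEnd P y e q + μ / 4) * 2 ^ k ≤ r 0 := by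
    rw [hr', hk', ← mul_assoc]
    exact mul_le_mul_of_nonneg_right hw₁ hpos.le
  have hr₂ : r 0 ≤ (lowerEnd P y e q + 3 * μ / 4) * 2 ^ k := by
    rw [hr', hk', ← mul_assoc]
    exact mul_le_mul_of_nonneg_right hw₂ hpos.le
  -- From `2 ≤ 2 ^ w.length * μ` the right side is at least `2 ^ j.size`.
  have hδ : (j : ℝ) < μ / 4 * 2 ^ k := by
    rw [hk', pow_succ]
    nlinarith
  have corr := fun i hi => decoding_correct (j := j) (δ := μ / 4 * 2 ^ k) (e := e)
    (A := fun i => split P y e i * 2 ^ k) (ρ := fun i => r 0 - lowerEnd P y e i * 2 ^ k)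
    (M := fun i => (N i).toNat) (r := r) (fun i _ => hM i) (by simp [lowerEnd])
    (fun i _ => hsub i)
    (fun i _ => by
      simp only [lowerEnd, Finset.sum_range_succ]
      split_ifs <;> ring)
    (fun i hi he => by
      -- For the bit `1`, the lower end after step `i` is at most that of the final interval, which
      -- lies `μ / 4` below the codeword.
      have h1 := lowerEnd_mono (y := y) (e := e) hP (show i + 1 ≤ q by omega)
      have h2 : lowerEnd P y e (i + 1) = lowerEnd P y e i + split P y e i := by
        simp [lowerEnd, Finset.sum_range_succ, he]
      have := mul_le_mul_of_nonneg_right h1 h2k.le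
      rw [h2] at this
      linarith)
    (fun i hi he => by
      -- For the bit `0`, the 0-branch contains the final interval, whose upper end lies `μ / 4`
      -- above the codeword.
      have h1 := upperEnd_anti (y := y) (e := e) hP (show i + 1 ≤ q by omega)
      have h2 : lowerEnd P y e (i + 1) = lowerEnd P y e i := by
        simp [lowerEnd, Finset.sum_range_succ, he]
      have h3 : mass P y e (i + 1) = split P y e i := by
        rw [mass, interleave_succ, he, split]
      have := mul_le_mul_of_nonneg_right h1 h2k.le
      rw [h2, h3] at this
      linarith) hδ (i := i) hi
  have size_r : ∀ i ≤ j, (r i).size ≤ q - i + d + j.size + 4 := by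
    intro i hi
    have h1 := (abs_le.mp (corr i hi).1).2
    have hij : (i : ℝ) ≤ j := by exact_mod_cast hi
    have h2 := upperEnd_anti (y := y) (e := e) hP (hi.trans hjq)
    have h3 := mul_le_mul_of_nonneg_right h2 h2k.le
    -- The error is at most `j`, hence is absorbed by the quarter of `μ` between the codeword and
    -- the upper end.
    have h4 : (r i : ℝ) ≤ mass P y e i * 2 ^ k := by
      linarith
    have h5 := hd i (hi.trans hjq)
    have h6 : (2 : ℝ) ^ q = 2 ^ (q - i) * 2 ^ i := by
      rw [← pow_add]; congr 1; omega
    have h7 : mass P y e i ≤ μ * 2 ^ (q - i) * 2 ^ d := by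
      have h8 : (0 : ℝ) < 2 ^ i := by positivity
      refine le_of_mul_le_mul_right ?_ h8
      rw [h6] at h5
      linarith
    have h8 : (r i : ℝ) ≤ 4 * 2 ^ (q - i) * 2 ^ d * 2 ^ (j.size + 1) := by
      refine h4.trans ((mul_le_mul_of_nonneg_right h7 h2k.le).trans ?_)
      rw [hk']
      have : (0 : ℝ) ≤ 2 ^ (q - i) * 2 ^ d * 2 ^ (j.size + 1) := by positivity
      have := mul_le_mul_of_nonneg_right hl₂ this
      linarith
    refine Nat.size_le.mpr ?_
    have h9 : (r i : ℝ) < 2 ^ (q - i + d + j.size + 4) := by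
      refine h8.trans_lt ?_
      have : (2 : ℝ) ^ (q - i + d + j.size + 4) = 8 * (2 ^ (q - i) * 2 ^ d * 2 ^ (j.size + 1)) := by
        simp only [pow_add]; ring
      rw [this]
      have : (0 : ℝ) < 2 ^ (q - i) * 2 ^ d * 2 ^ (j.size + 1) := by positivity
      linarith
    exact_mod_cast h9
  have hk1 : 0 < k.size := Nat.size_pos.mpr (by omega)
  refine sexec_decodeLast (N := N) (r := r) hj hk hr (fun i hi => ?_)
    (fun i hi => (hN₄ i).trans (by omega)) (fun i hi => (corr i hi.le).2 hi) (fun i _ => hsub i) hB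
    (fun i hi => ?_)
  · rw [List.append_assoc]
    exact (hN₂ i).mono (hs i hi)
  · have := size_r i hi
    have e : (prefixCode (natCode k)).length = 2 * k.size + 1 := by
      simp [prefixCode, natCode, length_bits, mul_comm]
    omega

end

/-! ### Codewords and the choice of the literal part -/

section

variable {U : StackMachine} {P : List Bool → ℝ} {s : ℕ → ℕ → ℕ} {p : List Bool}
  {y e : ℕ → Bool}

/-- The middle half of the interval has length `mass P y e q / 2`, so it contains a multiple of the
inverse of `2 ^ w.length` as soon as `2 ≤ 2 ^ w.length * mass P y e q`. Choosing the length by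
powers of two overshoots by at most a factor 2, whence the bound 4. -/
theorem exists_codeword (hP : IsEvenSemimeasure P) {q : ℕ} (hq : 0 < mass P y e q) :
    ∃ w : List Bool, (lowerEnd P y e q + mass P y e q / 4) * 2 ^ w.length ≤ bitsVal w.reverse ∧
      bitsVal w.reverse ≤ (lowerEnd P y e q + 3 * mass P y e q / 4) * 2 ^ w.length ∧
      2 ≤ 2 ^ w.length * mass P y e q ∧ 2 ^ w.length * mass P y e q ≤ 4 := by
  have h1 : mass P y e q ≤ 1 := mass_le_one hP q
  have h2 := upperEnd_anti (y := y) (e := e) hP (Nat.zero_le q)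
  have h3 : lowerEnd P y e 0 = 0 := by simp [lowerEnd]
  have h4 : mass P y e 0 ≤ 1 := mass_le_one hP 0
  have h5 := lowerEnd_mono (y := y) (e := e) hP (Nat.zero_le q)
  rw [h3] at h2 h5
  generalize lowerEnd P y e q = a at *
  generalize mass P y e q = μ at *
  obtain ⟨l, hl₁, hl₂⟩ := exists_nat_pow_near (x := 2 / μ) (y := 2)
    (by rw [le_div_iff₀ hq]; linarith) one_lt_two
  rw [le_div_iff₀ hq] at hl₁
  rw [div_lt_iff₀ hq] at hl₂
  have hp : (0 : ℝ) < 2 ^ (l + 1) := by positivity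
  have hn := Nat.le_ceil ((a + μ / 4) * 2 ^ (l + 1))
  have hn' := Nat.ceil_lt_add_one (a := (a + μ / 4) * 2 ^ (l + 1)) (by positivity)
  -- The interval lies in the unit interval, so rounding up within its middle half stays below `1`.
  have hlt : ⌈(a + μ / 4) * 2 ^ (l + 1)⌉₊ < 2 ^ (l + 1) := by
    have : (⌈(a + μ / 4) * 2 ^ (l + 1)⌉₊ : ℝ) < 2 ^ (l + 1) := by nlinarith
    exact_mod_cast this
  obtain ⟨w, hw, e⟩ := exists_bitsVal hlt
  refine ⟨w.reverse, ?_⟩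
  rw [List.reverse_reverse, List.length_reverse, hw, e]
  refine ⟨hn, by nlinarith, hl₂.le, by rw [pow_succ]; linarith⟩

/-- The pile bound `2 * m + 8 * m.size + 14` comes out of these hypotheses: `hpq` limits program
plus `q`, `hdm` limits the excess, and `hq` limits the length of the codeword. Nothing is decoded
when `q = 0`, so `hpq` is asked only for positive `q`. -/
theorem exists_encoding (hP : IsEvenSemimeasure P) (hp : U.Approximates s p P)
    {m q d s₀ k₀ : ℕ} (hqm : q ≤ m) (hq : 1 ≤ mass P y e q * 2 ^ (m + 4 * m.size))
    (hpq : 0 < q → p.length + q ≤ m + m.size) (hdm : d ≤ 4 * m.size)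
    (hd : ∀ i ≤ q, mass P y e i * 2 ^ i ≤ mass P y e q * 2 ^ q * 2 ^ d)
    (hs : ∀ k n, k ≤ k₀ → n ≤ 2 * m → s k n ≤ s₀)
    (hk₀ : ∀ k : ℕ, 2 ^ k * mass P y e q ≤ 16 * m → k ≤ k₀) :
    ∃ w : List Bool, 2 ^ w.length * mass P y e q ≤ 4 ∧ ∀ j, 0 < j → j ≤ q →
      ∃ S, SExec s₀ (2 * m + 8 * m.size + 14) (decodeLast U)
        (St.ofSide (prefixCode p ++ w) ((List.range j).map y)) () S ∧ S.output = [e (j - 1)] := by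
  have hpos : 0 < mass P y e q := by
    by_contra h
    have : mass P y e q * 2 ^ (m + 4 * m.size) ≤ 0 :=
      mul_nonpos_of_nonpos_of_nonneg (not_lt.mp h) (by positivity)
    linarith
  obtain ⟨w, hw₁, hw₂, hl₁, hl₂⟩ := exists_codeword hP hpos
  refine ⟨w, hl₂, fun j hj hjq => ?_⟩
  have hw : w.length ≤ m + 4 * m.size + 2 := by
    have : (2 : ℝ) ^ w.length ≤ 2 ^ (m + 4 * m.size + 2) := by
      have h1 := mul_le_mul_of_nonneg_left hq (show (0 : ℝ) ≤ 2 ^ w.length by positivity)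
      have h2 := mul_le_mul_of_nonneg_right hl₂
        (show (0 : ℝ) ≤ 2 ^ (m + 4 * m.size) by positivity)
      rw [pow_add _ _ 2]
      linarith
    exact (pow_le_pow_iff_right₀ one_lt_two).mp this
  have hpq := hpq (by omega)
  have hjs : j.size ≤ m.size := Nat.size_le_size (hjq.trans hqm)
  have hks : (w.length + (j.size + 1)).size ≤ m.size + 4 := by
    refine Nat.size_le.mpr ?_
    have h1 := Nat.lt_size_self m
    have h2 : m.size < 2 ^ m.size := Nat.lt_two_pow_self
    rw [pow_add]
    omega
  have hjj : 2 ^ j.size ≤ 2 * j := by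
    have := size_half hj
    rw [this, pow_succ, mul_comm]
    have h1 : 2 ^ (j.size - 1) ≤ j := by
      rw [← not_lt, ← Nat.size_le]
      omega
    rw [this, Nat.add_sub_cancel] at h1
    omega
  refine sexec_decodeLast_of_mass hP hp hj hjq hw₁ hw₂ hl₁ hl₂ hd rfl (fun i hi => ?_) (by omega)
    (by omega)
  refine hs _ _ (hk₀ _ ?_) (by omega)
  -- The precision satisfies 2^k μ = (2^|w| μ) · 2^(size j) · 2 ≤ 4 · 2j · 2 = 16 j ≤ 16 m.
  have h1 : (2 : ℝ) ^ j.size ≤ 2 * j := by exact_mod_cast hjj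
  have h2 : (j : ℝ) ≤ m := by exact_mod_cast hjq.trans hqm
  have h3 : (0 : ℝ) < 2 ^ j.size := by positivity
  rw [pow_add, pow_succ]
  nlinarith

theorem length_prefixCode_natCode (n : ℕ) : (prefixCode (natCode n)).length = 2 * n.size + 1 := by
  simp [prefixCode, natCode, length_bits, mul_comm]

theorem logb_add_le {a b : ℝ} (ha : 0 < a) {i j : ℕ} (h : a * 2 ^ i ≤ b * 2 ^ j) :
    Real.logb 2 a + i ≤ Real.logb 2 b + j := by
  have hb : 0 < b := by
    by_contra hb
    have h1 : b * 2 ^ j ≤ 0 := mul_nonpos_of_nonpos_of_nonneg (not_lt.mp hb) (by positivity)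
    have h2 : 0 < a * 2 ^ i := by positivity
    linarith
  have := Real.logb_le_logb_of_le one_lt_two (by positivity) h
  rwa [Real.logb_mul ha.ne' (by positivity), Real.logb_mul hb.ne' (by positivity),
    Real.logb_pow, Real.logb_pow, Real.logb_self_eq_one one_lt_two, mul_one, mul_one] at this

/-- Some program makes the decoding machine compute the first `m` even bits. -/
theorem exists_program (hP : IsEvenSemimeasure P) (hp : U.Approximates s p P) {m s₀ k₀ : ℕ}
    (hm : 0 < mass P y e m) (hs : ∀ k n, k ≤ k₀ → n ≤ 2 * m → s k n ≤ s₀)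
    (hk₀ : ∀ k : ℕ, 2 ^ k * mass P y e m ≤ 16 * m → k ≤ k₀) :
    ∃ u : List Bool, (u.length : ℝ) ≤ 7 * p.length + 8 - Real.logb 2 (mass P y e m) ∧
      ∀ j, 0 < j → j ≤ m → ∃ S, SExec s₀ (2 * m + 8 * m.size + 14) (decoder U)
        ⟨u, (List.range j).map y, [], fun _ => [], [], [], [], [], [], [], [], 0, 0, 0, 0, 0⟩ () S ∧
        S.output = [e (j - 1)] := by
  -- a part of the bits is given literally
  have literal : ∀ (q : ℕ) (p w : List Bool), q ≤ m → (∀ j, 0 < j → j ≤ q →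
      ∃ S, SExec s₀ (2 * m + 8 * m.size + 14) (decodeLast U)
        (St.ofSide (prefixCode p ++ w) ((List.range j).map y)) () S ∧ S.output = [e (j - 1)]) →
      ∃ u : List Bool, u.length = 2 * q.size + 2 * (m - q).size + 4 + (m - q) + 2 * p.length +
          w.length ∧
        ∀ j, 0 < j → j ≤ m → ∃ S, SExec s₀ (2 * m + 8 * m.size + 14) (decoder U)
          ⟨u, (List.range j).map y, [], fun _ => [], [], [], [], [], [], [], [], 0, 0, 0, 0, 0⟩
          () S ∧ S.output = [e (j - 1)] := by
    intro q p w hq h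
    have hl : ((List.range (m - q)).map fun i => e (q + i)).length = m - q := by simp
    refine ⟨true :: (prefixCode (natCode q) ++
      (prefixCode (natCode ((List.range (m - q)).map fun i => e (q + i)).length) ++
        (((List.range (m - q)).map fun i => e (q + i)) ++ (prefixCode p ++ w)))), ?_, ?_⟩
    · simp only [List.length_cons, List.length_append, length_prefixCode_natCode, hl]
      simp [prefixCode, mul_comm]
      ring
    · intro j hj hjm
      rcases le_or_gt j q with hjq | hjq
      · obtain ⟨S, hS, hout⟩ := h j hj hjq
        exact ⟨S, sexec_decoder_skip (by simp; omega) (by omega) (by simp; omega) (by simpa) hS,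
          hout⟩
      · obtain ⟨S, hS, hout⟩ := sexec_decoder_lookup (U := U) (s := s₀)
          (B := 2 * m + 8 * m.size + 14) (ys := (List.range j).map y)
          (l := (List.range (m - q)).map fun i => e (q + i)) (u := prefixCode p ++ w)
          (q := q) (i := j - q - 1) (by simp; omega) (by omega) (by simp; omega) (by simp; omega)
          (by simp; omega)
        refine ⟨S, hS, ?_⟩
        rw [hout]
        simp only [List.getElem_map, List.getElem_range]
        congr 2
        omega
  -- very small values of `P`
  by_cases h0 : mass P y e m * 2 ^ (m + 4 * m.size) ≤ 1
  · obtain ⟨u, hu, h⟩ := literal 0 [] [] (Nat.zero_le _) (fun j hj hj' => by omega)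
    refine ⟨u, ?_, h⟩
    -- The literal program has `m + 2 * m.size + 4` symbols, and here the logarithm of the inverse
    -- mass is at least `m + 4 * m.size`.
    have := logb_add_le (j := 0) (b := 1) hm (by simpa using h0)
    have h1 : (0 : ℝ) ≤ p.length := Nat.cast_nonneg _
    have h2 : (0 : ℝ) ≤ m.size := Nat.cast_nonneg _
    rw [hu]
    push_cast at this ⊢
    simp at this ⊢
    linarith
  have hq : ∀ q ≤ m, 1 ≤ mass P y e q * 2 ^ (m + 4 * m.size) := by
    intro q hq
    exact (not_le.mp h0).le.trans
      (mul_le_mul_of_nonneg_right (mass_anti hP hq) (by positivity))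
  have hk : ∀ q ≤ m, ∀ k : ℕ, 2 ^ k * mass P y e q ≤ 16 * m → k ≤ k₀ := by
    intro q hq k h
    exact hk₀ k ((mul_le_mul_of_nonneg_left (mass_anti hP hq) (by positivity)).trans h)
  have argmax : ∀ a, ∃ q ≤ a, ∀ i ≤ a, mass P y e i * 2 ^ i ≤ mass P y e q * 2 ^ q := by
    intro a
    obtain ⟨q, hq, h⟩ := Finset.exists_max_image (Finset.range (a + 1))
      (fun i => mass P y e i * 2 ^ i) ⟨0, by simp⟩
    simp only [Finset.mem_range, Nat.lt_succ_iff] at hq h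
    exact ⟨q, hq, h⟩
  -- Accounting for a literal part after `q`: `b` is a guaranteed gain in bits, `c` a tolerated
  -- loss, and `4 * m.size` bounds the cost of the numbers `q` and `m - q`.
  have literal' : ∀ (q b c : ℕ), q ≤ m → (0 < q → p.length + q ≤ m + m.size) →
      (∀ i ≤ q, mass P y e i * 2 ^ i ≤ mass P y e q * 2 ^ q) →
      mass P y e m * 2 ^ (m + b) ≤ mass P y e q * 2 ^ (q + c) → 4 * m.size + c ≤ b + 5 * p.length →
      ∃ u : List Bool, (u.length : ℝ) ≤ 7 * p.length + 8 - Real.logb 2 (mass P y e m) ∧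
      ∀ j, 0 < j → j ≤ m → ∃ S, SExec s₀ (2 * m + 8 * m.size + 14) (decoder U)
        ⟨u, (List.range j).map y, [], fun _ => [], [], [], [], [], [], [], [], 0, 0, 0, 0, 0⟩ () S ∧
        S.output = [e (j - 1)] := by
    intro q b c hqm hpq hmax hbc hle
    obtain ⟨w, hw, h⟩ := exists_encoding (s₀ := s₀) (d := 0) hP hp hqm (hq q hqm) hpq
      (Nat.zero_le _) (fun i hi => by simpa using hmax i hi) hs (hk q hqm)
    obtain ⟨u, hu, h⟩ := literal q p w hqm h
    refine ⟨u, ?_, h⟩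
    have h1 := logb_add_le hm hbc
    have hqpos : 0 < mass P y e q := hm.trans_le (mass_anti hP hqm)
    have h2 := logb_add_le (i := w.length) (b := 1) (j := 2) hqpos (by linarith)
    have h3 : q.size ≤ m.size := Nat.size_le_size hqm
    have h4 : (m - q).size ≤ m.size := Nat.size_le_size (Nat.sub_le _ _)
    have h6 : u.length + q + c ≤ m + b + 4 + 7 * p.length + w.length := by omega
    have h7 : (u.length + q + c : ℝ) ≤ m + b + 4 + 7 * p.length + w.length := by exact_mod_cast h6
    push_cast at h1 h2
    rw [Real.logb_one] at h2
    linarith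
  -- A long program pays for the numbers itself, but leaves room for decoding at most `m - p.length`
  -- pairs. If this truncated difference is `0`, all even bits are literal.
  rcases le_or_gt m.size p.length with h1 | h1
  · obtain ⟨q, hqm, hmax⟩ := argmax (m - p.length)
    refine literal' q 0 p.length (by omega) (by omega) (fun i hi => hmax i (hi.trans hqm)) ?_
      (by omega)
    have h2 := hmax _ le_rfl
    have h3 : mass P y e m ≤ mass P y e (m - p.length) := mass_anti hP (Nat.sub_le _ _)
    have h4 : (2 : ℝ) ^ m ≤ 2 ^ (m - p.length) * 2 ^ p.length := by
      rw [← pow_add]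
      exact pow_le_pow_right₀ one_le_two (by omega)
    calc mass P y e m * 2 ^ (m + 0) ≤ mass P y e (m - p.length) * (2 ^ (m - p.length) * 2 ^ p.length) :=
          mul_le_mul h3 h4 (by positivity) (mass_nonneg hP _)
      _ = mass P y e (m - p.length) * 2 ^ (m - p.length) * 2 ^ p.length := by ring
      _ ≤ mass P y e q * 2 ^ q * 2 ^ p.length := mul_le_mul_of_nonneg_right h2 (by positivity)
      _ = mass P y e q * 2 ^ (q + p.length) := by rw [pow_add]; ring
  obtain ⟨q, hqm, hmax⟩ := argmax m
  -- For a short program, either stopping at the maximizer `q` gains the `4 * m.size` bits that the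
  -- numbers cost, or `m` itself is maximal up to a factor `2 ^ (4 * m.size)`, and no literal part
  -- is needed.
  rcases le_or_gt (mass P y e m * 2 ^ (m + 4 * m.size)) (mass P y e q * 2 ^ q) with h2 | h2
  · exact literal' q (4 * m.size) 0 hqm (by omega) (fun i hi => hmax i (hi.trans hqm)) h2
      (by omega)
  obtain ⟨w, hw, h⟩ := exists_encoding (s₀ := s₀) (d := 4 * m.size) hP hp le_rfl (hq m le_rfl)
    (by omega) le_rfl (fun i hi => by
      have := hmax i hi
      rw [pow_add] at h2
      linarith) hs (hk m le_rfl)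
  refine ⟨false :: (prefixCode p ++ w), ?_, fun j hj hjm => ?_⟩
  · have h3 := logb_add_le (i := w.length) (b := 1) (j := 2) hm (by linarith)
    have h4 : (false :: (prefixCode p ++ w)).length = 2 * p.length + 2 + w.length := by
      simp [prefixCode, mul_comm]
      ring
    have h5 : (0 : ℝ) ≤ p.length := Nat.cast_nonneg _
    rw [Real.logb_one] at h3
    rw [h4]
    push_cast at h3 ⊢
    linarith
  · obtain ⟨S, hS, hout⟩ := h j hj hjm
    exact ⟨S, sexec_decoder_false (by simp; omega) hS, hout⟩

/-! ### From pairs of bits back to strings and tasks -/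

theorem interleave_getD (x : List Bool) {i : ℕ} (hi : 2 * i ≤ x.length) :
    interleave (fun i => x.getD (2 * i) false) (fun i => x.getD (2 * i + 1) false) i =
      x.take (2 * i) := by
  induction i with
  | zero => rfl
  | succ i ih =>
    have h1 : 2 * i < x.length := by omega
    have h2 : 2 * i + 1 < x.length := by omega
    have e₁ : x.take (2 * (i + 1)) = x.take (2 * i + 1) ++ [x[2 * i + 1]] :=
      (List.take_append_getElem h2).symm
    rw [interleave_succ, ih (by omega), e₁, ← List.take_append_getElem h1,
      List.getD_eq_getElem _ _ h1, List.getD_eq_getElem _ _ h2, List.append_assoc]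
    rfl

/-- If the length is odd, the last bit belongs to no pair, and it does not change `P` by `of_even`.
-/
theorem mass_eq (hP : IsEvenSemimeasure P) (x : List Bool) :
    mass P (fun i => x.getD (2 * i) false) (fun i => x.getD (2 * i + 1) false) (x.length / 2) =
      P x := by
  have hl : 2 * (x.length / 2) ≤ x.length := Nat.mul_div_le _ _
  rw [mass, interleave_getD x hl]
  rcases Nat.even_or_odd' x.length with ⟨k, hk | hk⟩
  · rw [List.take_of_length_le (by omega)]
  · have h1 : 2 * (x.length / 2) < x.length := by omega
    rw [← hP.of_even (x.take (2 * (x.length / 2))) (by simp [hl]) (x[2 * (x.length / 2)]),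
      List.take_append_getElem h1, List.take_of_length_le (by omega)]

theorem mem_evenTasks {x : List Bool} {t : List Bool × List Bool} (ht : t ∈ evenTasks x) :
    ∃ j, 0 < j ∧ j ≤ x.length / 2 ∧ t = ([x.getD (2 * (j - 1) + 1) false],
      (List.range j).map fun i => x.getD (2 * i) false) := by
  simp only [evenTasks, List.mem_ofFn] at ht
  obtain ⟨j, rfl⟩ := ht
  have hj := j.2
  refine ⟨j + 1, by omega, by omega, ?_⟩
  congr 1
  · simp [show 2 * j.1 + 1 < x.length by omega]
  · refine List.ext_getElem (by simp) fun i h1 h2 => ?_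
    simp at h1
    simp [-List.ofFn_succ, show 2 * i < x.length by omega]

/-- Since log |x| ≥ 1, the `L + 3` tokens of the counter block number at most log |x| + 8 ≤ 9 log
|x|, and the logarithmic part of the piles is at most 8 log |x| + 14 ≤ 22 log |x|. -/
theorem complexity_decodingMachine_le (hP : IsEvenSemimeasure P) (hp : U.Approximates s p P)
    (hs : ∀ k k' n n' : ℕ, k ≤ k' → n ≤ n' → s k n ≤ s k' n') {x : List Bool}
    (hx : 2 ≤ x.length) (hPx : 0 < P x) :
    ∃ u : List Bool, (u.length : ℝ) ≤ 7 * p.length + 8 + Real.logb 2 (1 / P x) ∧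
      (decodingMachine U).complexity
        (s ⌈Real.logb 2 (8 * (x.length : ℝ) / P x)⌉₊ x.length + x.length +
          (9 * tokenWidth (PileCounter 7 (Fin 6)) + 22) * Nat.log 2 x.length) (evenTasks x) ≤
        u.length := by
  have hm := mass_eq hP x
  have h2 : 2 * (x.length / 2) ≤ x.length := Nat.mul_div_le _ _
  obtain ⟨u, hu, h⟩ := exists_program (U := U)
    (s₀ := s ⌈Real.logb 2 (8 * (x.length : ℝ) / P x)⌉₊ x.length)
    (k₀ := ⌈Real.logb 2 (8 * (x.length : ℝ) / P x)⌉₊) hP hp (hm ▸ hPx)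
    (fun k n hk hn => hs _ _ _ _ hk (hn.trans h2)) (fun k hk => by
      rw [hm] at hk
      have h3 : (2 : ℝ) * ((x.length / 2 : ℕ) : ℝ) ≤ x.length := by exact_mod_cast h2
      -- With `m` equal to half the length, `16 * m` is at most `8 * x.length`.
      have h4 : (2 : ℝ) ^ k ≤ 8 * x.length / P x := by
        rw [le_div_iff₀ hPx]; linarith
      have h5 := Real.logb_le_logb_of_le one_lt_two (by positivity) h4
      rw [Real.logb_pow, Real.logb_self_eq_one one_lt_two, mul_one] at h5
      exact_mod_cast h5.trans (Nat.le_ceil _))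
  refine ⟨u, ?_, complexity_le fun t ht => ?_⟩
  · rw [hm] at hu
    rw [one_div, Real.logb_inv]
    linarith
  · obtain ⟨j, hj, hjm, rfl⟩ := mem_evenTasks ht
    obtain ⟨S, hS, hout⟩ := h j hj hjm
    have := computes_decodingMachine hS
    rw [hout] at this
    refine this.mono ?_
    have hsz : (x.length / 2).size ≤ Nat.log 2 x.length := by
      refine Nat.size_le.mpr ?_
      have := Nat.lt_pow_succ_log_self one_lt_two x.length
      rw [Nat.succ_eq_add_one, pow_succ] at this
      omega
    have hlog : 1 ≤ Nat.log 2 x.length := Nat.log_pos one_lt_two hx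
    have hB : (2 * (x.length / 2) + 8 * (x.length / 2).size + 14).size ≤ Nat.log 2 x.length + 5 := by
      refine (Nat.size_le (n := (x.length / 2).size + 5)).mpr ?_ |>.trans (by omega)
      have h1 := Nat.lt_size_self (x.length / 2)
      have h2 : (x.length / 2).size < 2 ^ (x.length / 2).size := Nat.lt_two_pow_self
      rw [pow_add]
      omega
    rw [counterSpace]
    have h6 : tokenWidth (PileCounter 7 (Fin 6)) *
        ((2 * (x.length / 2) + 8 * (x.length / 2).size + 14).size + 3) ≤
        tokenWidth (PileCounter 7 (Fin 6)) * (9 * Nat.log 2 x.length) :=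
      Nat.mul_le_mul_left _ (by omega)
    have h7 : tokenWidth (PileCounter 7 (Fin 6)) * (9 * Nat.log 2 x.length) =
      9 * tokenWidth (PileCounter 7 (Fin 6)) * Nat.log 2 x.length := by ring
    rw [add_mul]
    omega

end

end Frag

/-! ### Transfer to the optimal machine -/

theorem proposition4 (U : StackMachine) (hU : U.IsOptimal) :
    ∃ c : ℕ, ∀ s : ℕ → ℕ → ℕ,
      (∀ k k' n n' : ℕ, k ≤ k' → n ≤ n' → s k n ≤ s k' n') →
      ∀ P : List Bool → ℝ, IsEvenSemimeasure P →
      ∀ x : List Bool, 0 < P x →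
        ((U.evenComplexity
            (s ⌈Real.logb 2 (8 * (x.length : ℝ) / P x)⌉₊ x.length + x.length
              + c * Nat.log 2 x.length) x : ENNReal) : EReal)
          ≤ (Real.logb 2 (1 / P x) : EReal)
            + (c : EReal) * (((U.functionComplexity s P + 1 : ℕ∞) : ENNReal) : EReal) := by
  obtain ⟨a, ha⟩ := hU (Frag.decodingMachine U)
  refine ⟨9 * Frag.tokenWidth (Frag.PileCounter 7 (Fin 6)) + 22 + a, fun s hs P hP x hx => ?_⟩
  generalize hW : 9 * Frag.tokenWidth (Frag.PileCounter 7 (Fin 6)) + 22 = W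
  have hW' : 22 ≤ W := by omega
  by_cases htop : U.functionComplexity s P = ⊤
  · rw [htop]
    have : (((W + a : ℕ) : EReal) * (((⊤ + 1 : ℕ∞) : ENNReal) : EReal)) = ⊤ := by
      rw [top_add, ENat.toENNReal_top, EReal.coe_ennreal_top]
      exact EReal.mul_top_of_pos (by exact_mod_cast (by omega : 0 < W + a))
    rw [this]
    simp
  obtain ⟨p, hp, hpl⟩ := StackMachine.exists_length_eq_functionComplexity htop
  rw [← hpl]
  suffices h : ∃ n : ℕ, U.evenComplexity
      (s ⌈Real.logb 2 (8 * (x.length : ℝ) / P x)⌉₊ x.length + x.length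
        + (W + a) * Nat.log 2 x.length) x ≤ n ∧
      (n : ℝ) ≤ Real.logb 2 (1 / P x) + (W + a) * (p.length + 1) by
    obtain ⟨n, h1, h2⟩ := h
    calc _ ≤ (((n : ℕ∞) : ENNReal) : EReal) := by
          exact_mod_cast h1
      _ = ((n : ℝ) : EReal) := by
        rw [ENat.toENNReal_coe]
        rfl
      _ ≤ ((Real.logb 2 (1 / P x) + (W + a) * (p.length + 1) : ℝ) : EReal) := by exact_mod_cast h2
      _ = _ := by
        push_cast
        rfl
  have hL : 0 ≤ Real.logb 2 (1 / P x) :=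
    Real.logb_nonneg one_lt_two (by rw [le_div_iff₀ hx, one_mul]; exact hP.le_one x)
  rcases lt_or_ge x.length 2 with h2 | h2
  -- Strings with fewer than two bits give no tasks, so the empty program suffices. The bound is
  -- nonnegative because `P x ≤ 1`.
  · refine ⟨0, ?_, by push_cast; positivity⟩
    refine StackMachine.complexity_le (p := []) fun t ht => ?_
    obtain ⟨j, hj, hjm, -⟩ := Frag.mem_evenTasks ht
    omega
  obtain ⟨u, hu, h⟩ := Frag.complexity_decodingMachine_le hP hp hs h2 hx
  refine ⟨u.length + a, ?_, ?_⟩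
  · rw [hW] at h
    -- The additive space overhead `a` of the simulation is absorbed by `a * Nat.log 2 x.length`.
    have hlog := Nat.le_mul_of_pos_right a (Nat.log_pos one_lt_two h2)
    refine (StackMachine.complexity_anti ?_ _).trans ((ha (s ⌈Real.logb 2 (8 * (x.length : ℝ) / P x)⌉₊
      x.length + x.length + W * Nat.log 2 x.length) _).trans ?_)
    · rw [add_mul]
      omega
    · push_cast
      exact add_le_add_left h _
  -- The overhead `7 * p.length + 8 + a` is at most `(W + a) * (p.length + 1)`, as `W` is at least
  -- 22.
  · have h3 : (22 : ℝ) ≤ W := by exact_mod_cast hW'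
    have h4 : (0 : ℝ) ≤ p.length := Nat.cast_nonneg _
    have h5 : (0 : ℝ) ≤ a := Nat.cast_nonneg _
    push_cast
    nlinarith
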